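/- Let $d\ge 1$. Let $(\xi_{\mathbf n})_{\mathbf n\in\mathbb Z^d}$ be a strictly stationary random field on a probability space, with values in a measurable space $E$, and let $\le$ and $\wedge$ denote the coordinatewise order and minimum on $\mathbb Z^d$. Put $\mathcal F_{\mathbf k}=\sigma(\xi_{\mathbf u},\ \mathbf u\le\mathbf k)$ and let $X_{\mathbf k}=f(\xi_{\mathbf j},\ \mathbf j\le\mathbf k)$, that is, $X_{\mathbf k}=f\big((\xi_{\mathbf k+\mathbf j})_{\mathbf j\le\mathbf 0}\big)$, $\mathbf k\in\mathbb Z^d$, where $f$ is a real-valued measurable function and $X_{\mathbf 0}$ is integrable. Assume that the filtration is commuting in the following sense: for all integers $a\ge u$, all $\mathbf b,\mathbf v\in\mathbb Z^{d-1}$ and every integrable random variable $Y$, $$E\big(E(Y\mid\mathcal F_{a,\mathbf b})\mid\mathcal F_{u,\mathbf v}\big)=E\big(Y\mid\mathcal F_{u,\mathbf b\wedge\mathbf v}\big)\quad\text{a.s.}$$ For $\mathbf n\ge\mathbf 1=(1,\dots,1)$ write $|\mathbf n|=n_1\cdots n_d$ and $S_{\mathbf n}=\sum_{\mathbf 1\le\mathbf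 k\le\mathbf n}X_{\mathbf k}$, and let $\|\cdot\|$ be the norm in $L^2$. Assume that $$\sum_{\mathbf u\ge\mathbf 1}\frac{1}{|\mathbf u|^{3/2}}\,\big\|E(S_{\mathbf u}\mid\mathcal F_{\mathbf 1})\big\|<\infty ,$$ and that the shift $T_1$ in the first coordinate, $(T_1x)_{\mathbf j}=x_{\mathbf j+(1,0,\dots,0)}$ for $x\in E^{\mathbb Z^d}$, is ergodic with respect to the law of $(\xi_{\mathbf n})_{\mathbf n\in\mathbb Z^d}$. Then the variables $S_{\mathbf n}$ are square integrable and there is a constant $c\in\mathbb R$ such that $$\frac{1}{|\mathbf n|}E(S_{\mathbf n}^2)\to c^2\quad\text{as }\min(n_1,\dots,n_d)\to\infty$$ and $$\frac{1}{\sqrt{|\mathbf n|}}S_{\mathbf n}\Rightarrow N(0,c^2)\quad\text{as }\min(n_1,\dots,n_d)\to\infty ,$$ where $\Rightarrow$ is convergence in distribution and $N(0,0)$ is the point mass at $0$. -/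

import Mathlib

open MeasureTheory ProbabilityTheory Filter Topology

namespace RandomField

variable {d : ℕ} {Ω E : Type*}

/-- The shift by one unit in the `i`-th coordinate direction on configurations
`x = (x_j)`, `j ∈ ℤ^d`. -/
def shift (i : Fin d) (x : (Fin d → ℤ) → E) : (Fin d → ℤ) → E :=
  fun j => x (j + Pi.single i 1)

/-- The configuration `ω ↦ (ξ_j ω)`, `j ∈ ℤ^d`, of the field `ξ`. -/
def path (ξ : (Fin d → ℤ) → Ω → E) (ω : Ω) : (Fin d → ℤ) → E :=
  fun j => ξ j ω

/-- (Strict) stationarity: for each `k ∈ ℤ^d`, the translated field `(ξ_{j+k})` has the same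
joint law as `(ξ_j)`. -/
def IsStationary [MeasurableSpace Ω] [MeasurableSpace E] (μ : Measure Ω)
    (ξ : (Fin d → ℤ) → Ω → E) : Prop :=
  ∀ k : Fin d → ℤ, μ.map (path fun j => ξ (j + k)) = μ.map (path ξ)

/-- The filtration `ℱ_k = σ(ξ_u, u ≤ k)`, where `≤` is the coordinatewise order on `ℤ^d`. -/
abbrev sigmaField [MeasurableSpace E] (ξ : (Fin d → ℤ) → Ω → E) (k : Fin d → ℤ) :
    MeasurableSpace Ω :=
  ⨆ u ∈ Set.Iic k, MeasurableSpace.comap (ξ u) inferInstance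

/-- The filtration commutes in the last `d - 1` coordinates: for `k = (a, b)` and `l = (u, v)` with
`a ≥ u` in `ℤ` and `b, v ∈ ℤ^{d-1}`, and each integrable `Y`,
`E(E(Y | ℱ_{a,b}) | ℱ_{u,v}) = E(Y | ℱ_{u, b ∧ v})` almost surely. As `u = a ∧ u`, the index
`(u, b ∧ v)` is the coordinatewise minimum `k ⊓ l`. -/
def IsCommuting [NeZero d] [MeasurableSpace Ω] [MeasurableSpace E] (μ : Measure Ω)
    (ξ : (Fin d → ℤ) → Ω → E) : Prop :=
  ∀ Y : Ω → ℝ, Integrable Y μ → ∀ k l : Fin d → ℤ, l 0 ≤ k 0 →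
    μ[μ[Y | sigmaField ξ k] | sigmaField ξ l] =ᵐ[μ] μ[Y | sigmaField ξ (k ⊓ l)]

/-- The field `X_k = f(ξ_j, j ≤ k)`: the function `f` of the configuration
`(ξ_{k+j})`, `j ≤ 0`, seen from `k`. -/
def field (f : (Set.Iic (0 : Fin d → ℤ) → E) → ℝ) (ξ : (Fin d → ℤ) → Ω → E)
    (k : Fin d → ℤ) (ω : Ω) : ℝ :=
  f fun j => ξ (k + (j : Fin d → ℤ)) ω

/-- The partial sum `S_n = ∑_{1 ≤ k ≤ n} X_k`. -/
noncomputable def partialSum (X : (Fin d → ℤ) → Ω → ℝ) (n : Fin d → ℤ) (ω : Ω) : ℝ :=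
  ∑ k ∈ Finset.Icc 1 n, X k ω

/-- `|n| = n_1 ⋯ n_d`. -/
noncomputable def size (n : Fin d → ℤ) : ℝ :=
  ∏ i, (n i : ℝ)

end RandomField

/-! The proof moves to `L²` of the law of the field. Let `U_i` be the isometry induced by the shift
in direction `i`, and `P_i` the conditional expectation given the coordinates `ξ_u` with `u_i ≤ 0`.
Letting corners of orthants go to infinity in the commuting hypothesis shows that the `P_i` commute
and that their product is the projection on `σ(ξ_u, u ≤ 0)`. Moreover `P_i` commutes with `U_j` for
`j ≠ i`, and `P_i U_i P_i = P_i U_i`. Hence every direction looks like a stationary sequence with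
its past, and one-dimensional arguments can be iterated over the directions. Writing `S_i(n) =
∑_{k<n} U_i^k` and `F` for the function giving `X_0`, the hypothesis becomes `∑ ∏ n_i^(-3/2) ‖∏ P_i
S_i(n_i) F‖ < ∞`.

Moment bound. A doubling argument in one direction, iterated over the directions, bounds `‖∏
S_i(n_i) F‖` by `√|n|` times a sum over powers of two (`enorm_boxSum_le`), and subadditivity
compares this dyadic sum with the given one (`nestedSum_dyadic_le`).

Martingale approximation. The averages `A_i = N⁻¹ P_i S_i(N)` tend to zero on `F`, so by the moment
bound `F` may be replaced by `∏ (1 - A_i) F`, which has the form `∏ (1 - P_i U_i) g`. Since `1 - P_i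
U_i = (1 - P_i) U_i + (1 - U_i)` and the last term telescopes, the box sums are close to those of `∏
(1 - P_i) U_i g`, a martingale difference in every direction (`exists_martingale_approx`). A bounded
`g` can be used.

Central limit theorem for orthomartingale differences with one ergodic direction
(`IsShiftSystem.tendsto_charFun`). The induction adds one direction at a time, starting from the
ergodic one. In a new direction the normalised sums `R` over the old ones form a stationary sequence
of martingale differences, and what is needed is a law of large numbers for their squares on long
blocks. The square is replaced by `(2/c²)(1 - cos (c R))`. The induction hypothesis applied to sums
and differences of two translates of `h` shows that the cosines of two translates of `R` are
asymptotically uncorrelated, and a variance computation concludes; no ergodicity in the new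
direction is used.

Finally the approximations are Cauchy in norm, which yields `c`, and Lévy's continuity theorem gives
convergence in distribution. -/

namespace RandomField

open scoped ENNReal RealInnerProductSpace

/-! ### One direction: doubling inequality, martingale differences and coboundaries. -/

section SingleShift

variable {H : Type*} [NormedAddCommGroup H] [InnerProductSpace ℝ H]

/-- An isometry `U` and an orthogonal projection `P` such that the range of `P` is contained in
its image under `U`, as for the shift of a stationary sequence and the projection on its past. -/
structure IsShiftProj (U P : H →L[ℝ] H) : Prop where
  norm_shift : ∀ x, ‖U x‖ = ‖x‖
  proj_idem : P * P = P
  proj_symm : ∀ x y, ⟪P x, y⟫ = ⟪x, P y⟫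
  -- Equivalently, `U` maps the kernel of `P` into itself: what is orthogonal to the past stays so
  -- after a shift.
  proj_shift_proj : P * U * P = P * U

/-- The operator `∑_{k < n} U^k`. -/
noncomputable def powSum (U : H →L[ℝ] H) (n : ℕ) : H →L[ℝ] H := ∑ k ∈ Finset.range n, U ^ k

@[simp] lemma powSum_zero (U : H →L[ℝ] H) : powSum U 0 = 0 := by simp [powSum]

@[simp] lemma powSum_one (U : H →L[ℝ] H) : powSum U 1 = 1 := by simp [powSum]

lemma powSum_succ (U : H →L[ℝ] H) (n : ℕ) : powSum U (n + 1) = powSum U n + U ^ n :=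
  Finset.sum_range_succ _ _

lemma powSum_add (U : H →L[ℝ] H) (m n : ℕ) :
    powSum U (m + n) = powSum U m + U ^ m * powSum U n := by
  simp only [powSum, Finset.sum_range_add, Finset.mul_sum, pow_add]

lemma powSum_mul_one_sub (U : H →L[ℝ] H) (n : ℕ) : powSum U n * (1 - U) = 1 - U ^ n := by
  induction n with
  | zero => simp
  | succ n ih => rw [powSum_succ, add_mul, ih, pow_succ]; noncomm_ring

lemma commute_powSum {V U : H →L[ℝ] H} (h : Commute V U) (n : ℕ) : Commute V (powSum U n) :=
  Commute.sum_right _ _ _ fun k _ => h.pow_right k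

namespace IsShiftProj

variable {U P : H →L[ℝ] H} (h : IsShiftProj U P)
include h

lemma inner_shift (x y : H) : ⟪U x, U y⟫ = ⟪x, y⟫ :=
  (⟨U.toLinearMap, h.norm_shift⟩ : H →ₗᵢ[ℝ] H).inner_map_map x y

lemma norm_pow (k : ℕ) (x : H) : ‖(U ^ k) x‖ = ‖x‖ := by
  induction k with
  | zero => simp
  | succ k ih => rw [pow_succ', mul_apply_eq_comp, h.norm_shift, ih]

lemma inner_pow (k : ℕ) (x y : H) : ⟪(U ^ k) x, (U ^ k) y⟫ = ⟪x, y⟫ := by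
  induction k with
  | zero => simp
  | succ k ih =>
    rw [pow_succ', mul_apply_eq_comp, mul_apply_eq_comp, h.inner_shift, ih]

lemma proj_proj (x : H) : P (P x) = P x := congrArg (fun A : H →L[ℝ] H => A x) h.proj_idem

lemma norm_proj_le (x : H) : ‖P x‖ ≤ ‖x‖ := by
  have h1 : ‖P x‖ * ‖P x‖ ≤ ‖P x‖ * ‖x‖ := by
    rw [← real_inner_self_eq_norm_mul_norm, h.proj_symm, h.proj_proj, ← h.proj_symm]
    exact real_inner_le_norm _ _
  by_contra! hc
  have := norm_nonneg x
  nlinarith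

lemma norm_sub_proj_le (x : H) : ‖x - P x‖ ≤ ‖x‖ := by
  have h1 : ‖x - P x‖ * ‖x - P x‖ ≤ ‖x - P x‖ * ‖x‖ := by
    have h2 : ⟪x - P x, x - P x⟫ = ⟪x - P x, x⟫ := by
      rw [inner_sub_right, sub_eq_self, ← h.proj_symm, map_sub, h.proj_proj, sub_self,
        inner_zero_left]
    rw [← real_inner_self_eq_norm_mul_norm, h2]
    exact real_inner_le_norm _ _
  by_contra! hc
  have := norm_nonneg x
  nlinarith

lemma proj_pow_proj (k : ℕ) : P * U ^ k * P = P * U ^ k := by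
  induction k with
  | zero => simp [h.proj_idem]
  | succ k ih =>
    calc P * U ^ (k + 1) * P = (P * U ^ k) * U * P := by rw [pow_succ]; noncomm_ring
      _ = P * U ^ k * (P * U * P) := by simp only [← mul_assoc, ih]
      _ = (P * U ^ k * P) * U := by rw [h.proj_shift_proj, ← mul_assoc]
      _ = P * U ^ (k + 1) := by rw [ih, pow_succ]; noncomm_ring

lemma proj_pow_proj_apply (k : ℕ) (x : H) : P ((U ^ k) (P x)) = P ((U ^ k) x) :=
  congrArg (fun A : H →L[ℝ] H => A x) (h.proj_pow_proj k)

lemma proj_powSum_proj (n : ℕ) : P * powSum U n * P = P * powSum U n := by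
  simp only [powSum, Finset.mul_sum, Finset.sum_mul, h.proj_pow_proj]

lemma norm_powSum_le (n : ℕ) (x : H) : ‖powSum U n x‖ ≤ n * ‖x‖ := by
  induction n with
  | zero => simp
  | succ n ih =>
    rw [powSum_succ, add_apply]
    refine (norm_add_le _ _).trans ?_
    rw [h.norm_pow]; push_cast; linarith

/-- A second `P` to the right of `P * powSum U m` can be dropped, so both orders equal `P` times the
product of the two commuting sums. -/
lemma commute_proj_powSum (m n : ℕ) : Commute (P * powSum U m) (P * powSum U n) := by
  have h1 : Commute (powSum U m) (powSum U n) :=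
    commute_powSum (commute_powSum (Commute.refl U) m).symm n
  show (P * powSum U m) * (P * powSum U n) = (P * powSum U n) * (P * powSum U m)
  rw [← mul_assoc, ← mul_assoc, h.proj_powSum_proj, h.proj_powSum_proj, mul_assoc, h1.eq, mul_assoc]

lemma commute_proj_pow (m n : ℕ) : Commute (P * U ^ m) (P * powSum U n) := by
  have h1 := commute_powSum ((Commute.refl U).pow_left m) n
  show (P * U ^ m) * (P * powSum U n) = (P * powSum U n) * (P * U ^ m)
  rw [← mul_assoc, ← mul_assoc, h.proj_powSum_proj, h.proj_pow_proj, mul_assoc, h1.eq, mul_assoc]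

/-- Against each `U^k f` with `k < n` a factor `U^k` cancels; what remains is `f = P f` against a
shift of `y`, and this sees `y` only through `P y`. -/
lemma inner_powSum_pow {f : H} (hf : P f = f) (n : ℕ) (y : H) :
    ⟪powSum U n f, (U ^ n) y⟫ = ⟪powSum U n f, (U ^ n) (P y)⟫ := by
  simp only [powSum, sum_apply, sum_inner]
  refine Finset.sum_congr rfl fun k hk => ?_
  obtain ⟨m, rfl⟩ := Nat.exists_eq_add_of_le (Finset.mem_range.1 hk).le
  rw [pow_add, mul_apply_eq_comp, mul_apply_eq_comp, h.inner_pow,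
    h.inner_pow, ← hf, h.proj_symm, h.proj_symm, h.proj_pow_proj_apply]

/-- The two halves of the sum have equal norms. In the cross term the second half may be replaced by
its projection on the past, and Cauchy–Schwarz applies. -/
lemma norm_sq_powSum_two_mul {f : H} (hf : P f = f) (n : ℕ) :
    ‖powSum U (n + n) f‖ ^ 2 ≤
      2 * ‖powSum U n f‖ ^ 2 + 2 * (‖powSum U n f‖ * ‖(P * powSum U n) f‖) := by
  rw [powSum_add, add_apply, mul_apply_eq_comp,
    norm_add_sq_real, h.inner_powSum_pow hf, h.norm_pow]
  have h1 := real_inner_le_norm (powSum U n f) ((U ^ n) (P (powSum U n f)))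
  rw [h.norm_pow] at h1
  rw [mul_apply_eq_comp]
  linarith

/-- The Maxwell–Woodroofe type bound along powers of two. -/
lemma norm_powSum_two_pow_le {f : H} (hf : P f = f) (r : ℕ) :
    ‖powSum U (2 ^ r) f‖ ≤ √2 ^ r *
      (‖f‖ + 1 / 2 * ∑ j ∈ Finset.range r, (√2)⁻¹ ^ j * ‖(P * powSum U (2 ^ j)) f‖) := by
  induction r with
  | zero => simp
  | succ r ih =>
    have hs : (0 : ℝ) < √2 := by positivity
    have hs2 : √2 * √2 = 2 := Real.mul_self_sqrt (by norm_num)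
    have h1 := h.norm_sq_powSum_two_mul hf (2 ^ r)
    rw [← two_mul, ← pow_succ'] at h1
    have ha := norm_nonneg (powSum U (2 ^ r) f)
    have hb := norm_nonneg ((P * powSum U (2 ^ r)) f)
    -- Since `2a² + 2ab ≤ 2(a + b/2)²`, a doubling costs the factor `√2` and adds half of the
    -- projected norm.
    have h2 : ‖powSum U (2 ^ (r + 1)) f‖ ≤
        √2 * (‖powSum U (2 ^ r) f‖ + 1 / 2 * ‖(P * powSum U (2 ^ r)) f‖) := by
      refine abs_le_of_sq_le_sq' ?_ (by positivity) |>.2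
      have : (√2 * (‖powSum U (2 ^ r) f‖ + 1 / 2 * ‖(P * powSum U (2 ^ r)) f‖)) ^ 2 =
        2 * (‖powSum U (2 ^ r) f‖ + 1 / 2 * ‖(P * powSum U (2 ^ r)) f‖) ^ 2 := by
        rw [mul_pow, sq √2, hs2]
      rw [this]
      nlinarith [sq_nonneg ‖(P * powSum U (2 ^ r)) f‖]
    have h3 : √2 ^ r * (√2)⁻¹ ^ r = 1 := by
      rw [← mul_pow, mul_inv_cancel₀ hs.ne', one_pow]
    calc _ ≤ _ := h2
      _ ≤ √2 * (√2 ^ r * (‖f‖ + 1 / 2 * ∑ j ∈ Finset.range r,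
          (√2)⁻¹ ^ j * ‖(P * powSum U (2 ^ j)) f‖) + 1 / 2 * ‖(P * powSum U (2 ^ r)) f‖) := by
        gcongr
      _ = _ := by
        rw [Finset.sum_range_succ, pow_succ]
        linear_combination (-(1 / 2) * √2 * ‖(P * powSum U (2 ^ r)) f‖) * h3

/-- General lengths follow from powers of two by stripping the leading binary digit of `n`. -/
lemma norm_powSum_le_of_lt_two_pow {f : H} (hf : P f = f) {J : ℕ} {n : ℕ} (hn : n < 2 ^ J) :
    ‖powSum U n f‖ ≤ 4 * √n *
      ∑ j ∈ Finset.range J, (√2)⁻¹ ^ j * ‖(P * powSum U (2 ^ j)) f‖ := by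
  set D := ∑ j ∈ Finset.range J, (√2)⁻¹ ^ j * ‖(P * powSum U (2 ^ j)) f‖ with hD
  have hD0 : 0 ≤ D := Finset.sum_nonneg fun j _ => by positivity
  have h2 : ∀ r < J, ‖powSum U (2 ^ r) f‖ ≤ √2 ^ r * (3 / 2 * D) := by
    intro r hr
    refine (h.norm_powSum_two_pow_le hf r).trans ?_
    have h3 : ∑ j ∈ Finset.range r, (√2)⁻¹ ^ j * ‖(P * powSum U (2 ^ j)) f‖ ≤ D :=
      Finset.sum_le_sum_of_subset_of_nonneg (Finset.range_mono hr.le) fun _ _ _ => by positivity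
    -- The term `j = 0` of `D` is `‖P f‖ = ‖f‖`, whence the factor `1 + 1/2 = 3/2`.
    have h4 : ‖f‖ ≤ D := by
      have := Finset.single_le_sum (f := fun j => (√2)⁻¹ ^ j * ‖(P * powSum U (2 ^ j)) f‖)
        (fun _ _ => by positivity) (Finset.mem_range.2 (Nat.zero_lt_of_lt hr))
      simpa [hf, hD] using this
    gcongr
    linarith
  suffices ∀ K ≤ J, ∀ n < 2 ^ K, ‖powSum U n f‖ ≤ 4 * √n * D from this J le_rfl n hn
  intro K
  induction K with
  | zero =>
    intro _ n hn
    obtain rfl : n = 0 := by simpa using hn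
    simp
  | succ K ih =>
    intro hK n hn
    by_cases hc : n < 2 ^ K
    · exact ih (by omega) n hc
    obtain ⟨m, rfl⟩ := Nat.exists_eq_add_of_le (not_lt.1 hc)
    have hm : m < 2 ^ K := by rw [pow_succ] at hn; omega
    rw [powSum_add, add_apply, mul_apply_eq_comp]
    refine (norm_add_le _ _).trans ?_
    rw [h.norm_pow]
    have e1 := h2 K (by omega)
    have e2 := ih (by omega) m hm
    have e3 : √m ≤ √2 ^ K := by
      refine Real.sqrt_le_iff.2 ⟨by positivity, ?_⟩
      rw [← pow_mul, mul_comm, pow_mul, Real.sq_sqrt (by norm_num)]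
      exact_mod_cast hm.le
    -- Here `3/8` is `3/2` divided by the constant `4` of the claim. After squaring, `√m ≤ √2 ^ K`
    -- leaves `3/4 + 9/64 ≤ 1`, so the constant survives the induction.
    have e4 : √m + 3 / 8 * √2 ^ K ≤ √((2 ^ K + m : ℕ) : ℝ) := by
      refine Real.le_sqrt_of_sq_le ?_
      have e5 : (√m) ^ 2 = m := Real.sq_sqrt (by positivity)
      have e6 : (√2 ^ K) ^ 2 = 2 ^ K := by
        rw [← pow_mul, mul_comm, pow_mul, Real.sq_sqrt (by norm_num)]
      push_cast
      have := Real.sqrt_nonneg (m : ℝ)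
      nlinarith
    nlinarith

/-- A bound on the partial sums of an element of the range of `P` in terms of the projections
of the dyadic partial sums. -/
lemma enorm_powSum_le {f : H} (hf : P f = f) (n : ℕ) :
    ‖powSum U n f‖ₑ ≤ ENNReal.ofReal (4 * √n) *
      ∑' j : ℕ, ENNReal.ofReal ((√2)⁻¹ ^ j) * ‖(P * powSum U (2 ^ j)) f‖ₑ := by
  have h1 := h.norm_powSum_le_of_lt_two_pow hf (Nat.lt_two_pow_self (n := n))
  rw [← ofReal_norm]
  refine (ENNReal.ofReal_le_ofReal h1).trans ?_
  rw [ENNReal.ofReal_mul (by positivity), ENNReal.ofReal_sum_of_nonneg fun _ _ => by positivity]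
  gcongr
  refine le_trans (le_of_eq ?_) (ENNReal.sum_le_tsum (Finset.range n))
  refine Finset.sum_congr rfl fun j _ => ?_
  rw [ENNReal.ofReal_mul (by positivity), ofReal_norm]

/-- Orthogonality of an element of the range of `P` and the future martingale differences. -/
lemma inner_pow_of_proj_eq_zero {g y : H} (hg : P g = g) (hy : P y = 0) (k : ℕ) :
    ⟪g, (U ^ k) y⟫ = 0 := by
  rw [← hg, h.proj_symm, ← h.proj_pow_proj_apply, hy]; simp

/-- The partial sums of the martingale differences `U^k (U y - P U y)` are orthogonal sums. -/
lemma norm_powSum_sub {y : H} (hy : P y = y) (n : ℕ) :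
    ‖powSum U n (((1 - P) * U) y)‖ = √n * ‖((1 - P) * U) y‖ := by
  set m := ((1 - P) * U) y with hm
  have hm' : m = U y - P (U y) := by simp [hm]
  have hPm : P m = 0 := by rw [hm', map_sub, h.proj_proj, sub_self]
  -- Of the two terms of `m = U y - P U y`, the second lies in the range of `P`, and the first,
  -- after cancelling one `U`, leaves `y`, also in that range. Both are orthogonal to later shifts
  -- of `m` because `P m = 0`.
  have h1 : ∀ k, ⟪m, (U ^ (k + 1)) m⟫ = 0 := by
    intro k
    nth_rewrite 1 [hm']
    rw [inner_sub_left, h.inner_pow_of_proj_eq_zero (h.proj_proj _) hPm, sub_zero, pow_succ',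
      mul_apply_eq_comp, h.inner_shift, h.inner_pow_of_proj_eq_zero hy hPm]
  have h2 : ‖powSum U n m‖ ^ 2 = n * ‖m‖ ^ 2 := by
    induction n with
    | zero => simp
    | succ n ih =>
      rw [powSum_succ, add_apply, norm_add_sq_real, ih, h.norm_pow]
      have : ⟪powSum U n m, (U ^ n) m⟫ = 0 := by
        simp only [powSum, sum_apply, sum_inner]
        refine Finset.sum_eq_zero fun k hk => ?_
        obtain ⟨j, rfl⟩ := Nat.exists_eq_add_of_lt (Finset.mem_range.1 hk)
        rw [add_assoc, pow_add, mul_apply_eq_comp, h.inner_pow, h1]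
      rw [this]; push_cast; ring
  rw [← Real.sqrt_sq (norm_nonneg (powSum U n m)), h2, Real.sqrt_mul (by positivity),
    Real.sqrt_sq (norm_nonneg _)]

lemma norm_shift_sub_proj_le (y : H) : ‖((1 - P) * U) y‖ ≤ ‖y‖ := by
  have := h.norm_sub_proj_le (U y)
  rw [h.norm_shift] at this
  simpa using this

/-- The sum telescopes to `(1 - U ^ n) y`. The factor `2 / √n * √n` is `2` for `n > 0` and `0` for
`n = 0`; written so, it displays the gain `1 / √n` over the scale `√n`. -/
lemma norm_powSum_one_sub_le (y : H) (n : ℕ) : ‖powSum U n ((1 - U) y)‖ ≤ 2 / √n * √n * ‖y‖ := by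
  rcases Nat.eq_zero_or_pos n with rfl | hn
  · simp
  rw [← mul_apply_eq_comp, powSum_mul_one_sub, div_mul_cancel₀ _ (by positivity)]
  have h1 : ‖(1 - U ^ n) y‖ ≤ ‖y‖ + ‖(U ^ n) y‖ := norm_sub_le _ _
  rw [h.norm_pow] at h1
  linarith

/-- The ergodic averages of `P U` on the range of `P` differ from the identity by
a coboundary. -/
lemma sub_average_eq {x : H} (hx : P x = x) {N : ℕ} (hN : N ≠ 0) :
    x - (N : ℝ)⁻¹ • (P * powSum U N) x =
      (1 - P * U) (((N : ℝ)⁻¹ • ∑ m ∈ Finset.range N, P * powSum U m) x) := by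
  -- The inner `P` is absorbed and the sum telescopes. Averaging over `m < N` then solves the
  -- Poisson equation for `P U`.
  have h1 : ∀ m, (1 - P * U) ((P * powSum U m) x) = x - P ((U ^ m) x) := by
    intro m
    have e1 : (1 - P * U) * (P * powSum U m) = P * (1 - U ^ m) := by
      rw [sub_mul, ← mul_assoc (P * U), h.proj_shift_proj, ← powSum_mul_one_sub, mul_sub, mul_sub,
        one_mul, mul_one, (commute_powSum (Commute.refl U) m).symm.eq, mul_assoc]
    rw [← mul_apply_eq_comp, e1]
    simp [hx]
  have h2 : ∑ m ∈ Finset.range N, (1 - P * U) ((P * powSum U m) x) =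
      (N : ℝ) • x - (P * powSum U N) x := by
    simp only [h1, Finset.sum_sub_distrib, Finset.sum_const, Finset.card_range]
    simp [powSum, map_sum, Nat.cast_smul_eq_nsmul]
  have hN' : (N : ℝ) ≠ 0 := by exact_mod_cast hN
  rw [smul_apply, sum_apply, map_smul, map_sum, h2,
    smul_sub, smul_smul, inv_mul_cancel₀ hN', one_smul]

end IsShiftProj

end SingleShift

/-! ### Weighted sums of norms, iterated over the directions. -/

section NestedSums

variable {ι : Type*} {H : Type*} [NormedAddCommGroup H] [InnerProductSpace ℝ H]

/-- The iterated sum `∑_{n_1} w(n_1) ⋯ ∑_{n_k} w(n_k) ‖B_{i_k}(n_k) ⋯ B_{i_1}(n_1) x‖` over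
a list `i_1, …, i_k` of coordinates. -/
noncomputable def nestedSum (w : ℕ → ℝ≥0∞) (B : ι → ℕ → H →L[ℝ] H) : List ι → H → ℝ≥0∞
  | [], x => ‖x‖ₑ
  | i :: l, x => ∑' n : ℕ, w n * nestedSum w B l (B i n x)

variable {w : ℕ → ℝ≥0∞} {B : ι → ℕ → H →L[ℝ] H}

lemma nestedSum_add_le (l : List ι) (x y : H) :
    nestedSum w B l (x + y) ≤ nestedSum w B l x + nestedSum w B l y := by
  induction l generalizing x y with
  | nil => exact enorm_add_le x y
  | cons i l ih =>
    simp only [nestedSum, map_add]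
    rw [← ENNReal.tsum_add]
    refine ENNReal.tsum_le_tsum fun n => ?_
    rw [← mul_add]
    gcongr
    exact ih _ _

/-- Commutation moves `C` through every `B i n` to the innermost norm, where the bound is available.
-/
lemma nestedSum_map_le {l : List ι} {C : H →L[ℝ] H} {K : ℝ≥0∞}
    (hC : ∀ i ∈ l, ∀ n, Commute C (B i n)) (hK : ∀ z, ‖C z‖ₑ ≤ K * ‖z‖ₑ) (x : H) :
    nestedSum w B l (C x) ≤ K * nestedSum w B l x := by
  induction l generalizing x with
  | nil => exact hK x
  | cons i l ih =>
    simp only [nestedSum]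
    rw [← ENNReal.tsum_mul_left]
    refine ENNReal.tsum_le_tsum fun n => ?_
    have h1 : B i n (C x) = C (B i n x) :=
      (congrArg (fun A : H →L[ℝ] H => A x) (hC i List.mem_cons_self n).eq).symm
    rw [h1, mul_left_comm]
    gcongr
    exact ih (fun j hj => hC j (List.mem_cons_of_mem _ hj)) _

lemma tendsto_tsum_ennreal_of_dominated {f : ℕ → ℕ → ℝ≥0∞} {g bound : ℕ → ℝ≥0∞}
    (hb : ∑' n, bound n ≠ ⊤) (hf : ∀ N n, f N n ≤ bound n)
    (hlim : ∀ n, Tendsto (fun N => f N n) atTop (𝓝 (g n))) :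
    Tendsto (fun N => ∑' n, f N n) atTop (𝓝 (∑' n, g n)) := by
  simp only [← lintegral_count] at hb ⊢
  exact tendsto_lintegral_of_dominated_convergence bound (fun _ => measurable_of_countable _)
    (fun N => Eventually.of_forall (hf N)) hb (Eventually.of_forall hlim)

/-- Dominated convergence, one direction at a time: `B i n (C N x) = C N (B i n x)` still tends to
zero and is dominated by the term without `C N`. Nonzero weights let finiteness of the whole sum
pass to each inner sum. -/
lemma tendsto_nestedSum {l : List ι} (hw : ∀ n, w n ≠ 0) (hw' : ∀ n, w n ≠ ⊤)
    {C : ℕ → H →L[ℝ] H} (hC : ∀ N, ∀ i ∈ l, ∀ n, Commute (C N) (B i n))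
    (hC1 : ∀ N z, ‖C N z‖ ≤ ‖z‖) {x : H} (hx : nestedSum w B l x ≠ ⊤)
    (hlim : Tendsto (fun N => C N x) atTop (𝓝 0)) :
    Tendsto (fun N => nestedSum w B l (C N x)) atTop (𝓝 0) := by
  induction l generalizing x with
  | nil => simpa [nestedSum] using hlim.enorm
  | cons i l ih =>
    have hle : ∀ N z, nestedSum w B l (C N z) ≤ nestedSum w B l z := fun N z => by
      have := nestedSum_map_le (w := w) (l := l) (C := C N) (K := 1)
        (fun j hj => hC N j (List.mem_cons_of_mem _ hj))
        (fun z => by simpa [enorm_le_iff_norm_le] using hC1 N z) z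
      simpa using this
    have hcomm : ∀ N n, B i n (C N x) = C N (B i n x) := fun N n =>
      (congrArg (fun A : H →L[ℝ] H => A x) (hC N i List.mem_cons_self n).eq).symm
    simp only [nestedSum, hcomm] at hx ⊢
    have h0 : (0 : ℝ≥0∞) = ∑' _ : ℕ, 0 := by simp
    rw [h0]
    refine tendsto_tsum_ennreal_of_dominated hx (fun N n => by gcongr; exact hle N _) fun n => ?_
    have h1 : nestedSum w B l (B i n x) ≠ ⊤ := by
      intro h
      have := ENNReal.ne_top_of_tsum_ne_top hx n
      rw [h, ENNReal.mul_top (hw n)] at this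
      exact this rfl
    have h2 := ih (fun N j hj => hC N j (List.mem_cons_of_mem _ hj)) h1
      (by simpa [hcomm] using ((B i n).continuous.tendsto 0).comp hlim |>.congr fun N => hcomm N n)
    simpa using ENNReal.Tendsto.const_mul h2 (Or.inr (hw' n))

/-- The nested sum as a sum over multi-indices, the coordinates off the list being fixed. -/
lemma nestedSum_eq_tsum [DecidableEq ι] [Fintype ι] {l : List ι} (hl : l.Nodup)
    (hB : ∀ i j, i ≠ j → ∀ m n, Commute (B i m) (B j n)) (x : H) (u : ι → ℕ) :
    nestedSum w B l x = ∑' v : ι → ℕ, if ∀ j ∉ l, v j = u j then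
      (l.map fun i => w (v i)).prod * ‖(l.map fun i => B i (v i)).prod x‖ₑ else 0 := by
  induction l generalizing x u with
  | nil =>
    rw [tsum_eq_single u]
    · simp [nestedSum]
    · intro v hv
      rw [if_neg]
      intro h
      exact hv (funext fun j => h j List.not_mem_nil)
  | cons i l ih =>
    obtain ⟨hi, hl⟩ := List.nodup_cons.1 hl
    -- The summation variable of direction `i` is stored in the frozen coordinate `i`, which is why
    -- the statement carries an arbitrary `u`.
    have h1 : ∀ n, w n * nestedSum w B l (B i n x) = ∑' v : ι → ℕ,
        if ∀ j ∉ l, v j = Function.update u i n j then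
          ((i :: l).map fun i => w (v i)).prod *
            ‖((i :: l).map fun i => B i (v i)).prod x‖ₑ else 0 := by
      intro n
      rw [ih hl (B i n x) (Function.update u i n), ← ENNReal.tsum_mul_left]
      refine tsum_congr fun v => ?_
      split_ifs with hv
      · have hvi : v i = n := by simpa using hv i hi
        have hc : Commute (B i (v i)) (l.map fun i => B i (v i)).prod := by
          refine Commute.list_prod_right _ _ fun A hA => ?_
          obtain ⟨j, hj, rfl⟩ := List.mem_map.1 hA
          exact hB i j (fun h => hi (h ▸ hj)) _ _
        rw [List.map_cons, List.map_cons, List.prod_cons, List.prod_cons, hc.eq,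
          mul_apply_eq_comp, hvi, mul_assoc]
      · simp
    simp only [nestedSum, h1]
    -- For a fixed multi-index `v` only `n = v i` contributes.
    rw [ENNReal.tsum_comm]
    refine tsum_congr fun v => ?_
    rw [tsum_eq_single (v i)]
    · refine if_congr ?_ rfl rfl
      constructor
      · intro h j hj
        rw [List.mem_cons, not_or] at hj
        rw [h j hj.2, Function.update_of_ne hj.1]
      · intro h j hj
        by_cases hji : j = i
        · subst hji; simp
        · rw [Function.update_of_ne hji]
          exact h j (by simp [hji, hj])
    · intro n hn
      rw [if_neg]
      intro h
      exact hn (by simpa using (h i hi).symm)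

end NestedSums

/-! ### Comparing dyadic sums with full sums for subadditive sequences. -/

section Dyadic

/-- The weights `2^{-j/2}`. -/
noncomputable def dyadicWeight (j : ℕ) : ℝ≥0∞ := ENNReal.ofReal ((√2)⁻¹ ^ j)

/-- The weights `(n + 1)^{-3/2}`. -/
noncomputable def projWeight (n : ℕ) : ℝ≥0∞ := ENNReal.ofReal (1 / ((n : ℝ) + 1) ^ (3 / 2 : ℝ))

lemma dyadicWeight_ne_zero (j : ℕ) : dyadicWeight j ≠ 0 := by
  simp [dyadicWeight]

lemma tsum_inv_two_pow_le {N : ℕ} (hN : N ≠ 0) :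
    ∑' r : ℕ, (if N ≤ 2 ^ r then ENNReal.ofReal ((2 : ℝ)⁻¹ ^ r) else 0) ≤
      ENNReal.ofReal (2 / N) := by
  set c := Nat.clog 2 N with hc
  have hiff : ∀ r, N ≤ 2 ^ r ↔ c ≤ r := fun r => (Nat.clog_le_iff_le_pow (by norm_num)).symm
  have hNc : N ≤ 2 ^ c := (hiff c).2 le_rfl
  rw [← Summable.sum_add_tsum_nat_add' (k := c) ENNReal.summable, Finset.sum_eq_zero, zero_add]
  · have h1 : ∀ s, (if N ≤ 2 ^ (s + c) then ENNReal.ofReal ((2 : ℝ)⁻¹ ^ (s + c)) else 0) =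
        ENNReal.ofReal ((2 : ℝ)⁻¹ ^ s * (2 : ℝ)⁻¹ ^ c) := fun s => by
      rw [if_pos ((hiff _).2 (Nat.le_add_left _ _)), pow_add]
    simp only [h1]
    rw [← ENNReal.ofReal_tsum_of_nonneg (fun n => by positivity)
      ((summable_geometric_of_lt_one (by norm_num) (by norm_num)).mul_right _), tsum_mul_right,
      tsum_geometric_of_lt_one (by norm_num) (by norm_num)]
    refine ENNReal.ofReal_le_ofReal ?_
    have : (N : ℝ) ≤ 2 ^ c := by exact_mod_cast hNc
    have hN' : (0 : ℝ) < N := by positivity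
    rw [inv_pow, div_eq_mul_inv]
    norm_num
    exact inv_anti₀ hN' this
  · intro r hr
    rw [if_neg]
    rw [hiff]
    exact not_le.2 (Finset.mem_range.1 hr)

lemma dyadicWeight_mul_le {N r : ℕ} (hN : N ≠ 0) (h : N ≤ 2 ^ r) :
    dyadicWeight r * ENNReal.ofReal (4 / 2 ^ r) ≤
      ENNReal.ofReal (4 / √N) * ENNReal.ofReal ((2 : ℝ)⁻¹ ^ r) := by
  rw [dyadicWeight, ← ENNReal.ofReal_mul (by positivity), ← ENNReal.ofReal_mul (by positivity)]
  refine ENNReal.ofReal_le_ofReal ?_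
  have h1 : √(N : ℝ) ≤ √2 ^ r := by
    refine Real.sqrt_le_iff.2 ⟨by positivity, ?_⟩
    rw [← pow_mul, mul_comm, pow_mul, Real.sq_sqrt (by norm_num)]
    exact_mod_cast h
  have h0 : 0 < √(N : ℝ) := Real.sqrt_pos.2 (by positivity)
  have h2 := inv_anti₀ h0 h1
  calc (√2)⁻¹ ^ r * (4 / 2 ^ r) = (√2 ^ r)⁻¹ * (4 / 2 ^ r) := by rw [inv_pow]
    _ ≤ (√(N : ℝ))⁻¹ * (4 / 2 ^ r) := by gcongr
    _ = _ := by rw [inv_pow]; ring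

/-- For a subadditive sequence, the dyadic sum is controlled by the full sum. -/
lemma tsum_dyadic_le_of_subadditive {φ : ℕ → ℝ≥0∞} (hφ : ∀ m n, φ (m + n) ≤ φ m + φ n) :
    ∑' r, dyadicWeight r * φ (2 ^ r) ≤ 8 * ∑' n, projWeight n * φ (n + 1) := by
  -- Pairing `φ (m + 1) ≤ φ (n + 1) + φ (m - n)` over `n < m` bounds `φ (2 ^ r)` by four times the
  -- mean of `φ` over `1, …, 2 ^ r`.
  have h1 : ∀ r, φ (2 ^ r) ≤
      ENNReal.ofReal (4 / 2 ^ r) * ∑ n ∈ Finset.range (2 ^ r), φ (n + 1) := by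
    intro r
    obtain ⟨m, hm⟩ : ∃ m, 2 ^ r = m + 1 := Nat.exists_eq_add_one.2 (by positivity)
    have e1 : m * φ (m + 1) ≤ 2 * ∑ n ∈ Finset.range m, φ (n + 1) := by
      calc m * φ (m + 1) = ∑ n ∈ Finset.range m, φ (m + 1) := by simp
        _ ≤ ∑ n ∈ Finset.range m, (φ (n + 1) + φ ((m - 1 - n) + 1)) := by
          refine Finset.sum_le_sum fun n hn => ?_
          have := Finset.mem_range.1 hn
          refine le_trans (le_of_eq ?_) (hφ _ _)
          congr 1; omega
        _ = _ := by
          rw [Finset.sum_add_distrib, Finset.sum_range_reflect (fun n => φ (n + 1)), two_mul]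
    have e2 : (m + 1 : ℝ≥0∞) * φ (m + 1) ≤ 4 * ∑ n ∈ Finset.range (m + 1), φ (n + 1) := by
      rw [add_mul, one_mul, Finset.sum_range_succ, mul_add]
      refine add_le_add (e1.trans ?_) ?_
      · gcongr; norm_num
      · exact le_mul_of_one_le_left' (by norm_num)
    have e3 : (4 : ℝ) / 2 ^ r = 4 / (m + 1) := by
      congr 1; exact_mod_cast hm
    rw [e3, hm, ENNReal.ofReal_div_of_pos (by positivity), div_eq_mul_inv, mul_assoc,
      mul_comm _⁻¹, ← mul_assoc, ← div_eq_mul_inv]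
    have e4 : ENNReal.ofReal (m + 1 : ℝ) = (m : ℝ≥0∞) + 1 := by
      rw [ENNReal.ofReal_add (by positivity) (by norm_num)]; simp
    rw [e4, ENNReal.le_div_iff_mul_le (Or.inl (by simp)) (Or.inl (by simp [ENNReal.add_eq_top])),
      mul_comm]
    simpa using e2
  -- After interchanging the sums, `φ N` with `N = n + 1` has weight `∑_{2^r ≥ N} 4 · 2^(-3r/2) ≤
  -- (4/√N)(2/N) = 8 N^(-3/2)`.
  calc ∑' r, dyadicWeight r * φ (2 ^ r)
      ≤ ∑' r, ∑' n, (if n + 1 ≤ 2 ^ r then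
          dyadicWeight r * ENNReal.ofReal (4 / 2 ^ r) else 0) * φ (n + 1) := by
        refine ENNReal.tsum_le_tsum fun r => ?_
        refine (mul_le_mul_right (h1 r) _).trans ?_
        rw [← mul_assoc, Finset.mul_sum]
        refine le_trans (le_of_eq ?_) (ENNReal.sum_le_tsum (Finset.range (2 ^ r)))
        refine Finset.sum_congr rfl fun n hn => ?_
        rw [if_pos (Nat.succ_le_of_lt (Finset.mem_range.1 hn))]
    _ = ∑' n, ∑' r, (if n + 1 ≤ 2 ^ r then
          dyadicWeight r * ENNReal.ofReal (4 / 2 ^ r) else 0) * φ (n + 1) := ENNReal.tsum_comm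
    _ ≤ ∑' n, 8 * (projWeight n * φ (n + 1)) := by
        refine ENNReal.tsum_le_tsum fun n => ?_
        rw [ENNReal.tsum_mul_right, ← mul_assoc]
        gcongr
        calc ∑' r, (if n + 1 ≤ 2 ^ r then dyadicWeight r * ENNReal.ofReal (4 / 2 ^ r) else 0)
            ≤ ∑' r, ENNReal.ofReal (4 / √(n + 1 : ℕ)) *
              (if n + 1 ≤ 2 ^ r then ENNReal.ofReal ((2 : ℝ)⁻¹ ^ r) else 0) := by
              refine ENNReal.tsum_le_tsum fun r => ?_
              split_ifs with hr
              · exact dyadicWeight_mul_le (Nat.succ_ne_zero n) hr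
              · simp
          _ ≤ ENNReal.ofReal (4 / √(n + 1 : ℕ)) * ENNReal.ofReal (2 / (n + 1 : ℕ)) := by
              rw [ENNReal.tsum_mul_left]
              gcongr
              exact tsum_inv_two_pow_le (Nat.succ_ne_zero n)
          _ = 8 * projWeight n := by
              have h8 : (8 : ℝ≥0∞) = ENNReal.ofReal 8 := by simp
              rw [projWeight, h8, ← ENNReal.ofReal_mul (by positivity),
                ← ENNReal.ofReal_mul (by positivity)]
              congr 1
              have hp : (0 : ℝ) < n + 1 := by positivity
              have : ((n : ℝ) + 1) ^ (3 / 2 : ℝ) = (n + 1) * √(n + 1) := by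
                rw [Real.sqrt_eq_rpow, ← Real.rpow_one_add' hp.le (by norm_num)]
                norm_num
              rw [this]; push_cast
              have : 0 < √((n : ℝ) + 1) := Real.sqrt_pos.2 hp
              field_simp
              norm_num
    _ = _ := ENNReal.tsum_mul_left

end Dyadic

/-! ### Several commuting directions: moment bound and martingale approximation. -/

section Systems

variable {ι : Type*} {H : Type*} [NormedAddCommGroup H] [InnerProductSpace ℝ H]

/-- Commuting isometries `U i` and commuting orthogonal projections `P i`, such that `U i` and
`P i` form a shift with the projection on the past, and `P i` commutes with the other shifts. -/
structure IsShiftProjSystem (U P : ι → H →L[ℝ] H) : Prop where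
  shiftProj : ∀ i, IsShiftProj (U i) (P i)
  shift_comm : ∀ i j, Commute (U i) (U j)
  proj_comm : ∀ i j, Commute (P i) (P j)
  proj_shift_comm : ∀ i j, i ≠ j → Commute (P i) (U j)

/-- The operator `∏_{i ∈ l} ∑_{k < n_i} U_i^k`. -/
noncomputable def boxSum (U : ι → H →L[ℝ] H) (l : List ι) (n : ι → ℕ) : H →L[ℝ] H :=
  (l.map fun i => powSum (U i) (n i)).prod

/-- The number of points `∏_{i ∈ l} n_i` of a box. -/
noncomputable def boxSize (l : List ι) (n : ι → ℕ) : ℝ := (l.map fun i => (n i : ℝ)).prod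

@[simp] lemma boxSum_nil (U : ι → H →L[ℝ] H) (n : ι → ℕ) : boxSum U [] n = 1 := rfl

lemma boxSum_cons (U : ι → H →L[ℝ] H) (i : ι) (l : List ι) (n : ι → ℕ) :
    boxSum U (i :: l) n = powSum (U i) (n i) * boxSum U l n := by simp [boxSum]

@[simp] lemma boxSize_nil (n : ι → ℕ) : boxSize [] n = 1 := rfl

lemma boxSize_cons (i : ι) (l : List ι) (n : ι → ℕ) :
    boxSize (i :: l) n = n i * boxSize l n := by simp [boxSize]

lemma boxSize_nonneg (l : List ι) (n : ι → ℕ) : 0 ≤ boxSize l n := by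
  induction l with
  | nil => simp
  | cons i l ih => rw [boxSize_cons]; positivity

lemma commute_map_prod {V : H →L[ℝ] H} {l : List ι} {F : ι → H →L[ℝ] H}
    (h : ∀ i ∈ l, Commute V (F i)) : Commute V (l.map F).prod := by
  refine Commute.list_prod_right _ _ fun A hA => ?_
  obtain ⟨j, hj, rfl⟩ := List.mem_map.1 hA
  exact h j hj

lemma commute_boxSum {V : H →L[ℝ] H} {U : ι → H →L[ℝ] H} {l : List ι} {n : ι → ℕ}
    (h : ∀ i ∈ l, Commute V (U i)) : Commute V (boxSum U l n) :=
  commute_map_prod fun i hi => commute_powSum (h i hi) _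

lemma apply_comm {A B : H →L[ℝ] H} (h : Commute A B) (x : H) : A (B x) = B (A x) :=
  congrArg (fun C : H →L[ℝ] H => C x) h.eq

lemma norm_map_prod_le {l : List ι} {F : ι → H →L[ℝ] H} (h : ∀ i ∈ l, ∀ x, ‖F i x‖ ≤ ‖x‖)
    (x : H) : ‖(l.map F).prod x‖ ≤ ‖x‖ := by
  induction l with
  | nil => simp
  | cons i l ih =>
    rw [List.map_cons, List.prod_cons, mul_apply_eq_comp]
    exact (h i List.mem_cons_self _).trans (ih fun j hj => h j (List.mem_cons_of_mem _ hj))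

lemma enorm_map_prod_le {l : List ι} {F : ι → H →L[ℝ] H} {K : ℝ≥0∞}
    (h : ∀ i ∈ l, ∀ x, ‖F i x‖ₑ ≤ K * ‖x‖ₑ) (x : H) :
    ‖(l.map F).prod x‖ₑ ≤ K ^ l.length * ‖x‖ₑ := by
  induction l with
  | nil => simp
  | cons i l ih =>
    rw [List.map_cons, List.prod_cons, mul_apply_eq_comp, List.length_cons, pow_succ', mul_assoc]
    refine (h i List.mem_cons_self _).trans ?_
    gcongr
    exact ih fun j hj => h j (List.mem_cons_of_mem _ hj)

lemma tendsto_sqrt_coord_inv (i : ι) (C : ℝ) :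
    Tendsto (fun n : ι → ℕ => C / √(n i : ℝ)) atTop (𝓝 0) := by
  have h1 : Tendsto (fun n : ι → ℕ => n i) atTop atTop :=
    tendsto_atTop_atTop.2 fun b => ⟨fun _ => b, fun n hn => hn i⟩
  exact (tendsto_const_nhds.div_atTop tendsto_id).comp
    (Real.tendsto_sqrt_atTop.comp (tendsto_natCast_atTop_atTop.comp h1))

/-- The term with all indices zero has weight one and equals the norm of `x`. -/
lemma enorm_le_nestedSum_dyadic {l : List ι} {x : H} {U P : ι → H →L[ℝ] H} (hx : ∀ i ∈ l, P i x = x) :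
    ‖x‖ₑ ≤ nestedSum dyadicWeight (fun i j => P i * powSum (U i) (2 ^ j)) l x := by
  induction l with
  | nil => exact le_rfl
  | cons i l ih =>
    refine (ih fun j hj => hx j (List.mem_cons_of_mem _ hj)).trans ?_
    refine le_trans (le_of_eq ?_) (ENNReal.le_tsum 0)
    simp [dyadicWeight, hx i List.mem_cons_self]

namespace IsShiftProjSystem

variable {U P : ι → H →L[ℝ] H} (h : IsShiftProjSystem U P)
include h

/-- The projected partial sums in different directions commute. -/
lemma commute_proj_powSum (i j : ι) (m n : ℕ) :
    Commute (P i * powSum (U i) m) (P j * powSum (U j) n) := by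
  by_cases hij : i = j
  · subst hij
    exact (h.shiftProj i).commute_proj_powSum m n
  · refine Commute.mul_left (Commute.mul_right (h.proj_comm i j) ?_) (Commute.mul_right ?_ ?_)
    · exact commute_powSum (h.proj_shift_comm i j hij) _
    · exact (commute_powSum (h.proj_shift_comm j i (Ne.symm hij)) _).symm
    · exact (commute_powSum (commute_powSum (h.shift_comm i j) _).symm _).symm

lemma commute_proj_pow (i j : ι) (m n : ℕ) :
    Commute (P i * U i ^ m) (P j * powSum (U j) n) := by
  by_cases hij : i = j
  · subst hij
    exact (h.shiftProj i).commute_proj_pow m n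
  · refine Commute.mul_left (Commute.mul_right (h.proj_comm i j) ?_) (Commute.mul_right ?_ ?_)
    · exact commute_powSum (h.proj_shift_comm i j hij) _
    · exact ((h.proj_shift_comm j i (Ne.symm hij)).pow_right m).symm
    · exact commute_powSum ((h.shift_comm i j).pow_left m) _

/-- A moment bound for sums over boxes in terms of the dyadic nested sum. -/
lemma enorm_boxSum_le {l : List ι} (hl : l.Nodup) {x : H} (hx : ∀ i ∈ l, P i x = x) (n : ι → ℕ) :
    ‖boxSum U l n x‖ₑ ≤ 4 ^ l.length * ENNReal.ofReal √(boxSize l n) *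
      nestedSum dyadicWeight (fun i j => P i * powSum (U i) (2 ^ j)) l x := by
  induction l generalizing x with
  | nil => simp [nestedSum]
  | cons i l ih =>
    obtain ⟨hi, hl⟩ := List.nodup_cons.1 hl
    have hne : ∀ j ∈ l, i ≠ j := fun j hj hij => hi (hij ▸ hj)
    have hP : P i (boxSum U l n x) = boxSum U l n x := by
      rw [apply_comm (commute_boxSum fun j hj => h.proj_shift_comm i j (hne j hj)),
        hx i List.mem_cons_self]
    rw [boxSum_cons, mul_apply_eq_comp]
    -- The one-direction inequality is applied to the box sum over the other directions. Each `P i *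
    -- powSum (U i) (2 ^ j)` then commutes past that box sum, and the induction hypothesis applies
    -- to its value at `x`.
    refine ((h.shiftProj i).enorm_powSum_le hP _).trans ?_
    have h1 : ∀ j : ℕ, ‖(P i * powSum (U i) (2 ^ j)) (boxSum U l n x)‖ₑ ≤
        4 ^ l.length * ENNReal.ofReal √(boxSize l n) *
          nestedSum dyadicWeight (fun i j => P i * powSum (U i) (2 ^ j)) l
            ((P i * powSum (U i) (2 ^ j)) x) := by
      intro j
      have hc : Commute (P i * powSum (U i) (2 ^ j)) (boxSum U l n) :=
        commute_boxSum fun k hk => Commute.mul_left (h.proj_shift_comm i k (hne k hk))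
          (commute_powSum (h.shift_comm k i) _).symm
      rw [apply_comm hc]
      refine ih hl fun k hk => ?_
      have hc' : Commute (P k) (P i * powSum (U i) (2 ^ j)) := Commute.mul_right (h.proj_comm k i)
        (commute_powSum (h.proj_shift_comm k i (hne k hk).symm) _)
      rw [apply_comm hc', hx k (List.mem_cons_of_mem _ hk)]
    have h2 : ENNReal.ofReal (4 * √(n i)) = 4 * ENNReal.ofReal √(n i) := by
      rw [ENNReal.ofReal_mul (by norm_num)]; simp
    have h3 : ENNReal.ofReal √(boxSize (i :: l) n) =
        ENNReal.ofReal √(n i) * ENNReal.ofReal √(boxSize l n) := by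
      rw [boxSize_cons, Real.sqrt_mul (by positivity), ENNReal.ofReal_mul (by positivity)]
    calc _ ≤ ENNReal.ofReal (4 * √(n i)) * ∑' j : ℕ, ENNReal.ofReal ((√2)⁻¹ ^ j) *
          (4 ^ l.length * ENNReal.ofReal √(boxSize l n) *
          nestedSum dyadicWeight (fun i j => P i * powSum (U i) (2 ^ j)) l
            ((P i * powSum (U i) (2 ^ j)) x)) := by
          gcongr with j
          exact h1 j
      _ = _ := by
          simp only [mul_left_comm _ (4 ^ l.length * ENNReal.ofReal √(boxSize l n)), nestedSum,
            ENNReal.tsum_mul_left, h2, h3, List.length_cons, pow_succ, dyadicWeight]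
          ring

/-- The dyadic nested sum is controlled by the full one. -/
lemma nestedSum_dyadic_le (l : List ι) (x : H) :
    nestedSum dyadicWeight (fun i j => P i * powSum (U i) (2 ^ j)) l x ≤
      8 ^ l.length * nestedSum projWeight (fun i n => P i * powSum (U i) (n + 1)) l x := by
  induction l generalizing x with
  | nil => simp [nestedSum]
  | cons i l ih =>
    simp only [nestedSum]
    set φ : ℕ → ℝ≥0∞ := fun n => nestedSum projWeight (fun i n => P i * powSum (U i) (n + 1)) l
      ((P i * powSum (U i) n) x) with hφ
    -- With `S n = powSum (U i) n`, one has `P S (m + n) = P S m + (P U^m)(P S n)`, and the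
    -- contraction `P U^m` commutes with all operators of the nested sum.
    have hsub : ∀ m n, φ (m + n) ≤ φ m + φ n := by
      intro m n
      have e1 : P i * powSum (U i) (m + n) = P i * powSum (U i) m +
          (P i * U i ^ m) * (P i * powSum (U i) n) := by
        rw [powSum_add, mul_add, ← mul_assoc _ (P i), (h.shiftProj i).proj_pow_proj, mul_assoc]
      simp only [hφ]
      rw [e1, add_apply, mul_apply_eq_comp (P i * U i ^ m)]
      refine (nestedSum_add_le _ _ _).trans ?_
      gcongr
      have := nestedSum_map_le (w := projWeight) (B := fun i n => P i * powSum (U i) (n + 1))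
        (l := l) (C := P i * U i ^ m) (K := 1) (fun j _ n => h.commute_proj_pow i j m _)
        (fun z => ?_) ((P i * powSum (U i) n) x)
      · simpa using this
      · rw [one_mul, enorm_le_iff_norm_le, ← (h.shiftProj i).norm_pow m z]
        exact (h.shiftProj i).norm_proj_le _
    calc _ ≤ ∑' n, dyadicWeight n * (8 ^ l.length * φ (2 ^ n)) := by
          gcongr with n
          exact ih _
      _ = 8 ^ l.length * ∑' n, dyadicWeight n * φ (2 ^ n) := by
          simp only [mul_left_comm _ ((8 : ℝ≥0∞) ^ l.length), ENNReal.tsum_mul_left]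
      _ ≤ 8 ^ l.length * (8 * ∑' n, projWeight n * φ (n + 1)) := by
          gcongr
          exact tsum_dyadic_le_of_subadditive hsub
      _ = _ := by rw [List.length_cons, pow_succ, mul_assoc]

/-- Only the terms whose index vanishes in every direction other than `i` are kept. -/
lemma tsum_enorm_le_nestedSum_dyadic {l : List ι} {x : H} (hx : ∀ i ∈ l, P i x = x) {i : ι}
    (hi : i ∈ l) : ∑' s, dyadicWeight s * ‖(P i * powSum (U i) (2 ^ s)) x‖ₑ ≤
      nestedSum dyadicWeight (fun i j => P i * powSum (U i) (2 ^ j)) l x := by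
  induction l with
  | nil => simp at hi
  | cons j l ih =>
    by_cases hij : i ∈ l
    · refine (ih (fun j hj => hx j (List.mem_cons_of_mem _ hj)) hij).trans ?_
      refine le_trans (le_of_eq ?_) (ENNReal.le_tsum 0)
      simp [dyadicWeight, hx j List.mem_cons_self]
    · obtain rfl : i = j := (List.mem_cons.1 hi).resolve_right hij
      simp only [nestedSum]
      gcongr with s
      refine enorm_le_nestedSum_dyadic fun k hk => ?_
      have hc := h.commute_proj_powSum k i 1 (2 ^ s)
      rw [powSum_one, mul_one] at hc
      rw [apply_comm hc, hx k (List.mem_cons_of_mem _ hk)]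

/-- Terms of a convergent series tend to zero; this already holds with the weight `2^(-s/2)`, which
dominates `2^(-s)`. -/
lemma tendsto_average {l : List ι} {x : H} (hx : ∀ i ∈ l, P i x = x)
    (hfin : nestedSum dyadicWeight (fun i j => P i * powSum (U i) (2 ^ j)) l x ≠ ⊤) {i : ι}
    (hi : i ∈ l) :
    Tendsto (fun s : ℕ => (((2 ^ s : ℕ) : ℝ)⁻¹ • (P i * powSum (U i) (2 ^ s))) x) atTop (𝓝 0) := by
  have h1 := ENNReal.tendsto_atTop_zero_of_tsum_ne_top
    (ne_top_of_le_ne_top hfin (h.tsum_enorm_le_nestedSum_dyadic hx hi))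
  rw [tendsto_zero_iff_norm_tendsto_zero]
  have h2 := (ENNReal.tendsto_toReal ENNReal.zero_ne_top).comp h1
  refine squeeze_zero (fun _ => norm_nonneg _) (fun s => ?_) h2
  simp only [Function.comp_apply, ENNReal.toReal_mul, toReal_enorm, dyadicWeight]
  rw [ENNReal.toReal_ofReal (by positivity), smul_apply, norm_smul]
  gcongr
  rw [norm_inv, Real.norm_natCast, inv_pow]
  refine inv_anti₀ (by positivity) ?_
  push_cast
  gcongr
  exact Real.sqrt_le_iff.2 ⟨by norm_num, by norm_num⟩

lemma norm_average_le (i : ι) (N : ℕ) (z : H) :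
    ‖((N : ℝ)⁻¹ • (P i * powSum (U i) N)) z‖ ≤ ‖z‖ := by
  rcases Nat.eq_zero_or_pos N with rfl | hN
  · simp
  rw [smul_apply, norm_smul, norm_inv, Real.norm_natCast, inv_mul_le_iff₀ (by positivity)]
  exact ((h.shiftProj i).norm_proj_le _).trans ((h.shiftProj i).norm_powSum_le N z)

lemma commute_average (i j : ι) (N m : ℕ) :
    Commute ((N : ℝ)⁻¹ • (P i * powSum (U i) N)) (P j * powSum (U j) m) :=
  (h.commute_proj_powSum i j N m).smul_left _

/-- With `A` the average in direction `i` and `E` the product over the rest, `x - (1 - A) E x = (x -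
E x) + E A x`. The product `E` is bounded uniformly in `s`, and the nested sum of `A x` tends to
zero by `tendsto_nestedSum`. -/
lemma tendsto_nestedSum_sub {l₀ : List ι} {x : H} (hx : ∀ i ∈ l₀, P i x = x)
    (hfin : nestedSum dyadicWeight (fun i j => P i * powSum (U i) (2 ^ j)) l₀ x ≠ ⊤)
    {l : List ι} (hl : ∀ i ∈ l, i ∈ l₀) :
    Tendsto (fun s : ℕ => nestedSum dyadicWeight (fun i j => P i * powSum (U i) (2 ^ j)) l₀
      (x - (l.map fun i => 1 - ((2 ^ s : ℕ) : ℝ)⁻¹ • (P i * powSum (U i) (2 ^ s))).prod x))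
      atTop (𝓝 0) := by
  induction l with
  | nil =>
    have : nestedSum dyadicWeight (fun i j => P i * powSum (U i) (2 ^ j)) l₀ 0 = 0 := by
      have := nestedSum_map_le (w := dyadicWeight) (l := l₀)
        (B := fun i j => P i * powSum (U i) (2 ^ j)) (C := 0) (K := 0)
        (fun j _ n => Commute.zero_left _) (by simp) x
      simpa using this
    simp [this]
  | cons i l ih =>
    set A : ℕ → H →L[ℝ] H := fun s => ((2 ^ s : ℕ) : ℝ)⁻¹ • (P i * powSum (U i) (2 ^ s)) with hA
    set E : ℕ → H →L[ℝ] H := fun s =>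
      (l.map fun i => 1 - ((2 ^ s : ℕ) : ℝ)⁻¹ • (P i * powSum (U i) (2 ^ s))).prod with hE
    have hAlim : Tendsto (fun s => nestedSum dyadicWeight
        (fun i j => P i * powSum (U i) (2 ^ j)) l₀ (A s x)) atTop (𝓝 0) :=
      tendsto_nestedSum dyadicWeight_ne_zero
        (fun n => ENNReal.ofReal_ne_top) (fun s j _ n => h.commute_average i j _ _)
        (fun s z => h.norm_average_le i _ z) hfin (h.tendsto_average hx hfin (hl i List.mem_cons_self))
    have hEA : ∀ s, nestedSum dyadicWeight (fun i j => P i * powSum (U i) (2 ^ j)) l₀ (E s (A s x)) ≤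
        2 ^ l.length * nestedSum dyadicWeight (fun i j => P i * powSum (U i) (2 ^ j)) l₀ (A s x) := by
      intro s
      refine nestedSum_map_le (fun j _ n => ?_) (fun z => ?_) _
      · exact (commute_map_prod fun k _ => (Commute.one_right _).sub_right
          (h.commute_average k j _ _).symm).symm
      · refine enorm_map_prod_le (fun k _ z => ?_) z
        rw [sub_apply, one_apply_eq_self, two_mul]
        refine enorm_sub_le.trans (add_le_add le_rfl ?_)
        rw [enorm_le_iff_norm_le]
        exact h.norm_average_le k _ _
    have hsum := (ih fun j hj => hl j (List.mem_cons_of_mem _ hj)).add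
      (ENNReal.Tendsto.const_mul (a := 2 ^ l.length) hAlim (Or.inr (by simp)))
    rw [mul_zero, add_zero] at hsum
    refine tendsto_of_tendsto_of_tendsto_of_le_of_le tendsto_const_nhds hsum
      (fun _ => zero_le) fun s => ?_
    have e1 : x - ((i :: l).map fun i =>
        1 - ((2 ^ s : ℕ) : ℝ)⁻¹ • (P i * powSum (U i) (2 ^ s))).prod x =
        (x - E s x) + E s (A s x) := by
      have hc : Commute (A s) (E s) := commute_map_prod fun k _ => (Commute.one_right _).sub_right
        ((h.commute_average i k _ _).smul_right _)
      rw [← apply_comm hc, List.map_cons, List.prod_cons, mul_apply_eq_comp, sub_apply,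
        one_apply_eq_self]
      simp only [hA, hE]
      abel
    simp only [e1]
    exact (nestedSum_add_le _ _ _).trans (add_le_add le_rfl (hEA s))

/-- Products of averaged operators are products of coboundary operators. -/
lemma prod_one_sub_average_eq (N : ℕ) (hN : N ≠ 0) {l : List ι} {x : H}
    (hx : ∀ i ∈ l, P i x = x) :
    (l.map fun i => 1 - (N : ℝ)⁻¹ • (P i * powSum (U i) N)).prod x =
      (l.map fun i => 1 - P i * U i).prod ((l.map fun i =>
        (N : ℝ)⁻¹ • ∑ m ∈ Finset.range N, P i * powSum (U i) m).prod x) := by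
  induction l with
  | nil => simp
  | cons i l ih =>
    have hG : ∀ (V : H →L[ℝ] H), (∀ j m, Commute V (P j * powSum (U j) m)) → ∀ j,
        Commute V ((N : ℝ)⁻¹ • ∑ m ∈ Finset.range N, P j * powSum (U j) m) := fun V hV j =>
      (Commute.sum_right _ _ _ fun m _ => hV j m).smul_right _
    have hQ : ∀ j, P j * U j = P j * powSum (U j) 2 - P j * powSum (U j) 1 := fun j => by
      rw [← mul_sub, powSum_succ, powSum_one]; simp
    have hV : ∀ j m, Commute ((N : ℝ)⁻¹ • (P i * powSum (U i) N)) (P j * powSum (U j) m) :=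
      fun j m => h.commute_average i j N m
    have hV' : ∀ j m, Commute ((N : ℝ)⁻¹ • ∑ m ∈ Finset.range N, P i * powSum (U i) m)
        (P j * powSum (U j) m) := fun j m =>
      (Commute.sum_left _ _ _ fun k _ => h.commute_proj_powSum i j k m).smul_left _
    have hV'' : ∀ j m, Commute (P i * U i) (P j * powSum (U j) m) := fun j m => by
      simpa using h.commute_proj_pow i j 1 m
    rw [List.map_cons, List.prod_cons, mul_apply_eq_comp, ih fun j hj =>
      hx j (List.mem_cons_of_mem _ hj)]
    simp only [List.map_cons, List.prod_cons, mul_apply_eq_comp]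
    have c1 : Commute (1 - (N : ℝ)⁻¹ • (P i * powSum (U i) N))
        (l.map fun i => 1 - P i * U i).prod := commute_map_prod fun j _ =>
      (Commute.one_left _).sub_left ((Commute.one_right _).sub_right
        (by rw [hQ]; exact (hV j 2).sub_right (hV j 1)))
    have c2 : Commute (1 - (N : ℝ)⁻¹ • (P i * powSum (U i) N)) (l.map fun i =>
        (N : ℝ)⁻¹ • ∑ m ∈ Finset.range N, P i * powSum (U i) m).prod := commute_map_prod fun j _ =>
      (Commute.one_left _).sub_left (hG _ hV j)
    have c3 : Commute (1 - P i * U i) (l.map fun i => 1 - P i * U i).prod :=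
      commute_map_prod fun j _ => (Commute.one_left _).sub_left ((Commute.one_right _).sub_right
        (by rw [hQ j]; exact (hV'' j 2).sub_right (hV'' j 1)))
    have c4 : Commute (1 - P i * U i) (l.map fun i =>
        (N : ℝ)⁻¹ • ∑ m ∈ Finset.range N, P i * powSum (U i) m).prod := commute_map_prod fun j _ =>
      (Commute.one_left _).sub_left (hG _ hV'' j)
    have c5 : Commute ((N : ℝ)⁻¹ • ∑ m ∈ Finset.range N, P i * powSum (U i) m) (l.map fun i =>
        (N : ℝ)⁻¹ • ∑ m ∈ Finset.range N, P i * powSum (U i) m).prod := commute_map_prod fun j _ =>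
      hG _ hV' j
    have e := (h.shiftProj i).sub_average_eq (hx i List.mem_cons_self) hN
    rw [apply_comm c1, apply_comm c2, apply_comm c3, apply_comm c5, apply_comm c4, ← e]
    simp

/-- The sums over boxes of `∏ (1 - P_i) U_i g` are sums of orthogonal variables. -/
lemma norm_boxSum_prod {l : List ι} (hl : l.Nodup) {g : H} (hg : ∀ i ∈ l, P i g = g) (n : ι → ℕ) :
    ‖boxSum U l n ((l.map fun i => (1 - P i) * U i).prod g)‖ =
      √(boxSize l n) * ‖(l.map fun i => (1 - P i) * U i).prod g‖ := by
  induction l generalizing g with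
  | nil => simp
  | cons i l ih =>
    obtain ⟨hi, hl⟩ := List.nodup_cons.1 hl
    have hne : ∀ j ∈ l, i ≠ j := fun j hj hij => hi (hij ▸ hj)
    have c0 : ∀ j ∈ l, Commute (P i) (U j) := fun j hj => h.proj_shift_comm i j (hne j hj)
    have cM : ∀ j ∈ l, Commute ((1 - P i) * U i) (U j) := fun j hj =>
      ((Commute.one_left _).sub_left (c0 j hj)).mul_left (h.shift_comm i j)
    have cP : ∀ j ∈ l, Commute (P j) ((1 - P i) * U i) := fun j hj =>
      ((Commute.one_right _).sub_right (h.proj_comm j i)).mul_right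
        (h.proj_shift_comm j i (hne j hj).symm)
    have c1 : Commute ((1 - P i) * U i) (boxSum U l n) := commute_boxSum cM
    have c2 : Commute ((1 - P i) * U i) (l.map fun i => (1 - P i) * U i).prod :=
      commute_map_prod fun j hj =>
        ((Commute.one_right _).sub_right (cP j hj).symm).mul_right (cM j hj)
    have c3 : Commute (P i) (boxSum U l n) := commute_boxSum c0
    have c4 : Commute (P i) (l.map fun i => (1 - P i) * U i).prod := commute_map_prod fun j hj =>
      ((Commute.one_right _).sub_right (h.proj_comm i j)).mul_right (c0 j hj)
    rw [boxSum_cons, List.map_cons, List.prod_cons]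
    simp only [mul_apply_eq_comp _ (boxSum U l n), mul_apply_eq_comp ((1 - P i) * U i)]
    have hy : P i (boxSum U l n ((l.map fun i => (1 - P i) * U i).prod g)) =
        boxSum U l n ((l.map fun i => (1 - P i) * U i).prod g) := by
      rw [apply_comm c3, apply_comm c4, hg i List.mem_cons_self]
    rw [← apply_comm c1, (h.shiftProj i).norm_powSum_sub hy, apply_comm c1, apply_comm c2,
      ih hl fun j hj => by rw [apply_comm (cP j hj), hg j (List.mem_cons_of_mem _ hj)],
      boxSize_cons, Real.sqrt_mul (by positivity), mul_assoc]

/-- `1 - P U = (1 - P) U + (1 - U)` splits the summand into a martingale difference, with sums of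
order `√n`, and a coboundary, with bounded sums. -/
lemma norm_powSum_one_sub_le_sqrt {i : ι} {y : H} (hy : P i y = y) (n : ℕ) :
    ‖powSum (U i) n ((1 - P i * U i) y)‖ ≤ 3 * √n * ‖y‖ := by
  have e : (1 - P i * U i) y = ((1 - P i) * U i) y + (1 - U i) y := by
    rw [← add_apply]; congr 1; noncomm_ring
  have h1 := (h.shiftProj i).norm_powSum_sub hy n
  have h2 := (h.shiftProj i).norm_shift_sub_proj_le y
  have h3 := (h.shiftProj i).norm_powSum_one_sub_le y n
  have h4 : 2 / √n * √(n : ℝ) ≤ 2 * √n := by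
    rcases Nat.eq_zero_or_pos n with rfl | hn
    · simp
    · have : 1 ≤ √(n : ℝ) := Real.one_le_sqrt.2 (by exact_mod_cast hn)
      rw [div_mul_cancel₀ _ (by positivity)]; linarith
  rw [e, map_add]
  refine (norm_add_le _ _).trans ?_
  rw [h1]
  have h5 := mul_le_mul_of_nonneg_left h2 (Real.sqrt_nonneg (n : ℝ))
  have h6 := mul_le_mul_of_nonneg_right h4 (norm_nonneg y)
  linarith

lemma norm_boxSum_coboundary_le {l : List ι} (hl : l.Nodup) {g : H} (hg : ∀ i ∈ l, P i g = g)
    (n : ι → ℕ) : ‖boxSum U l n ((l.map fun i => 1 - P i * U i).prod g)‖ ≤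
      3 ^ l.length * √(boxSize l n) * ‖g‖ := by
  induction l with
  | nil => simp
  | cons i l ih =>
    obtain ⟨hi, hl⟩ := List.nodup_cons.1 hl
    have hne : ∀ j ∈ l, i ≠ j := fun j hj hij => hi (hij ▸ hj)
    have c0 : ∀ j ∈ l, Commute (P i) (U j) := fun j hj => h.proj_shift_comm i j (hne j hj)
    have c1 : Commute (1 - P i * U i) (boxSum U l n) := commute_boxSum fun j hj =>
      (Commute.one_left _).sub_left ((c0 j hj).mul_left (h.shift_comm i j))
    have c3 : Commute (P i) (boxSum U l n) := commute_boxSum c0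
    have c4 : Commute (P i) (l.map fun i => 1 - P i * U i).prod := commute_map_prod fun j hj =>
      (Commute.one_right _).sub_right ((h.proj_comm i j).mul_right (c0 j hj))
    have hy : P i (boxSum U l n ((l.map fun i => 1 - P i * U i).prod g)) =
        boxSum U l n ((l.map fun i => 1 - P i * U i).prod g) := by
      rw [apply_comm c3, apply_comm c4, hg i List.mem_cons_self]
    rw [boxSum_cons, List.map_cons, List.prod_cons]
    simp only [mul_apply_eq_comp _ (boxSum U l n), mul_apply_eq_comp (1 - P i * U i)]
    rw [← apply_comm c1]
    refine (h.norm_powSum_one_sub_le_sqrt hy _).trans ?_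
    have := ih hl fun j hj => hg j (List.mem_cons_of_mem _ hj)
    rw [boxSize_cons, Real.sqrt_mul (by positivity), List.length_cons, pow_succ]
    have h3 := mul_le_mul_of_nonneg_left this (by positivity : 0 ≤ 3 * √(n i : ℝ))
    linarith

/-- The sums over boxes of a multiple coboundary `∏ (1 - P_i U_i) g` are approximated by those of
the martingale difference `∏ (1 - P_i) U_i g`. -/
lemma exists_norm_boxSum_sub_le {l : List ι} (hl : l.Nodup) {g : H} (hg : ∀ i ∈ l, P i g = g) :
    ∃ e : (ι → ℕ) → ℝ, Tendsto e atTop (𝓝 0) ∧ ∀ n,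
      ‖boxSum U l n ((l.map fun i => 1 - P i * U i).prod g -
        (l.map fun i => (1 - P i) * U i).prod g)‖ ≤ e n * √(boxSize l n) := by
  induction l with
  | nil => exact ⟨fun _ => 0, tendsto_const_nhds, fun n => by simp⟩
  | cons i l ih =>
    obtain ⟨hi, hl⟩ := List.nodup_cons.1 hl
    obtain ⟨e, he, hle⟩ := ih hl fun j hj => hg j (List.mem_cons_of_mem _ hj)
    have hne : ∀ j ∈ l, i ≠ j := fun j hj hij => hi (hij ▸ hj)
    have c0 : ∀ j ∈ l, Commute (P i) (U j) := fun j hj => h.proj_shift_comm i j (hne j hj)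
    refine ⟨fun n => e n + 2 * 3 ^ l.length * ‖g‖ / √(n i : ℝ), ?_, fun n => ?_⟩
    · simpa using he.add (tendsto_sqrt_coord_inv i (2 * 3 ^ l.length * ‖g‖))
    set E := (l.map fun i => 1 - P i * U i).prod with hE
    set M := (l.map fun i => (1 - P i) * U i).prod with hM
    have c1 : Commute ((1 - P i) * U i) (boxSum U l n) := commute_boxSum fun j hj =>
      ((Commute.one_left _).sub_left (c0 j hj)).mul_left (h.shift_comm i j)
    have c2 : Commute (1 - U i) (boxSum U l n) := commute_boxSum fun j hj =>
      (Commute.one_left _).sub_left (h.shift_comm i j)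
    have c3 : Commute (P i) (boxSum U l n) := commute_boxSum c0
    have c4 : Commute (P i) E := commute_map_prod fun j hj =>
      (Commute.one_right _).sub_right ((h.proj_comm i j).mul_right (c0 j hj))
    have c5 : Commute (P i) M := commute_map_prod fun j hj =>
      ((Commute.one_right _).sub_right (h.proj_comm i j)).mul_right (c0 j hj)
    have hy : P i (boxSum U l n (E g - M g)) = boxSum U l n (E g - M g) := by
      rw [apply_comm c3, map_sub, apply_comm c4, apply_comm c5, hg i List.mem_cons_self]
    -- `(1 - P U) E - (1 - P) U M = (1 - P) U (E - M) + (1 - U) E`. The first term inherits the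
    -- error of the other directions by orthogonality in direction `i`; the second telescopes there
    -- and gains `1 / √(n i)`.
    have e1 : boxSum U (i :: l) n (((i :: l).map fun i => 1 - P i * U i).prod g -
        ((i :: l).map fun i => (1 - P i) * U i).prod g) =
        powSum (U i) (n i) (((1 - P i) * U i) (boxSum U l n (E g - M g))) +
          powSum (U i) (n i) ((1 - U i) (boxSum U l n (E g))) := by
      rw [apply_comm c1, apply_comm c2, ← map_add, boxSum_cons, mul_apply_eq_comp, ← map_add]
      congr 2
      simp only [List.map_cons, List.prod_cons, mul_apply_eq_comp, sub_apply,
        one_apply_eq_self, map_sub]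
      abel
    have h1 := (h.shiftProj i).norm_powSum_sub hy (n i)
    have h2 := (h.shiftProj i).norm_shift_sub_proj_le (boxSum U l n (E g - M g))
    have h3 := (h.shiftProj i).norm_powSum_one_sub_le (boxSum U l n (E g)) (n i)
    have h4 := h.norm_boxSum_coboundary_le hl (fun j hj => hg j (List.mem_cons_of_mem _ hj)) n
    have h5 := mul_le_mul_of_nonneg_left (h2.trans (hle n)) (Real.sqrt_nonneg (n i : ℝ))
    have h6 := mul_le_mul_of_nonneg_left h4 (by positivity : 0 ≤ 2 / √(n i : ℝ) * √(n i : ℝ))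
    rw [e1, boxSize_cons, Real.sqrt_mul (by positivity)]
    refine (norm_add_le _ _).trans ?_
    rw [h1]
    refine (add_le_add h5 (h3.trans h6)).trans (le_of_eq ?_)
    ring

/-- Martingale approximation: if the nested sum of the projected dyadic sums of `f` is finite then
the sums of `f` over boxes are approximated by those of orthomartingale differences. -/
theorem exists_martingale_approx {l : List ι} (hl : l.Nodup) {f : H} (hf : ∀ i ∈ l, P i f = f)
    (hfin : nestedSum dyadicWeight (fun i j => P i * powSum (U i) (2 ^ j)) l f ≠ ⊤)
    {ε : ℝ} (hε : 0 < ε) :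
    ∃ g : H, (∀ i ∈ l, P i g = g) ∧ ∀ᶠ n in (atTop : Filter (ι → ℕ)),
      ‖boxSum U l n (f - (l.map fun i => (1 - P i) * U i).prod g)‖ ≤ ε * √(boxSize l n) := by
  have hlim := h.tendsto_nestedSum_sub hf hfin (l := l) fun i hi => hi
  -- The factor is the constant of `enorm_boxSum_le`, so a single large `s` brings the remainder
  -- below `ε / 2` for all boxes at once.
  have hlim' := ENNReal.Tendsto.const_mul (a := 4 ^ l.length) hlim (Or.inr (by simp))
  rw [mul_zero] at hlim'
  have hε2 : (0 : ℝ≥0∞) < ENNReal.ofReal (ε / 2) := by simpa using hε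
  obtain ⟨s, hs⟩ := (hlim'.eventually (gt_mem_nhds hε2)).exists
  have hN : (2 ^ s : ℕ) ≠ 0 := by positivity
  set g := (l.map fun i => ((2 ^ s : ℕ) : ℝ)⁻¹ • ∑ m ∈ Finset.range (2 ^ s),
    P i * powSum (U i) m).prod f with hgdef
  have hPA : ∀ i j m, Commute (P i) (P j * powSum (U j) m) := fun i j m => by
    simpa using h.commute_proj_powSum i j 1 m
  have hg : ∀ i ∈ l, P i g = g := fun i hi => by
    have c : Commute (P i) (l.map fun i => ((2 ^ s : ℕ) : ℝ)⁻¹ • ∑ m ∈ Finset.range (2 ^ s),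
        P i * powSum (U i) m).prod := commute_map_prod fun j _ =>
      (Commute.sum_right _ _ _ fun m _ => hPA i j m).smul_right _
    rw [hgdef, apply_comm c, hf i hi]
  refine ⟨g, hg, ?_⟩
  obtain ⟨e, he, hle⟩ := h.exists_norm_boxSum_sub_le hl hg
  filter_upwards [he.eventually (gt_mem_nhds (half_pos hε))] with n hn
  have h1 := h.prod_one_sub_average_eq (2 ^ s) hN hf
  rw [← hgdef] at h1
  rw [h1] at hs
  have hr : ∀ i ∈ l, P i (f - (l.map fun i => 1 - P i * U i).prod g) =
      f - (l.map fun i => 1 - P i * U i).prod g := fun i hi => by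
    have c : Commute (P i) (l.map fun i => 1 - P i * U i).prod := commute_map_prod fun j _ =>
      (Commute.one_right _).sub_right (by
        have e : P j * U j = P j * powSum (U j) 2 - P j * powSum (U j) 1 := by
          rw [← mul_sub, powSum_succ, powSum_one]; simp
        rw [e]; exact (hPA i j 2).sub_right (hPA i j 1))
    rw [map_sub, apply_comm c, hf i hi, hg i hi]
  have h2 := h.enorm_boxSum_le hl hr n
  have h3 : ‖boxSum U l n (f - (l.map fun i => 1 - P i * U i).prod g)‖ ≤
      ε / 2 * √(boxSize l n) := by
    rw [← ENNReal.ofReal_le_ofReal_iff (by positivity), ofReal_norm,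
      ENNReal.ofReal_mul (by positivity)]
    refine h2.trans ?_
    rw [mul_right_comm]
    gcongr
  have h4 : f - (l.map fun i => (1 - P i) * U i).prod g =
      (f - (l.map fun i => 1 - P i * U i).prod g) +
      ((l.map fun i => 1 - P i * U i).prod g - (l.map fun i => (1 - P i) * U i).prod g) := by abel
  rw [h4, map_add]
  refine (norm_add_le _ _).trans ?_
  have h5 := (hle n).trans (mul_le_mul_of_nonneg_right hn.le (Real.sqrt_nonneg _))
  linarith

end IsShiftProjSystem

end Systems

/-! ### Conditional expectation under a change of space. -/

section ConditionalExpectation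

/-- Conditional expectations commute with composition with a measure preserving map. -/
lemma condExp_comp_measurePreserving {α β : Type*} {mα : MeasurableSpace α}
    {m mβ : MeasurableSpace β} {μ : Measure α} {ν : Measure β} [IsFiniteMeasure μ]
    [IsFiniteMeasure ν] {φ : α → β} (hφ : MeasurePreserving φ μ ν)
    (hm : m ≤ mβ) {h : β → ℝ} (hh : Integrable h ν) :
    μ[h ∘ φ | m.comap φ] =ᵐ[μ] ν[h | m] ∘ φ := by
  have hle : m.comap φ ≤ mα := (MeasurableSpace.comap_mono hm).trans hφ.measurable.comap_le
  have hint : Integrable (ν[h | m] ∘ φ) μ := hφ.integrable_comp_of_integrable integrable_condExp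
  refine (ae_eq_condExp_of_forall_setIntegral_eq hle (hφ.integrable_comp_of_integrable hh)
    (fun s _ _ => hint.integrableOn) ?_ ?_).symm
  · rintro s ⟨t, ht, rfl⟩ _
    have e : ∀ k : β → ℝ, Integrable k ν → ∫ x in φ ⁻¹' t, (k ∘ φ) x ∂μ = ∫ y in t, k y ∂ν := by
      intro k hk
      rw [← hφ.map_eq] at hk ⊢
      exact (setIntegral_map (hm t ht) hk.1 hφ.measurable.aemeasurable).symm
    rw [e _ integrable_condExp, e _ hh, setIntegral_condExp hm hh ht]
  · exact (stronglyMeasurable_condExp.comp_measurable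
      (Measurable.of_comap_le le_rfl)).aestronglyMeasurable

end ConditionalExpectation

/-! ### Stationary martingale differences: orthogonality and fourth moments. -/

section MartingaleDifferences

variable {Ω : Type*} {N mΩ : MeasurableSpace Ω}

/-- The function `h` is a martingale difference for the filtration generated by the σ-field `N`
and the transformation `T`. -/
structure IsMartDiff (μ : Measure Ω) (T : Ω → Ω) (N : MeasurableSpace Ω) (h : Ω → ℝ) : Prop where
  aesm : AEStronglyMeasurable[N.comap T] h μ
  condExp_eq_zero : μ[h | N] =ᵐ[μ] 0

variable {μ : Measure Ω} [IsProbabilityMeasure μ] {T : Ω → Ω}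

lemma comap_iterate_mono (hmono : N ≤ N.comap T) {j k : ℕ} (hjk : j ≤ k) :
    N.comap T^[j] ≤ N.comap T^[k] := by
  induction k, hjk using Nat.le_induction with
  | base => exact le_rfl
  | succ k _ ih =>
    refine ih.trans ?_
    rw [Function.iterate_succ', ← MeasurableSpace.comap_comp]
    exact MeasurableSpace.comap_mono hmono

lemma _root_.MeasureTheory.AEStronglyMeasurable.comp_comap_iterate {β : Type*} [TopologicalSpace β]
    {m : MeasurableSpace Ω} {mΩ : MeasurableSpace Ω} {μ : Measure Ω} {T : Ω → Ω}
    (hT : MeasurePreserving T μ μ) {h : Ω → β} (hh : AEStronglyMeasurable[m] h μ) (k : ℕ) :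
    AEStronglyMeasurable[m.comap T^[k]] (h ∘ T^[k]) μ := by
  obtain ⟨h', hm, he⟩ := hh
  exact ⟨h' ∘ T^[k], hm.comp_measurable (Measurable.of_comap_le le_rfl),
    (hT.iterate k).quasiMeasurePreserving.ae_eq_comp he⟩

omit [IsProbabilityMeasure μ] in
lemma memLp_birkhoffSum (hT : MeasurePreserving T μ μ) {h : Ω → ℝ} {p : ℝ≥0∞} (hh : MemLp h p μ)
    (n : ℕ) : MemLp (birkhoffSum T h n) p μ := by
  have : birkhoffSum T h n = fun ω => ∑ k ∈ Finset.range n, (h ∘ T^[k]) ω := rfl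
  rw [this]
  exact memLp_finsetSum _ fun k _ => hh.comp_measurePreserving (hT.iterate k)

omit [IsProbabilityMeasure μ] in
lemma integrable_birkhoffSum (hT : MeasurePreserving T μ μ) {h : Ω → ℝ} (hh : Integrable h μ)
    (n : ℕ) : Integrable (birkhoffSum T h n) μ :=
  memLp_one_iff_integrable.1 (memLp_birkhoffSum hT (memLp_one_iff_integrable.2 hh) n)

omit [IsProbabilityMeasure μ] in
lemma integral_comp_iterate (hT : MeasurePreserving T μ μ) {h : Ω → ℝ}
    (hh : AEStronglyMeasurable h μ) (k : ℕ) : ∫ ω, h (T^[k] ω) ∂μ = ∫ ω, h ω ∂μ := by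
  have hk := hT.iterate k
  have := integral_map (f := h) hk.measurable.aemeasurable (by rwa [hk.map_eq])
  rw [hk.map_eq] at this
  exact this.symm

omit [IsProbabilityMeasure μ] in
lemma integrable_pow_mul_pow {f g : Ω → ℝ} (hf : MemLp f 4 μ) (hg : MemLp g 4 μ) {a b : ℕ}
    (hab : a + b = 4) : Integrable (fun ω => f ω ^ a * g ω ^ b) μ := by
  have hf4 := hf.integrable_norm_pow (p := 4) (by norm_num)
  have hg4 := hg.integrable_norm_pow (p := 4) (by norm_num)
  refine (hf4.add hg4).mono' ((hf.1.pow a).mul (hg.1.pow b)) (Eventually.of_forall fun ω => ?_)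
  rw [norm_mul, norm_pow, norm_pow, Pi.add_apply]
  have hx := norm_nonneg (f ω)
  have hy := norm_nonneg (g ω)
  rcases le_total ‖f ω‖ ‖g ω‖ with hc | hc
  · calc ‖f ω‖ ^ a * ‖g ω‖ ^ b ≤ ‖g ω‖ ^ a * ‖g ω‖ ^ b := by gcongr
      _ = ‖g ω‖ ^ 4 := by rw [← pow_add, hab]
      _ ≤ _ := le_add_of_nonneg_left (by positivity)
  · calc ‖f ω‖ ^ a * ‖g ω‖ ^ b ≤ ‖f ω‖ ^ a * ‖f ω‖ ^ b := by gcongr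
      _ = ‖f ω‖ ^ 4 := by rw [← pow_add, hab]
      _ ≤ _ := le_add_of_nonneg_right (by positivity)

omit [IsProbabilityMeasure μ] in
lemma integrable_pow_four {f : Ω → ℝ} (hf : MemLp f 4 μ) : Integrable (fun ω => f ω ^ 4) μ := by
  simpa using integrable_pow_mul_pow hf hf (a := 4) (b := 0) rfl

lemma memLp_two_of_four {f : Ω → ℝ} (hf : MemLp f 4 μ) : MemLp f 2 μ :=
  hf.mono_exponent (by norm_num)

namespace IsMartDiff

variable (hT : MeasurePreserving T μ μ) (hN : N ≤ mΩ) (hmono : N ≤ N.comap T) {h : Ω → ℝ}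
  (hh : IsMartDiff μ T N h)
include hT hN hmono hh

omit [IsProbabilityMeasure μ] hN in
lemma aesm_birkhoffSum (n : ℕ) : AEStronglyMeasurable[N.comap T^[n]] (birkhoffSum T h n) μ := by
  induction n with
  | zero => exact aestronglyMeasurable_const
  | succ n ih =>
    have h1 := hh.aesm.comp_comap_iterate hT n
    rw [MeasurableSpace.comap_comp, ← Function.iterate_succ' T n] at h1
    have e : birkhoffSum T h (n + 1) = birkhoffSum T h n + h ∘ T^[n] :=
      funext fun ω => birkhoffSum_succ _ _ _ _
    rw [e]
    exact (ih.mono (comap_iterate_mono hmono n.le_succ)).add h1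

omit hmono in
-- `h ∘ T^[k]` has conditional mean zero given `N.comap T^[k]`. Vector values are allowed for `Φ` in
-- order to cover both real powers and complex exponentials of partial sums.
lemma integral_smul_eq_zero {E : Type*} [NormedAddCommGroup E] [NormedSpace ℝ E] [CompleteSpace E]
    (hint : Integrable h μ) {k : ℕ} {Φ : Ω → E} (hΦ : AEStronglyMeasurable[N.comap T^[k]] Φ μ)
    (hi : Integrable (fun ω => h (T^[k] ω) • Φ ω) μ) : ∫ ω, h (T^[k] ω) • Φ ω ∂μ = 0 := by
  have hle : N.comap T^[k] ≤ mΩ :=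
    (MeasurableSpace.comap_mono hN).trans (hT.iterate k).measurable.comap_le
  have h1 := condExp_smul_of_aestronglyMeasurable_right (f := h ∘ T^[k])
    ((hT.iterate k).integrable_comp_of_integrable hint) hi hΦ
  have h2 : μ[h ∘ T^[k] | N.comap T^[k]] =ᵐ[μ] 0 :=
    (condExp_comp_measurePreserving (hT.iterate k) hN hint).trans
      ((hT.iterate k).quasiMeasurePreserving.ae_eq_comp hh.condExp_eq_zero)
  have h3 : ∫ ω, h (T^[k] ω) • Φ ω ∂μ =
      ∫ ω, (μ[(h ∘ T^[k]) • Φ | N.comap T^[k]]) ω ∂μ := (integral_condExp hle).symm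
  rw [h3]
  refine integral_eq_zero_of_ae ?_
  filter_upwards [h1, h2] with ω e1 e2
  rw [e1, Pi.smul_apply', e2]; simp

/-- Orthogonality: the square of a sum may be replaced by the sum of the squares. -/
lemma integral_sq_birkhoffSum_smul (h2 : MemLp h 2 μ) {k : ℕ} {G : Ω → ℂ}
    (hG : AEStronglyMeasurable[N.comap T^[k]] G μ) (hG1 : ∀ ω, ‖G ω‖ ≤ 1) (v : ℕ) :
    ∫ ω, (birkhoffSum T h v (T^[k] ω)) ^ 2 • G ω ∂μ =
      ∫ ω, (birkhoffSum T (fun ω => h ω ^ 2) v (T^[k] ω)) • G ω ∂μ := by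
  have hle : N.comap T^[k] ≤ mΩ :=
    (MeasurableSpace.comap_mono hN).trans (hT.iterate k).measurable.comap_le
  have hG' : AEStronglyMeasurable G μ := hG.mono hle
  have hbdd : ∀ {f : Ω → ℝ}, Integrable f μ → Integrable (fun ω => f ω • G ω) μ := fun {f} hf =>
    hf.norm.mono' (hf.1.smul hG') (Eventually.of_forall fun ω => by
      rw [norm_smul]; exact mul_le_of_le_one_right (norm_nonneg _) (hG1 ω))
  induction v with
  | zero => simp
  | succ v ih =>
    have hA : MemLp (fun ω => birkhoffSum T h v (T^[k] ω)) 2 μ :=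
      (memLp_birkhoffSum hT h2 v).comp_measurePreserving (hT.iterate k)
    have hX : MemLp (fun ω => h (T^[v + k] ω)) 2 μ :=
      h2.comp_measurePreserving (hT.iterate (v + k))
    have hQ : Integrable (fun ω => birkhoffSum T (fun ω => h ω ^ 2) v (T^[k] ω)) μ :=
      (hT.iterate k).integrable_comp_of_integrable (integrable_birkhoffSum hT h2.integrable_sq v)
    have hAX : Integrable (fun ω => birkhoffSum T h v (T^[k] ω) * h (T^[v + k] ω)) μ :=
      hA.integrable_mul hX
    have hzero : ∫ ω, (2 * (birkhoffSum T h v (T^[k] ω) * h (T^[v + k] ω))) • G ω ∂μ = 0 := by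
      have hm : AEStronglyMeasurable[N.comap T^[v + k]]
          (fun ω => birkhoffSum T h v (T^[k] ω)) μ := by
        have h1 := (hh.aesm_birkhoffSum hT hmono v).comp_comap_iterate hT k
        rwa [MeasurableSpace.comap_comp, ← Function.iterate_add] at h1
      have h1 := hh.integral_smul_eq_zero hT hN (h2.integrable (by norm_num)) (k := v + k)
        (Φ := fun ω => (2 * birkhoffSum T h v (T^[k] ω)) • G ω)
        ((hm.const_mul 2).smul (hG.mono (comap_iterate_mono hmono (Nat.le_add_left k v)))) ?_
      · rw [← h1]
        refine integral_congr_ae (Eventually.of_forall fun ω => ?_)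
        simp only [smul_smul]; congr 1; ring
      · refine (hbdd (hAX.const_mul 2)).congr (Eventually.of_forall fun ω => ?_)
        simp only [smul_smul]; congr 1; ring
    have e1 : ∀ ω, (birkhoffSum T h (v + 1) (T^[k] ω)) ^ 2 • G ω =
        (birkhoffSum T h v (T^[k] ω)) ^ 2 • G ω + (h (T^[v + k] ω) ^ 2 • G ω +
        (2 * (birkhoffSum T h v (T^[k] ω) * h (T^[v + k] ω))) • G ω) := by
      intro ω
      rw [birkhoffSum_succ, ← Function.iterate_add_apply, ← add_smul, ← add_smul]
      congr 1; ring
    have e2 : ∀ ω, (birkhoffSum T (fun ω => h ω ^ 2) (v + 1) (T^[k] ω)) • G ω =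
        (birkhoffSum T (fun ω => h ω ^ 2) v (T^[k] ω)) • G ω + h (T^[v + k] ω) ^ 2 • G ω := by
      intro ω
      rw [birkhoffSum_succ, ← Function.iterate_add_apply, ← add_smul]
    simp only [e1, e2]
    have i1 := hbdd hA.integrable_sq
    have i2 := hbdd hX.integrable_sq
    have i3 := hbdd (hAX.const_mul 2)
    have i23 : Integrable (fun ω => h (T^[v + k] ω) ^ 2 • G ω +
        (2 * (birkhoffSum T h v (T^[k] ω) * h (T^[v + k] ω))) • G ω) μ := i2.add i3
    rw [integral_add i1 i23, integral_add i2 i3, integral_add (hbdd hQ) i2, ih, hzero,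
      add_zero]

lemma integral_sq_birkhoffSum (h2 : MemLp h 2 μ) (v : ℕ) :
    ∫ ω, (birkhoffSum T h v ω) ^ 2 ∂μ = v * ∫ ω, h ω ^ 2 ∂μ := by
  have h1 := hh.integral_sq_birkhoffSum_smul hT hN hmono h2 (k := 0) (G := fun _ => 1)
    aestronglyMeasurable_const (by simp) v
  simp only [Function.iterate_zero, id_eq, Complex.real_smul, mul_one] at h1
  rw [integral_complex_ofReal, integral_complex_ofReal, Complex.ofReal_inj] at h1
  rw [h1]
  simp only [birkhoffSum]
  have hi : ∀ k, Integrable (fun ω => h (T^[k] ω) ^ 2) μ := fun k =>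
    (hT.iterate k).integrable_comp_of_integrable (g := fun ω => h ω ^ 2) h2.integrable_sq
  rw [integral_finsetSum _ fun k _ => hi k]
  simp [integral_comp_iterate hT (h := fun ω => h ω ^ 2) h2.integrable_sq.1]

/-- A fourth moment bound for sums of martingale differences. -/
lemma integral_pow_four_birkhoffSum_le (h4 : MemLp h 4 μ) {B : ℝ} (hB : ∫ ω, h ω ^ 4 ∂μ ≤ B)
    (n : ℕ) : ∫ ω, (birkhoffSum T h n ω) ^ 4 ∂μ ≤ 16 * n ^ 2 * B := by
  have hB0 : 0 ≤ B := le_trans (integral_nonneg fun ω => by positivity) hB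
  induction n with
  | zero => simp
  | succ n ih =>
    have hS : MemLp (birkhoffSum T h n) 4 μ := memLp_birkhoffSum hT h4 n
    have hX : MemLp (fun ω => h (T^[n] ω)) 4 μ := h4.comp_measurePreserving (hT.iterate n)
    have hX4 : ∫ ω, h (T^[n] ω) ^ 4 ∂μ ≤ B := by
      rwa [integral_comp_iterate hT (h := fun ω => h ω ^ 4) (integrable_pow_four h4).1]
    rcases Nat.eq_zero_or_pos n with rfl | hn
    · simp only [zero_add, birkhoffSum_one]
      simp at hX4 ⊢; linarith
    have hn' : (0 : ℝ) < n := by exact_mod_cast hn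
    have i3 : Integrable (fun ω => birkhoffSum T h n ω ^ 3 * h (T^[n] ω)) μ := by
      simpa using integrable_pow_mul_pow hS hX (a := 3) (b := 1) rfl
    have hzero : ∫ ω, birkhoffSum T h n ω ^ 3 * h (T^[n] ω) ∂μ = 0 := by
      have h1 := hh.integral_smul_eq_zero hT hN (h4.integrable (by norm_num)) (k := n)
        (Φ := fun ω => birkhoffSum T h n ω ^ 3) ((hh.aesm_birkhoffSum hT hmono n).pow 3)
        (by simpa [mul_comm] using i3)
      simpa [mul_comm] using h1
    -- From `4 s x³ ≤ 2 s² x² + 2 x⁴` and `8 s² x² ≤ s⁴/n + 16 n x⁴`. The weight `1/n` makes the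
    -- recursion close with growth `16 n²`; the term in `s³ x` integrates to zero.
    have hpt : ∀ s x : ℝ, (s + x) ^ 4 ≤
        (1 + 1 / n) * s ^ 4 + 4 * (s ^ 3 * x) + (16 * n + 3) * x ^ 4 := by
      intro s x
      have e1 : 8 * (s ^ 2 * x ^ 2) ≤ 1 / n * s ^ 4 + 16 * n * x ^ 4 := by
        have e : 1 / n * s ^ 4 + 16 * n * x ^ 4 - 8 * (s ^ 2 * x ^ 2) =
            1 / (n : ℝ) * (s ^ 2 - 4 * n * x ^ 2) ^ 2 := by field_simp; ring
        have : 0 ≤ 1 / (n : ℝ) * (s ^ 2 - 4 * n * x ^ 2) ^ 2 := by positivity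
        linarith
      have e2 : 0 ≤ x ^ 2 * (s - x) ^ 2 := by positivity
      nlinarith
    calc ∫ ω, (birkhoffSum T h (n + 1) ω) ^ 4 ∂μ
        ≤ ∫ ω, ((1 + 1 / n) * birkhoffSum T h n ω ^ 4 +
          4 * (birkhoffSum T h n ω ^ 3 * h (T^[n] ω)) + (16 * n + 3) * h (T^[n] ω) ^ 4) ∂μ := by
          refine integral_mono (integrable_pow_four (memLp_birkhoffSum hT h4 (n + 1)))
            ((((integrable_pow_four hS).const_mul _).add (i3.const_mul _)).add
              ((integrable_pow_four hX).const_mul _)) fun ω => ?_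
          simp only [birkhoffSum_succ]
          exact hpt _ _
      _ = (1 + 1 / n) * ∫ ω, birkhoffSum T h n ω ^ 4 ∂μ +
          (16 * n + 3) * ∫ ω, h (T^[n] ω) ^ 4 ∂μ := by
          have j1 : Integrable (fun ω => (1 + 1 / (n : ℝ)) * birkhoffSum T h n ω ^ 4) μ :=
            (integrable_pow_four hS).const_mul _
          have j2 : Integrable (fun ω => 4 * (birkhoffSum T h n ω ^ 3 * h (T^[n] ω))) μ :=
            i3.const_mul _
          have j3 : Integrable (fun ω => (16 * (n : ℝ) + 3) * h (T^[n] ω) ^ 4) μ :=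
            (integrable_pow_four hX).const_mul _
          have j12 : Integrable (fun ω => (1 + 1 / (n : ℝ)) * birkhoffSum T h n ω ^ 4 +
            4 * (birkhoffSum T h n ω ^ 3 * h (T^[n] ω))) μ := j1.add j2
          rw [integral_add j12 j3, integral_add j1 j2, integral_const_mul, integral_const_mul, integral_const_mul, hzero]
          ring
      _ ≤ (1 + 1 / n) * (16 * n ^ 2 * B) + (16 * n + 3) * B := by gcongr
      _ ≤ _ := by
          push_cast
          have : (1 + 1 / (n : ℝ)) * (16 * n ^ 2 * B) = (16 * n ^ 2 + 16 * n) * B := by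
            field_simp
          rw [this]
          nlinarith

end IsMartDiff

end MartingaleDifferences

/-! ### Elementary bounds for exponentials. -/

section ScalarBounds

lemma norm_exp_I_sub_taylor_le (x : ℝ) :
    ‖Complex.exp (x * Complex.I) - (1 + x * Complex.I - (x ^ 2 / 2 : ℝ))‖ ≤ 4 * |x| ^ 3 := by
  have hI : ‖(x : ℂ) * Complex.I‖ = |x| := by simp
  rcases le_or_gt |x| 1 with hx | hx
  · have h1 := Complex.exp_bound (x := x * Complex.I) (by rwa [hI]) (n := 3) (by norm_num)
    rw [hI] at h1
    have e : ∑ m ∈ Finset.range 3, ((x : ℂ) * Complex.I) ^ m / (m.factorial : ℂ) =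
        1 + x * Complex.I - (x ^ 2 / 2 : ℝ) := by
      simp [Finset.sum_range_succ, mul_pow, Nat.factorial]
      ring
    rw [e] at h1
    refine h1.trans ?_
    have h3 : 0 ≤ |x| ^ 3 := by positivity
    norm_num [Nat.factorial]
    linarith
  · have h1 : ‖Complex.exp (x * Complex.I)‖ = 1 := Complex.norm_exp_ofReal_mul_I x
    have h2 : ‖(1 + x * Complex.I - (x ^ 2 / 2 : ℝ) : ℂ)‖ ≤ 1 + |x| + |x| ^ 2 / 2 := by
      refine (norm_sub_le _ _).trans (add_le_add ((norm_add_le _ _).trans ?_) ?_)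
      · simp
      · rw [Complex.norm_real, Real.norm_of_nonneg (by positivity), sq_abs]
    refine (norm_sub_le _ _).trans ?_
    rw [h1]
    nlinarith [mul_pos (sub_pos.2 hx) (sub_pos.2 hx), sq_nonneg (|x|), pow_pos (zero_lt_one.trans hx) 3]

lemma abs_exp_neg_sub_le {s : ℝ} (hs : 0 ≤ s) : |Real.exp (-s) - (1 - s)| ≤ s ^ 2 / 2 := by
  have h1 := Real.one_sub_le_exp_neg s
  have h2 := Real.quadratic_le_exp_of_nonneg hs
  rw [abs_of_nonneg (by linarith)]
  have h3 : Real.exp (-s) * Real.exp s = 1 := by rw [← Real.exp_add]; simp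
  have h4 := Real.exp_pos (-s)
  have h5 : Real.exp (-s) * (1 + s + s ^ 2 / 2) ≤ 1 := by
    have := mul_le_mul_of_nonneg_left h2 h4.le
    linarith
  by_contra! hc
  have h6 : (1 - s + s ^ 2 / 2) * (1 + s + s ^ 2 / 2) < 1 := by
    refine lt_of_lt_of_le ?_ h5
    gcongr
    linarith
  nlinarith [sq_nonneg (s ^ 2)]

lemma abs_exp_neg_sub_exp_neg_le {x y : ℝ} (hx : 0 ≤ x) (hxy : x ≤ y) :
    |Real.exp (-x) - Real.exp (-y)| ≤ y - x := by
  have h1 : Real.exp (-y) = Real.exp (-x) * Real.exp (-(y - x)) := by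
    rw [← Real.exp_add]; congr 1; ring
  have h2 := Real.one_sub_le_exp_neg (y - x)
  have h3 : Real.exp (-x) ≤ 1 := Real.exp_le_one_iff.2 (by linarith)
  have h4 : Real.exp (-(y - x)) ≤ 1 := Real.exp_le_one_iff.2 (by linarith)
  have h5 := Real.exp_pos (-x)
  rw [h1, abs_of_nonneg (by nlinarith)]
  nlinarith

lemma abs_pow_three_le (x : ℝ) : |x| ^ 3 ≤ (x ^ 2 + x ^ 4) / 2 := by
  have h1 : x ^ 2 = |x| ^ 2 := (sq_abs x).symm
  have h2 : x ^ 4 = |x| ^ 4 := by rw [← abs_pow, abs_of_nonneg (by positivity)]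
  rw [h1, h2]
  nlinarith [sq_nonneg (|x| * (|x| - 1)), abs_nonneg x]

lemma norm_exp_I_sub_exp_I_le (x y : ℝ) :
    ‖Complex.exp (x * Complex.I) - Complex.exp (y * Complex.I)‖ ≤ |x - y| := by
  have h1 : Complex.exp (x * Complex.I) - Complex.exp (y * Complex.I) =
      Complex.exp (y * Complex.I) * (Complex.exp (Complex.I * ((x - y : ℝ) : ℂ)) - 1) := by
    rw [mul_sub, ← Complex.exp_add, mul_one]; congr 2; push_cast; ring
  rw [h1, norm_mul, Complex.norm_exp_ofReal_mul_I, one_mul]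
  exact Real.norm_exp_I_mul_ofReal_sub_one_le

end ScalarBounds

/-! ### A quantitative central limit theorem by blocks. -/

section MartingaleCLT

variable {Ω : Type*} {N mΩ : MeasurableSpace Ω} {μ : Measure Ω} [IsProbabilityMeasure μ]
  {T : Ω → Ω}

lemma integrable_exp_I {S : Ω → ℝ} (hS : AEStronglyMeasurable S μ) (a : ℝ) :
    Integrable (fun ω => Complex.exp ((a * S ω : ℝ) * Complex.I)) μ := by
  refine (integrable_const (1 : ℝ)).mono' ?_ (Eventually.of_forall fun ω => ?_)
  · exact (by fun_prop : Continuous fun x : ℝ =>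
      Complex.exp ((a * x : ℝ) * Complex.I)).comp_aestronglyMeasurable hS
  · rw [Complex.norm_exp_ofReal_mul_I]

lemma norm_integral_exp_I_sub_le {S S' : Ω → ℝ} (hS : Integrable S μ) (hS' : Integrable S' μ)
    (a : ℝ) : ‖∫ ω, Complex.exp ((a * S ω : ℝ) * Complex.I) ∂μ -
      ∫ ω, Complex.exp ((a * S' ω : ℝ) * Complex.I) ∂μ‖ ≤ |a| * ∫ ω, |S ω - S' ω| ∂μ := by
  rw [← integral_sub (integrable_exp_I hS.1 a) (integrable_exp_I hS'.1 a), ← integral_const_mul]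
  refine (norm_integral_le_integral_norm _).trans ?_
  refine integral_mono_of_nonneg (Eventually.of_forall fun ω => norm_nonneg _)
    ((hS.sub hS').abs.const_mul _) (Eventually.of_forall fun ω => ?_)
  refine (norm_exp_I_sub_exp_I_le _ _).trans (le_of_eq ?_)
  rw [← mul_sub, abs_mul]

/-- The mean deviation of the averages of the squares from `σ2`. -/
noncomputable def sqDeviation (μ : Measure Ω) (T : Ω → Ω) (h : Ω → ℝ) (σ2 : ℝ) (v : ℕ) : ℝ :=
  ∫ ω, |birkhoffSum T (fun ω => h ω ^ 2) v ω - v * σ2| ∂μ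

namespace IsMartDiff

variable (hT : MeasurePreserving T μ μ) (hN : N ≤ mΩ) (hmono : N ≤ N.comap T) {h : Ω → ℝ}
  (hh : IsMartDiff μ T N h)
include hT hN hmono hh

/-- One step of the telescoping argument, from `k` to `k + v` summands. -/
lemma norm_integral_exp_step_le (h4 : MemLp h 4 μ) {B : ℝ} (hB : ∫ ω, h ω ^ 4 ∂μ ≤ B)
    {σ2 : ℝ} (hσ : 0 ≤ σ2) (a : ℝ) (k v : ℕ) :
    ‖∫ ω, Complex.exp ((a * birkhoffSum T h (k + v) ω : ℝ) * Complex.I) ∂μ -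
      Real.exp (-(a ^ 2 * v * σ2 / 2)) *
        ∫ ω, Complex.exp ((a * birkhoffSum T h k ω : ℝ) * Complex.I) ∂μ‖ ≤
      a ^ 4 * v ^ 2 * σ2 ^ 2 / 8 + a ^ 2 / 2 * sqDeviation μ T h σ2 v +
        2 * |a| ^ 3 * (v * (1 + B) + 16 * v ^ 2 * B) := by
  have h2 : MemLp h 2 μ := memLp_two_of_four h4
  have hle : N.comap T^[k] ≤ mΩ :=
    (MeasurableSpace.comap_mono hN).trans (hT.iterate k).measurable.comap_le
  set G : Ω → ℂ := fun ω => Complex.exp ((a * birkhoffSum T h k ω : ℝ) * Complex.I) with hGdef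
  set Y : Ω → ℝ := fun ω => birkhoffSum T h v (T^[k] ω) with hY
  set Q : Ω → ℝ := fun ω => birkhoffSum T (fun ω => h ω ^ 2) v (T^[k] ω) with hQ
  have hGm : AEStronglyMeasurable[N.comap T^[k]] G μ :=
    (by fun_prop : Continuous fun x : ℝ => Complex.exp ((a * x : ℝ) * Complex.I)
      ).comp_aestronglyMeasurable (hh.aesm_birkhoffSum hT hmono k)
  have hG1 : ∀ ω, ‖G ω‖ = 1 := fun ω => Complex.norm_exp_ofReal_mul_I _
  have hbdd : ∀ {f : Ω → ℝ}, Integrable f μ → Integrable (fun ω => f ω • G ω) μ := fun {f} hf =>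
    hf.norm.mono' (hf.1.smul (hGm.mono hle)) (Eventually.of_forall fun ω => by
      rw [norm_smul, hG1, mul_one])
  have hbddR : ∀ {f : Ω → ℝ}, ‖∫ ω, f ω • G ω ∂μ‖ ≤ ∫ ω, |f ω| ∂μ := fun {f} => by
    refine (norm_integral_le_integral_norm _).trans (le_of_eq ?_)
    simp [hG1]
  have hY4 : MemLp Y 4 μ := (memLp_birkhoffSum hT h4 v).comp_measurePreserving (hT.iterate k)
  have hY2 : MemLp Y 2 μ := memLp_two_of_four hY4
  have hYi : Integrable Y μ := hY2.integrable (by norm_num)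
  have hQi : Integrable Q μ :=
    (hT.iterate k).integrable_comp_of_integrable (integrable_birkhoffSum hT h2.integrable_sq v)
  have hGi : Integrable G μ := integrable_exp_I (memLp_birkhoffSum hT h2 k).1 a
  -- the linear term vanishes
  have hlin : ∫ ω, Y ω • G ω ∂μ = 0 := by
    simp only [hY, birkhoffSum, Finset.sum_smul, ← Function.iterate_add_apply]
    have hi : ∀ j, Integrable (fun ω => h (T^[j + k] ω) • G ω) μ := fun j =>
      hbdd ((hT.iterate (j + k)).integrable_comp_of_integrable (h2.integrable (by norm_num)))
    rw [integral_finsetSum _ fun j _ => hi j]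
    exact Finset.sum_eq_zero fun j _ => hh.integral_smul_eq_zero hT hN
      (h2.integrable (by norm_num)) (hGm.mono (comap_iterate_mono hmono (Nat.le_add_left k j)))
      (hi j)
  -- Orthogonality turns the square of the block sum into the sum `Q` of squares, which is then
  -- compared with the constant `v * σ2`.
  have hquad : ∫ ω, (Y ω) ^ 2 • G ω ∂μ = ∫ ω, Q ω • G ω ∂μ :=
    hh.integral_sq_birkhoffSum_smul hT hN hmono h2 hGm (fun ω => (hG1 ω).le) v
  have hquad' : ∫ ω, Q ω • G ω ∂μ = ∫ ω, (Q ω - v * σ2) • G ω ∂μ + (v * σ2 : ℝ) * ∫ ω, G ω ∂μ := by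
    have e : ∀ ω, Q ω • G ω = (Q ω - v * σ2) • G ω + (v * σ2 : ℝ) • G ω := fun ω => by
      rw [← add_smul]; congr 1; ring
    simp only [e]
    have i1 : Integrable (fun ω => (Q ω - v * σ2) • G ω) μ := hbdd (hQi.sub (integrable_const _))
    have i2 : Integrable (fun ω => (v * σ2 : ℝ) • G ω) μ := hGi.smul (v * σ2 : ℝ)
    rw [integral_add i1 i2, integral_smul, Complex.real_smul]
  have hdev : ∫ ω, |Q ω - v * σ2| ∂μ = sqDeviation μ T h σ2 v :=
    integral_comp_iterate hT (h := fun ω => |birkhoffSum T (fun ω => h ω ^ 2) v ω - v * σ2|)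
      ((integrable_birkhoffSum hT h2.integrable_sq v).sub (integrable_const _)).abs.1 k
  -- the remainder term
  set ρ : Ω → ℂ := fun ω => Complex.exp ((a * birkhoffSum T h (k + v) ω : ℝ) * Complex.I) -
    (G ω + (a * Complex.I) * (Y ω • G ω) - (a ^ 2 / 2 : ℝ) * (Y ω ^ 2 • G ω)) with hρ
  have hρle : ∀ ω, ‖ρ ω‖ ≤ 2 * |a| ^ 3 * (Y ω ^ 2 + Y ω ^ 4) := by
    intro ω
    have e : ρ ω = (Complex.exp ((a * Y ω : ℝ) * Complex.I) -
        (1 + (a * Y ω : ℝ) * Complex.I - ((a * Y ω) ^ 2 / 2 : ℝ))) * G ω := by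
      simp only [hρ, birkhoffSum_add, hGdef, Complex.real_smul]
      rw [mul_add, Complex.ofReal_add, add_mul, Complex.exp_add]
      push_cast
      ring
    rw [e, norm_mul, hG1, mul_one]
    refine (norm_exp_I_sub_taylor_le _).trans ?_
    rw [abs_mul, mul_pow]
    have := mul_le_mul_of_nonneg_left (abs_pow_three_le (Y ω)) (by positivity : 0 ≤ 4 * |a| ^ 3)
    linarith
  have hmom : ∫ ω, (2 * |a| ^ 3 * (Y ω ^ 2 + Y ω ^ 4)) ∂μ ≤
      2 * |a| ^ 3 * (v * (1 + B) + 16 * v ^ 2 * B) := by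
    rw [integral_const_mul, integral_add hY2.integrable_sq (integrable_pow_four hY4)]
    gcongr
    · have e1 : ∫ ω, Y ω ^ 2 ∂μ = v * ∫ ω, h ω ^ 2 ∂μ := by
        rw [← hh.integral_sq_birkhoffSum hT hN hmono h2 v]
        exact integral_comp_iterate hT (h := fun ω => birkhoffSum T h v ω ^ 2)
          (memLp_birkhoffSum hT h2 v).integrable_sq.1 k
      rw [e1]
      gcongr
      have e2 : ∫ ω, h ω ^ 2 ∂μ ≤ ∫ ω, (1 + h ω ^ 4) ∂μ :=
        integral_mono h2.integrable_sq ((integrable_const _).add (integrable_pow_four h4))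
          fun ω => by
            show h ω ^ 2 ≤ 1 + h ω ^ 4
            nlinarith [sq_nonneg (h ω ^ 2 - 1)]
      rw [integral_add (integrable_const _) (integrable_pow_four h4)] at e2
      simp at e2
      linarith
    · have e1 := hh.integral_pow_four_birkhoffSum_le hT hN hmono h4 hB v
      rwa [← integral_comp_iterate hT (h := fun ω => birkhoffSum T h v ω ^ 4)
          (integrable_pow_four (memLp_birkhoffSum hT h4 v)).1 k] at e1
  have hρi : ‖∫ ω, ρ ω ∂μ‖ ≤ 2 * |a| ^ 3 * (v * (1 + B) + 16 * v ^ 2 * B) := by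
    refine (norm_integral_le_integral_norm _).trans (le_trans ?_ hmom)
    exact integral_mono_of_nonneg (Eventually.of_forall fun ω => norm_nonneg _)
      ((hY2.integrable_sq.add (integrable_pow_four hY4)).const_mul _) (Eventually.of_forall hρle)
  have i1 : Integrable (fun ω => (a * Complex.I) * (Y ω • G ω)) μ := (hbdd hYi).const_mul _
  have i2 : Integrable (fun ω => ((a ^ 2 / 2 : ℝ) : ℂ) * (Y ω ^ 2 • G ω)) μ :=
    (hbdd hY2.integrable_sq).const_mul _
  have i3 : Integrable (fun ω => G ω + (a * Complex.I) * (Y ω • G ω)) μ := hGi.add i1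
  have i4 : Integrable (fun ω => G ω + (a * Complex.I) * (Y ω • G ω) -
    (a ^ 2 / 2 : ℝ) * (Y ω ^ 2 • G ω)) μ := i3.sub i2
  have hmain : ∫ ω, ρ ω ∂μ =
      ∫ ω, Complex.exp ((a * birkhoffSum T h (k + v) ω : ℝ) * Complex.I) ∂μ -
      (∫ ω, G ω ∂μ - (a ^ 2 / 2 : ℝ) * (∫ ω, (Q ω - v * σ2) • G ω ∂μ +
        (v * σ2 : ℝ) * ∫ ω, G ω ∂μ)) := by
    simp only [hρ]
    rw [integral_sub (integrable_exp_I (memLp_birkhoffSum hT h2 (k + v)).1 a) i4,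
      integral_sub i3 i2, integral_add hGi i1, integral_const_mul, integral_const_mul, hlin,
      hquad, hquad', mul_zero, add_zero]
  set s : ℝ := a ^ 2 * v * σ2 / 2 with hs
  have hz : ‖∫ ω, G ω ∂μ‖ ≤ 1 := by
    refine (norm_integral_le_integral_norm _).trans ?_
    simp [hG1]
  -- Three errors remain: `exp (-s)` against `1 - s`, the deviation of `Q` from `v * σ2`, and the
  -- Taylor remainder.
  have hfinal : ∫ ω, Complex.exp ((a * birkhoffSum T h (k + v) ω : ℝ) * Complex.I) ∂μ -
      Real.exp (-s) * ∫ ω, G ω ∂μ =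
      -((Real.exp (-s) - (1 - s) : ℝ) : ℂ) * ∫ ω, G ω ∂μ -
        (a ^ 2 / 2 : ℝ) * ∫ ω, (Q ω - v * σ2) • G ω ∂μ + ∫ ω, ρ ω ∂μ := by
    rw [hmain, hs]; push_cast; ring
  rw [hfinal]
  refine (norm_add_le _ _).trans (add_le_add ((norm_sub_le _ _).trans (add_le_add ?_ ?_)) hρi)
  · rw [norm_mul, norm_neg, Complex.norm_real, Real.norm_eq_abs]
    have h1 := abs_exp_neg_sub_le (s := s) (by positivity)
    have e : s ^ 2 / 2 = a ^ 4 * v ^ 2 * σ2 ^ 2 / 8 := by rw [hs]; ring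
    rw [← e]
    exact (mul_le_of_le_one_right (abs_nonneg _) hz).trans h1
  · rw [norm_mul, Complex.norm_real, Real.norm_of_nonneg (by positivity)]
    gcongr
    exact hbddR.trans hdev.le

/-- The telescoped estimate for sums over blocks. -/
lemma norm_integral_exp_blocks_le (h4 : MemLp h 4 μ) {B : ℝ} (hB : ∫ ω, h ω ^ 4 ∂μ ≤ B)
    {σ2 : ℝ} (hσ : 0 ≤ σ2) (a : ℝ) (v q : ℕ) :
    ‖∫ ω, Complex.exp ((a * birkhoffSum T h (v * q) ω : ℝ) * Complex.I) ∂μ -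
      Real.exp (-(a ^ 2 * v * σ2 / 2 * q))‖ ≤
      q * (a ^ 4 * v ^ 2 * σ2 ^ 2 / 8 + a ^ 2 / 2 * sqDeviation μ T h σ2 v +
        2 * |a| ^ 3 * (v * (1 + B) + 16 * v ^ 2 * B)) := by
  induction q with
  | zero => simp
  | succ q ih =>
    have h1 := hh.norm_integral_exp_step_le hT hN hmono h4 hB hσ a (v * q) v
    set s : ℝ := a ^ 2 * v * σ2 / 2 with hs
    have e : ((Real.exp (-(s * (q + 1 : ℕ))) : ℝ) : ℂ) =
        Real.exp (-s) * Real.exp (-(s * q)) := by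
      rw [← Complex.ofReal_mul, ← Real.exp_add]; congr 2; push_cast; ring
    have e2 : ∀ z w x : ℂ, z - Real.exp (-s) * w = (z - Real.exp (-s) * x) +
        Real.exp (-s) * (x - w) := fun z w x => by ring
    rw [e, Nat.mul_succ, e2 _ _ (∫ ω, Complex.exp ((a * birkhoffSum T h (v * q) ω : ℝ) *
      Complex.I) ∂μ)]
    refine (norm_add_le _ _).trans ((add_le_add h1 (le_trans ?_ ih)).trans (le_of_eq ?_))
    · rw [norm_mul, Complex.norm_real, Real.norm_of_nonneg (Real.exp_pos _).le]
      have hexp : Real.exp (-s) ≤ 1 := Real.exp_le_one_iff.2 (by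
        have : 0 ≤ s := by positivity
        linarith)
      exact mul_le_of_le_one_left (norm_nonneg _) hexp
    · push_cast; ring

end IsMartDiff

/-- The error term of the martingale central limit theorem with blocks of length `v`. -/
noncomputable def martError (t σ2 B : ℝ) (v n : ℕ) : ℝ :=
  t ^ 2 * (v ^ 2 * σ2 ^ 2 / 8) * (|t| / √n) ^ 2 +
    t ^ 2 * (2 * (v * (1 + B) + 16 * v ^ 2 * B)) * (|t| / √n) +
    (1 + v * (1 + B)) * (|t| / √n) + v * σ2 / 2 * (|t| / √n) ^ 2

lemma tendsto_martError (t σ2 B : ℝ) (v : ℕ) :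
    Tendsto (martError t σ2 B v) atTop (𝓝 0) := by
  have h1 : Tendsto (fun n : ℕ => |t| / √(n : ℝ)) atTop (𝓝 0) :=
    (tendsto_const_nhds.div_atTop tendsto_id).comp
      (Real.tendsto_sqrt_atTop.comp tendsto_natCast_atTop_atTop)
  have h2 := h1.pow 2
  have h3 := (((h2.const_mul (t ^ 2 * (v ^ 2 * σ2 ^ 2 / 8))).add
    (h1.const_mul (t ^ 2 * (2 * (v * (1 + B) + 16 * v ^ 2 * B))))).add
    (h1.const_mul (1 + v * (1 + B)))).add (h2.const_mul (v * σ2 / 2))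
  simp only [ne_eq, OfNat.ofNat_ne_zero, not_false_eq_true, zero_pow, mul_zero, add_zero] at h3
  exact h3

/-- A quantitative central limit theorem for stationary martingale differences. -/
theorem IsMartDiff.norm_charFun_sub_le (hT : MeasurePreserving T μ μ) (hN : N ≤ mΩ)
    (hmono : N ≤ N.comap T) {h : Ω → ℝ} (hh : IsMartDiff μ T N h) (h4 : MemLp h 4 μ) {B : ℝ}
    (hB : ∫ ω, h ω ^ 4 ∂μ ≤ B) {σ2 : ℝ} (hσ : 0 ≤ σ2) (t : ℝ) {v n : ℕ} (hv : v ≠ 0)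
    (hn : n ≠ 0) :
    ‖∫ ω, Complex.exp ((t / √n * birkhoffSum T h n ω : ℝ) * Complex.I) ∂μ -
      Real.exp (-(t ^ 2 * σ2 / 2))‖ ≤
      t ^ 2 / 2 * (sqDeviation μ T h σ2 v / v) + martError t σ2 B v n := by
  have h2 : MemLp h 2 μ := memLp_two_of_four h4
  have hB0 : 0 ≤ B := le_trans (integral_nonneg fun ω => by positivity) hB
  have hn' : (0 : ℝ) < n := by positivity
  have hv' : (0 : ℝ) < v := by positivity
  set a : ℝ := t / √n with ha
  have hat : |a| = |t| / √n := by rw [ha, abs_div, abs_of_nonneg (Real.sqrt_nonneg _)]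
  have hat2 : a ^ 2 * n = t ^ 2 := by
    rw [ha, div_pow, Real.sq_sqrt hn'.le]; field_simp
  -- There are `q` full blocks and a remainder of length `r < v`. The deviations add up to at most a
  -- multiple of `sqDeviation / v`, because `a² v q ≤ t²`; every other error keeps a factor `|t| /
  -- √n` and goes into `martError`.
  set q := n / v
  set r := n % v
  have hqr : n = v * q + r := (Nat.div_add_mod n v).symm
  have hr : r ≤ v := (Nat.mod_lt n (Nat.pos_of_ne_zero hv)).le
  have hqrR : (n : ℝ) = v * q + r := by exact_mod_cast hqr
  have hr' : (r : ℝ) ≤ v := by exact_mod_cast hr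
  have hr0 : (0 : ℝ) ≤ r := by positivity
  have hq0 : (0 : ℝ) ≤ q := by positivity
  have hqv : a ^ 2 * (v * q) ≤ t ^ 2 := by
    rw [← hat2]; gcongr; linarith
  have hq : a ^ 2 * q ≤ t ^ 2 := by
    refine le_trans ?_ hqv
    gcongr
    have : (1 : ℝ) ≤ v := by exact_mod_cast Nat.one_le_iff_ne_zero.2 hv
    nlinarith
  have hblock := hh.norm_integral_exp_blocks_le hT hN hmono h4 hB hσ a v q
  have hD0 : 0 ≤ sqDeviation μ T h σ2 v := integral_nonneg fun ω => abs_nonneg _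
  -- the incomplete block
  have hrest : ‖∫ ω, Complex.exp ((a * birkhoffSum T h n ω : ℝ) * Complex.I) ∂μ -
      ∫ ω, Complex.exp ((a * birkhoffSum T h (v * q) ω : ℝ) * Complex.I) ∂μ‖ ≤
      |a| * (1 + v * (1 + B)) := by
    refine (norm_integral_exp_I_sub_le (integrable_birkhoffSum hT (h2.integrable (by norm_num)) _)
      (integrable_birkhoffSum hT (h2.integrable (by norm_num)) _) a).trans ?_
    gcongr
    have e1 : ∀ ω, |birkhoffSum T h n ω - birkhoffSum T h (v * q) ω| =
        |birkhoffSum T h r (T^[v * q] ω)| := fun ω => by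
      rw [hqr, birkhoffSum_add, add_sub_cancel_left]
    have hS2 := (memLp_birkhoffSum hT h2 r).integrable_sq
    simp only [e1]
    rw [integral_comp_iterate hT (h := fun ω => |birkhoffSum T h r ω|)
      (integrable_birkhoffSum hT (h2.integrable (by norm_num)) r).abs.1]
    calc ∫ ω, |birkhoffSum T h r ω| ∂μ ≤ ∫ ω, (1 + birkhoffSum T h r ω ^ 2) ∂μ := by
          refine integral_mono (integrable_birkhoffSum hT (h2.integrable (by norm_num)) r).abs
            ((integrable_const _).add hS2) fun ω => ?_
          show |birkhoffSum T h r ω| ≤ 1 + birkhoffSum T h r ω ^ 2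
          rw [← sq_abs]
          nlinarith [sq_nonneg (|birkhoffSum T h r ω| - 1)]
      _ = 1 + r * ∫ ω, h ω ^ 2 ∂μ := by
          rw [integral_add (integrable_const _) hS2, hh.integral_sq_birkhoffSum hT hN hmono h2]
          simp
      _ ≤ 1 + v * (1 + B) := by
          have e2 : ∫ ω, h ω ^ 2 ∂μ ≤ ∫ ω, (1 + h ω ^ 4) ∂μ :=
            integral_mono h2.integrable_sq ((integrable_const _).add (integrable_pow_four h4))
              fun ω => by
                show h ω ^ 2 ≤ 1 + h ω ^ 4
                nlinarith [sq_nonneg (h ω ^ 2 - 1)]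
          rw [integral_add (integrable_const _) (integrable_pow_four h4)] at e2
          simp at e2
          have e3 : 0 ≤ ∫ ω, h ω ^ 2 ∂μ := integral_nonneg fun ω => by positivity
          gcongr
          linarith
  have hexp : ‖((Real.exp (-(a ^ 2 * v * σ2 / 2 * q)) : ℝ) : ℂ) -
      (Real.exp (-(t ^ 2 * σ2 / 2)) : ℝ)‖ ≤ v * σ2 / 2 * |a| ^ 2 := by
    rw [← Complex.ofReal_sub, Complex.norm_real, Real.norm_eq_abs, sq_abs]
    refine (abs_exp_neg_sub_exp_neg_le (by positivity) ?_).trans ?_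
    · rw [← hat2]
      have : 0 ≤ a ^ 2 * r * σ2 / 2 := by positivity
      rw [hqrR]
      linarith
    · rw [← hat2, hqrR]
      have : a ^ 2 * r * σ2 / 2 ≤ a ^ 2 * v * σ2 / 2 := by gcongr
      linarith
  have hsum : q * (a ^ 4 * v ^ 2 * σ2 ^ 2 / 8 + a ^ 2 / 2 * sqDeviation μ T h σ2 v +
        2 * |a| ^ 3 * (v * (1 + B) + 16 * v ^ 2 * B)) ≤
      t ^ 2 * (v ^ 2 * σ2 ^ 2 / 8) * |a| ^ 2 + t ^ 2 / 2 * (sqDeviation μ T h σ2 v / v) +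
      t ^ 2 * (2 * (v * (1 + B) + 16 * v ^ 2 * B)) * |a| := by
    have f1 : q * (a ^ 4 * v ^ 2 * σ2 ^ 2 / 8) ≤ t ^ 2 * (v ^ 2 * σ2 ^ 2 / 8) * |a| ^ 2 := by
      have := mul_le_mul_of_nonneg_right hq (by positivity : 0 ≤ v ^ 2 * σ2 ^ 2 / 8 * a ^ 2)
      rw [sq_abs]; nlinarith
    have f2 : q * (a ^ 2 / 2 * sqDeviation μ T h σ2 v) ≤
        t ^ 2 / 2 * (sqDeviation μ T h σ2 v / v) := by
      have := mul_le_mul_of_nonneg_right hqv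
        (by positivity : 0 ≤ sqDeviation μ T h σ2 v / v / 2)
      have e : a ^ 2 * (v * q) * (sqDeviation μ T h σ2 v / v / 2) =
        q * (a ^ 2 / 2 * sqDeviation μ T h σ2 v) := by field_simp
      linarith
    have f3 : q * (2 * |a| ^ 3 * (v * (1 + B) + 16 * v ^ 2 * B)) ≤
        t ^ 2 * (2 * (v * (1 + B) + 16 * v ^ 2 * B)) * |a| := by
      have := mul_le_mul_of_nonneg_right hq
        (by positivity : 0 ≤ 2 * (v * (1 + B) + 16 * v ^ 2 * B) * |a|)
      have e : |a| ^ 3 = a ^ 2 * |a| := by rw [pow_succ, sq_abs]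
      rw [e]; linarith
    linarith
  have e3 : ∀ x y z w : ℂ, x - w = (x - y) + ((y - z) + (z - w)) := fun x y z w => by ring
  rw [e3 _ (∫ ω, Complex.exp ((a * birkhoffSum T h (v * q) ω : ℝ) * Complex.I) ∂μ)
    ((Real.exp (-(a ^ 2 * v * σ2 / 2 * q)) : ℝ) : ℂ)]
  refine (norm_add_le _ _).trans ((add_le_add hrest ((norm_add_le _ _).trans
    (add_le_add (hblock.trans hsum) hexp))).trans ?_)
  rw [martError, ← hat]
  linarith

end MartingaleCLT

/-! ### The mean ergodic theorem. -/

section Ergodic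

variable {Ω : Type*} {mΩ : MeasurableSpace Ω} {μ : Measure Ω} [IsProbabilityMeasure μ]
  {T : Ω → Ω}

lemma integral_abs_le_norm (u : Lp ℝ 2 μ) : ∫ ω, |u ω| ∂μ ≤ ‖u‖ := by
  have h1 := eLpNorm_le_eLpNorm_of_exponent_le (μ := μ) (f := u) (p := 1) (q := 2) (by norm_num)
    (Lp.aestronglyMeasurable u)
  have h2 : ∫ ω, |u ω| ∂μ = (eLpNorm u 1 μ).toReal := by
    rw [eLpNorm_one_eq_lintegral_enorm, ← integral_norm_eq_lintegral_enorm
      (Lp.aestronglyMeasurable u)]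
    rfl
  rw [h2, Lp.norm_def]
  exact ENNReal.toReal_mono (Lp.eLpNorm_ne_top u) h1

omit [IsProbabilityMeasure μ] in
lemma coeFn_birkhoffAverage (hT : MeasurePreserving T μ μ) {f : Ω → ℝ} (hf : MemLp f 2 μ) (v : ℕ) :
    ((birkhoffAverage ℝ (Lp.compMeasurePreservingₗᵢ ℝ T hT) _root_.id v (hf.toLp f) : Lp ℝ 2 μ) :
      Ω → ℝ) =ᵐ[μ]
      fun ω => (v : ℝ)⁻¹ * birkhoffSum T f v ω := by
  have h1 : ∀ k, (((Lp.compMeasurePreservingₗᵢ ℝ T hT)^[k] (hf.toLp f) : Lp ℝ 2 μ) : Ω → ℝ) =ᵐ[μ]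
      f ∘ T^[k] := by
    intro k
    have e : (Lp.compMeasurePreservingₗᵢ ℝ T hT)^[k] (hf.toLp f) =
        Lp.compMeasurePreserving T^[k] (hT.iterate k) (hf.toLp f) := by
      rw [← Lp.compMeasurePreserving_iterate hT k]; rfl
    rw [e]
    exact (Lp.coeFn_compMeasurePreserving _ _).trans
      ((hT.iterate k).quasiMeasurePreserving.ae_eq_comp hf.coeFn_toLp)
  have h2 : ((birkhoffSum (Lp.compMeasurePreservingₗᵢ ℝ T hT) _root_.id v (hf.toLp f) :
      Lp ℝ 2 μ) : Ω → ℝ) =ᵐ[μ] birkhoffSum T f v := by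
    induction v with
    | zero => simpa using Lp.coeFn_zero ℝ 2 μ
    | succ v ih =>
      rw [birkhoffSum_succ]
      filter_upwards [Lp.coeFn_add (birkhoffSum (Lp.compMeasurePreservingₗᵢ ℝ T hT) _root_.id v
        (hf.toLp f)) (_root_.id ((Lp.compMeasurePreservingₗᵢ ℝ T hT)^[v] (hf.toLp f))), ih, h1 v]
        with ω e1 e2 e3
      rw [e1, Pi.add_apply, e2, birkhoffSum_succ]
      congr 1
  rw [birkhoffAverage]
  filter_upwards [Lp.coeFn_smul (v : ℝ)⁻¹ (birkhoffSum (Lp.compMeasurePreservingₗᵢ ℝ T hT)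
    _root_.id v (hf.toLp f)), h2] with ω e1 e2
  rw [e1, Pi.smul_apply, e2, smul_eq_mul]

/-- The mean ergodic theorem in `L¹` for an ergodic transformation. -/
lemma tendsto_integral_abs_birkhoff (hT : Ergodic T μ) {f : Ω → ℝ} (hf : MemLp f 2 μ) :
    Tendsto (fun v : ℕ => (∫ ω, |birkhoffSum T f v ω - v * ∫ ω, f ω ∂μ| ∂μ) / v)
      atTop (𝓝 0) := by
  have hmp := hT.toMeasurePreserving
  set U := Lp.compMeasurePreservingₗᵢ (E := ℝ) (p := 2) ℝ T hmp with hU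
  set A : ℕ → Lp ℝ 2 μ := fun v => birkhoffAverage ℝ U _root_.id v (hf.toLp f) with hA
  -- Von Neumann's theorem gives an invariant limit, which ergodicity makes constant; comparing
  -- integrals identifies the constant.
  obtain ⟨G, hG, hlim⟩ : ∃ G : Lp ℝ 2 μ, U G = G ∧ Tendsto A atTop (𝓝 G) := by
    have h1 := U.toContinuousLinearMap.tendsto_birkhoffAverage_orthogonalProjection
      U.norm_toContinuousLinearMap_le (hf.toLp f)
    refine ⟨_, ?_, h1⟩
    exact LinearMap.mem_eqLocus.1 (Submodule.coe_mem _)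
  obtain ⟨c, hc⟩ : ∃ c : ℝ, (G : Ω → ℝ) =ᵐ[μ] fun _ => c := by
    refine hT.ae_eq_const_of_ae_eq_comp_ae (Lp.aestronglyMeasurable G) ?_
    have h1 := Lp.coeFn_compMeasurePreserving G hmp
    have h2 : Lp.compMeasurePreserving T hmp G = G := hG
    rw [h2] at h1
    exact h1.symm
  have hlim' : Tendsto (fun v => ‖A v - G‖) atTop (𝓝 0) := by
    rw [← tendsto_iff_norm_sub_tendsto_zero]; exact hlim
  have hle : ∀ v : ℕ, ∫ ω, |(v : ℝ)⁻¹ * birkhoffSum T f v ω - c| ∂μ ≤ ‖A v - G‖ := by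
    intro v
    refine le_trans (le_of_eq ?_) (integral_abs_le_norm (A v - G))
    refine integral_congr_ae ?_
    filter_upwards [Lp.coeFn_sub (A v) G, hc, coeFn_birkhoffAverage hmp hf v] with ω e1 e2 e3
    rw [e1, Pi.sub_apply, e2]
    rw [show (A v : Ω → ℝ) ω = _ from e3]
  have hfi : Integrable f μ := hf.integrable (by norm_num)
  have hint : ∀ v : ℕ, v ≠ 0 → ∫ ω, ((v : ℝ)⁻¹ * birkhoffSum T f v ω - c) ∂μ = ∫ ω, f ω ∂μ - c := by
    intro v hv
    have hv' : (v : ℝ) ≠ 0 := by exact_mod_cast hv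
    have e : ∫ ω, birkhoffSum T f v ω ∂μ = v * ∫ ω, f ω ∂μ := by
      simp only [birkhoffSum]
      have hi : ∀ k, Integrable (fun ω => f (T^[k] ω)) μ := fun k =>
        (hmp.iterate k).integrable_comp_of_integrable hfi
      rw [integral_finsetSum _ fun k _ => hi k]
      simp [integral_comp_iterate hmp hfi.1]
    rw [integral_sub ((integrable_birkhoffSum hmp hfi v).const_mul _) (integrable_const _),
      integral_const_mul, e]
    simp [hv']
  have hcf : ∫ ω, f ω ∂μ = c := by
    have h1 : ∀ᶠ v : ℕ in atTop, |∫ ω, f ω ∂μ - c| ≤ ‖A v - G‖ := by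
      filter_upwards [eventually_ne_atTop 0] with v hv
      rw [← hint v hv]
      exact (abs_integral_le_integral_abs).trans (hle v)
    have h2 := ge_of_tendsto hlim' h1
    exact sub_eq_zero.1 (abs_nonpos_iff.1 h2)
  refine squeeze_zero' (Eventually.of_forall fun v =>
    div_nonneg (integral_nonneg fun ω => abs_nonneg _) (Nat.cast_nonneg v)) ?_ hlim'
  filter_upwards [eventually_ne_atTop 0] with v hv
  have hv' : (0 : ℝ) < v := by positivity
  refine le_trans (le_of_eq ?_) (hle v)
  rw [hcf, ← integral_div]
  refine integral_congr_ae (Eventually.of_forall fun ω => ?_)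
  simp only
  nth_rewrite 2 [← abs_of_pos hv']
  rw [← abs_div]
  congr 1
  field_simp

end Ergodic

/-! ### Central limit theorem for arrays of martingale differences. -/

section CLTFromDeviation

variable {Ω : Type*} {N mΩ : MeasurableSpace Ω} {μ : Measure Ω} [IsProbabilityMeasure μ]
  {T : Ω → Ω}

/-- A central limit theorem for a family of stationary martingale differences, under
a law of large numbers for the squares on long blocks. -/
lemma tendsto_charFun_of_sqDeviation {κ : Type*} {F : Filter κ} (hT : MeasurePreserving T μ μ)
    (hN : N ≤ mΩ) (hmono : N ≤ N.comap T) {R : κ → Ω → ℝ} (hR : ∀ n, IsMartDiff μ T N (R n))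
    (h4 : ∀ n, MemLp (R n) 4 μ) {B : ℝ} (hB : ∀ n, ∫ ω, R n ω ^ 4 ∂μ ≤ B) {σ2 : ℝ} (hσ : 0 ≤ σ2)
    {m : κ → ℕ} (hm : Tendsto m F atTop)
    (hdev : ∀ ε > 0, ∃ v : ℕ, v ≠ 0 ∧ ∀ᶠ n in F, sqDeviation μ T (R n) σ2 v / v ≤ ε) (t : ℝ) :
    Tendsto (fun n => ∫ ω, Complex.exp ((t / √(m n) * birkhoffSum T (R n) (m n) ω : ℝ) *
      Complex.I) ∂μ) F (𝓝 (Real.exp (-(t ^ 2 * σ2 / 2)) : ℝ)) := by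
  rw [Metric.tendsto_nhds]
  intro ε hε
  -- The block length is fixed first; only afterwards does `m n → ∞` remove `martError`.
  obtain ⟨v, hv, hvn⟩ := hdev (ε / (2 * (t ^ 2 + 1))) (by positivity)
  have h1 := (tendsto_martError t σ2 B v).comp hm
  filter_upwards [hvn, h1.eventually (gt_mem_nhds (half_pos hε)),
    hm.eventually (eventually_ne_atTop 0)] with n e1 e2 e3
  rw [dist_eq_norm]
  refine lt_of_le_of_lt ((hR n).norm_charFun_sub_le hT hN hmono (h4 n) (hB n) hσ t hv e3) ?_
  have e4 : t ^ 2 / 2 * (sqDeviation μ T (R n) σ2 v / v) ≤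
      t ^ 2 / 2 * (ε / (2 * (t ^ 2 + 1))) := by gcongr
  have e5 : t ^ 2 / 2 * (ε / (2 * (t ^ 2 + 1))) ≤ ε / 2 := by
    rw [div_mul_div_comm, div_le_div_iff₀ (by positivity) (by norm_num)]
    nlinarith [sq_nonneg t]
  simp only [Function.comp_apply] at e2
  linarith

end CLTFromDeviation

/-! ### Sums over boxes for commuting transformations. -/

section ShiftSystems

variable {ι Ω : Type*} {mΩ : MeasurableSpace Ω}

/-- Commuting measure preserving transformations `T i` with σ-fields `N i`, increasing along `T i`
and invariant along the other transformations. -/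
structure IsShiftSystem (μ : Measure Ω) (T : ι → Ω → Ω) (N : ι → MeasurableSpace Ω) : Prop where
  measurePreserving : ∀ i, MeasurePreserving (T i) μ μ
  comm : ∀ i j, Function.Commute (T i) (T j)
  le : ∀ i, N i ≤ mΩ
  mono : ∀ i, N i ≤ (N i).comap (T i)
  comap_eq : ∀ i j, i ≠ j → (N i).comap (T j) = N i

/-- The sum of `h` along a box of iterates of the transformations `T i`, `i ∈ l`. -/
def boxBirkhoffSum (T : ι → Ω → Ω) : List ι → (ι → ℕ) → (Ω → ℝ) → Ω → ℝ
  | [], _, h => h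
  | i :: l, n, h => birkhoffSum (T i) (boxBirkhoffSum T l n h) (n i)

lemma birkhoffSum_comp {T S : Ω → Ω} (hTS : Function.Commute T S) (h : Ω → ℝ) (n k : ℕ) :
    birkhoffSum T (h ∘ S^[k]) n = birkhoffSum T h n ∘ S^[k] := by
  ext ω
  simp only [birkhoffSum, Function.comp_apply]
  refine Finset.sum_congr rfl fun j _ => ?_
  rw [((hTS.iterate_left j).iterate_right k).eq]

lemma birkhoffSum_fun_sub (T : Ω → Ω) (f g : Ω → ℝ) (n : ℕ) :
    birkhoffSum T (f - g) n = birkhoffSum T f n - birkhoffSum T g n := by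
  ext ω; simp [birkhoffSum]

lemma birkhoffSum_fun_add (T : Ω → Ω) (f g : Ω → ℝ) (n : ℕ) :
    birkhoffSum T (f + g) n = birkhoffSum T f n + birkhoffSum T g n := by
  ext ω; simp [birkhoffSum, Finset.sum_add_distrib]

lemma birkhoffSum_const_mul (T : Ω → Ω) (c : ℝ) (f : Ω → ℝ) (n : ℕ) (ω : Ω) :
    birkhoffSum T (fun ω => c * f ω) n ω = c * birkhoffSum T f n ω := by
  simp [birkhoffSum, Finset.mul_sum]

lemma boxBirkhoffSum_add (T : ι → Ω → Ω) (l : List ι) (n : ι → ℕ) (f g : Ω → ℝ) :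
    boxBirkhoffSum T l n (f + g) = boxBirkhoffSum T l n f + boxBirkhoffSum T l n g := by
  induction l with
  | nil => rfl
  | cons i l ih => simp only [boxBirkhoffSum, ih, birkhoffSum_fun_add]

lemma boxBirkhoffSum_sub (T : ι → Ω → Ω) (l : List ι) (n : ι → ℕ) (f g : Ω → ℝ) :
    boxBirkhoffSum T l n (f - g) = boxBirkhoffSum T l n f - boxBirkhoffSum T l n g := by
  induction l with
  | nil => rfl
  | cons i l ih => simp only [boxBirkhoffSum, ih, birkhoffSum_fun_sub]

variable {μ : Measure Ω}

lemma IsMartDiff.add {T : Ω → Ω} {N : MeasurableSpace Ω} {f g : Ω → ℝ} (hf : IsMartDiff μ T N f)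
    (hg : IsMartDiff μ T N g) (hfi : Integrable f μ) (hgi : Integrable g μ) :
    IsMartDiff μ T N (f + g) := by
  refine ⟨hf.aesm.add hg.aesm, ?_⟩
  filter_upwards [condExp_add hfi hgi N, hf.condExp_eq_zero, hg.condExp_eq_zero] with ω e1 e2 e3
  rw [e1, Pi.add_apply, e2, e3]; simp

lemma IsMartDiff.sub {T : Ω → Ω} {N : MeasurableSpace Ω} {f g : Ω → ℝ} (hf : IsMartDiff μ T N f)
    (hg : IsMartDiff μ T N g) (hfi : Integrable f μ) (hgi : Integrable g μ) :
    IsMartDiff μ T N (f - g) := by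
  refine ⟨hf.aesm.sub hg.aesm, ?_⟩
  filter_upwards [condExp_sub hfi hgi N, hf.condExp_eq_zero, hg.condExp_eq_zero] with ω e1 e2 e3
  rw [e1, Pi.sub_apply, e2, e3]; simp

lemma IsMartDiff.const_mul {T : Ω → Ω} {N : MeasurableSpace Ω} {f : Ω → ℝ}
    (hf : IsMartDiff μ T N f) (c : ℝ) : IsMartDiff μ T N (fun ω => c * f ω) := by
  refine ⟨hf.aesm.const_mul c, ?_⟩
  filter_upwards [condExp_smul c f N (μ := μ), hf.condExp_eq_zero] with ω e1 e2
  rw [show (fun ω => c * f ω) = c • f from rfl, e1, Pi.smul_apply, e2]; simp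

namespace IsShiftSystem

variable [IsProbabilityMeasure μ] {T : ι → Ω → Ω} {N : ι → MeasurableSpace Ω} (hS : IsShiftSystem μ T N)
include hS

/-- `T j` leaves `N i` invariant and, since the transformations commute, also `(N i).comap (T i)`;
so neither measurability nor the conditional mean changes. -/
lemma isMartDiff_comp {i j : ι} (hij : i ≠ j) {h : Ω → ℝ} (hi : Integrable h μ)
    (hh : IsMartDiff μ (T i) (N i) h) : IsMartDiff μ (T i) (N i) (h ∘ T j) := by
  have hT := hS.measurePreserving j
  have e : ((N i).comap (T i)).comap (T j) = (N i).comap (T i) := by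
    rw [MeasurableSpace.comap_comp, (hS.comm i j).comp_eq, ← MeasurableSpace.comap_comp,
      hS.comap_eq i j hij]
  constructor
  · have h1 := hh.aesm.comp_comap_iterate hT 1
    rwa [Function.iterate_one, e] at h1
  · have h1 := condExp_comp_measurePreserving hT (hS.le i) hi
    rw [hS.comap_eq i j hij] at h1
    exact h1.trans (hT.quasiMeasurePreserving.ae_eq_comp hh.condExp_eq_zero)

lemma isMartDiff_comp_iterate {i j : ι} (hij : i ≠ j) {h : Ω → ℝ} (hi : Integrable h μ)
    (hh : IsMartDiff μ (T i) (N i) h) (k : ℕ) :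
    IsMartDiff μ (T i) (N i) (h ∘ (T j)^[k]) := by
  induction k with
  | zero => exact hh
  | succ k ih =>
    rw [Function.iterate_succ, ← Function.comp_assoc]
    exact hS.isMartDiff_comp hij
      (((hS.measurePreserving j).iterate k).integrable_comp_of_integrable hi) ih

lemma isMartDiff_birkhoffSum {i j : ι} (hij : i ≠ j) {h : Ω → ℝ} (hi : Integrable h μ)
    (hh : IsMartDiff μ (T i) (N i) h) (n : ℕ) :
    IsMartDiff μ (T i) (N i) (birkhoffSum (T j) h n) := by
  induction n with
  | zero =>
    rw [birkhoffSum_zero']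
    exact ⟨aestronglyMeasurable_const, by rw [condExp_zero]⟩
  | succ n ih =>
    have e : birkhoffSum (T j) h (n + 1) = birkhoffSum (T j) h n + h ∘ (T j)^[n] :=
      funext fun ω => birkhoffSum_succ _ _ _ _
    rw [e]
    exact ih.add (hS.isMartDiff_comp_iterate hij hi hh n)
      (integrable_birkhoffSum (hS.measurePreserving j) hi n)
      (((hS.measurePreserving j).iterate n).integrable_comp_of_integrable hi)

omit [IsProbabilityMeasure μ] in
lemma memLp_boxBirkhoffSum {h : Ω → ℝ} {p : ℝ≥0∞} (hh : MemLp h p μ) (l : List ι) (n : ι → ℕ) :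
    MemLp (boxBirkhoffSum T l n h) p μ := by
  induction l with
  | nil => exact hh
  | cons i l ih => exact memLp_birkhoffSum (hS.measurePreserving i) ih _

lemma isMartDiff_boxBirkhoffSum {i : ι} {l : List ι} (hi : i ∉ l) {h : Ω → ℝ}
    (hint : Integrable h μ) (hh : IsMartDiff μ (T i) (N i) h) (n : ι → ℕ) :
    IsMartDiff μ (T i) (N i) (boxBirkhoffSum T l n h) := by
  induction l with
  | nil => exact hh
  | cons j l ih =>
    rw [List.mem_cons, not_or] at hi
    exact hS.isMartDiff_birkhoffSum hi.1 (memLp_one_iff_integrable.1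
      (hS.memLp_boxBirkhoffSum (memLp_one_iff_integrable.2 hint) l n)) (ih hi.2) _

omit [IsProbabilityMeasure μ] in
lemma boxBirkhoffSum_comp (j : ι) (l : List ι) (n : ι → ℕ) (h : Ω → ℝ) (k : ℕ) :
    boxBirkhoffSum T l n (h ∘ (T j)^[k]) = boxBirkhoffSum T l n h ∘ (T j)^[k] := by
  induction l with
  | nil => rfl
  | cons i l ih =>
    simp only [boxBirkhoffSum]
    rw [ih, birkhoffSum_comp (hS.comm i j)]

/-- Iterates the bound of one direction, the inner box sum being again a martingale difference in
direction `i`. After normalisation it bounds fourth moments uniformly over boxes. -/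
lemma integral_pow_four_boxBirkhoffSum_le {l : List ι} (hl : l.Nodup) {h : Ω → ℝ}
    (h4 : MemLp h 4 μ) (hh : ∀ i ∈ l, IsMartDiff μ (T i) (N i) h) (n : ι → ℕ) :
    ∫ ω, boxBirkhoffSum T l n h ω ^ 4 ∂μ ≤
      16 ^ l.length * boxSize l n ^ 2 * ∫ ω, h ω ^ 4 ∂μ := by
  induction l with
  | nil => simp [boxBirkhoffSum]
  | cons i l ih =>
    obtain ⟨hi, hl⟩ := List.nodup_cons.1 hl
    refine ((hS.isMartDiff_boxBirkhoffSum hi (h4.integrable (by norm_num))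
      (hh i List.mem_cons_self) n).integral_pow_four_birkhoffSum_le (hS.measurePreserving i)
      (hS.le i) (hS.mono i) (hS.memLp_boxBirkhoffSum h4 l n)
      (ih hl fun j hj => hh j (List.mem_cons_of_mem _ hj)) (n i)).trans (le_of_eq ?_)
    rw [boxSize_cons, List.length_cons]; ring

end IsShiftSystem

end ShiftSystems

/-! ### Cosines in place of squares. -/

section CosineBounds

lemma abs_cos_sub_le (y : ℝ) : |Real.cos y - (1 - y ^ 2 / 2)| ≤ 3 * y ^ 4 := by
  have h4 : y ^ 4 = |y| ^ 4 := by rw [← abs_pow, abs_of_nonneg (by positivity)]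
  rcases le_or_gt |y| 1 with hy | hy
  · have h1 := Real.cos_bound hy
    rw [h4]
    have : 0 ≤ |y| ^ 4 := by positivity
    linarith
  · have h1 := Real.neg_one_le_cos y
    have h2 := Real.cos_le_one y
    have h5 : (1 : ℝ) ≤ |y| ^ 2 := by nlinarith
    have h3 : |y| ^ 2 ≤ |y| ^ 4 := by nlinarith
    rw [h4, ← sq_abs y, abs_le]
    constructor <;> nlinarith

variable {Ω : Type*} {mΩ : MeasurableSpace Ω} {μ : Measure Ω} [IsProbabilityMeasure μ]

lemma integrable_cos {R : Ω → ℝ} (hR : AEStronglyMeasurable R μ) (c : ℝ) :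
    Integrable (fun ω => Real.cos (c * R ω)) μ :=
  (integrable_const (1 : ℝ)).mono' ((by fun_prop : Continuous fun x : ℝ =>
    Real.cos (c * x)).comp_aestronglyMeasurable hR)
    (Eventually.of_forall fun ω => Real.abs_cos_le_one _)

lemma tendsto_integral_cos {κ : Type*} {F : Filter κ} {R : κ → Ω → ℝ}
    (hR : ∀ n, AEStronglyMeasurable (R n) μ) {c : ℝ} {z : ℝ}
    (h : Tendsto (fun n => ∫ ω, Complex.exp ((c * R n ω : ℝ) * Complex.I) ∂μ) F (𝓝 (z : ℂ))) :
    Tendsto (fun n => ∫ ω, Real.cos (c * R n ω) ∂μ) F (𝓝 z) := by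
  have h1 := (Complex.continuous_re.tendsto _).comp h
  rw [Complex.ofReal_re] at h1
  refine h1.congr fun n => ?_
  have h2 := integral_re (𝕜 := ℂ) (integrable_exp_I (hR n) c)
  simp only [RCLike.re_eq_complex_re] at h2
  rw [Function.comp_apply, ← h2]
  refine integral_congr_ae (Eventually.of_forall fun ω => ?_)
  simp only
  rw [Complex.exp_ofReal_mul_I_re]

end CosineBounds

/-! ### A law of large numbers for squares from decorrelated cosines. -/

section Deviation

variable {Ω : Type*} {mΩ : MeasurableSpace Ω} {μ : Measure Ω} [IsProbabilityMeasure μ]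
  {T : Ω → Ω}

/-- The second moment of a sum of centered cosines. -/
lemma integral_sq_sum_cos_eq (hT : MeasurePreserving T μ μ) {R : Ω → ℝ}
    (hR : AEStronglyMeasurable R μ) (c : ℝ) (v : ℕ) :
    ∫ ω, (∑ k ∈ Finset.range v, (Real.cos (c * R (T^[k] ω)) - ∫ ω, Real.cos (c * R ω) ∂μ)) ^ 2 ∂μ =
      ∑ a ∈ Finset.range v, ∑ b ∈ Finset.range v,
        (∫ ω, Real.cos (c * R (T^[a] ω)) * Real.cos (c * R (T^[b] ω)) ∂μ -
          (∫ ω, Real.cos (c * R ω) ∂μ) ^ 2) := by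
  set m := ∫ ω, Real.cos (c * R ω) ∂μ with hm
  have hRk : ∀ k, AEStronglyMeasurable (fun ω => R (T^[k] ω)) μ := fun k =>
    hR.comp_measurePreserving (hT.iterate k)
  have hi : ∀ k, Integrable (fun ω => Real.cos (c * R (T^[k] ω))) μ := fun k =>
    integrable_cos (hRk k) c
  have hmk : ∀ k, ∫ ω, Real.cos (c * R (T^[k] ω)) ∂μ = m := fun k =>
    integral_comp_iterate hT (h := fun ω => Real.cos (c * R ω)) (integrable_cos hR c).1 k
  have hii : ∀ a b, Integrable (fun ω => Real.cos (c * R (T^[a] ω)) * Real.cos (c * R (T^[b] ω)))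
      μ := fun a b => (hi b).bdd_mul (c := 1) (hi a).1
        (Eventually.of_forall fun ω => Real.abs_cos_le_one _)
  have hprod : ∀ a b, Integrable (fun ω => (Real.cos (c * R (T^[a] ω)) - m) *
      (Real.cos (c * R (T^[b] ω)) - m)) μ ∧
      ∫ ω, (Real.cos (c * R (T^[a] ω)) - m) * (Real.cos (c * R (T^[b] ω)) - m) ∂μ =
      ∫ ω, Real.cos (c * R (T^[a] ω)) * Real.cos (c * R (T^[b] ω)) ∂μ - m ^ 2 := by
    intro a b
    have e : ∀ ω, (Real.cos (c * R (T^[a] ω)) - m) * (Real.cos (c * R (T^[b] ω)) - m) =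
        (Real.cos (c * R (T^[a] ω)) * Real.cos (c * R (T^[b] ω)) - m * Real.cos (c * R (T^[a] ω))) -
          (m * Real.cos (c * R (T^[b] ω)) - m ^ 2) := fun ω => by ring
    have j1 : Integrable (fun ω => Real.cos (c * R (T^[a] ω)) * Real.cos (c * R (T^[b] ω)) -
      m * Real.cos (c * R (T^[a] ω))) μ := (hii a b).sub ((hi a).const_mul m)
    have j2 : Integrable (fun ω => m * Real.cos (c * R (T^[b] ω)) - m ^ 2) μ :=
      ((hi b).const_mul m).sub (integrable_const _)
    simp only [e]
    refine ⟨j1.sub j2, ?_⟩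
    rw [integral_sub j1 j2, integral_sub (hii a b) ((hi a).const_mul m),
      integral_sub ((hi b).const_mul m) (integrable_const _), integral_const_mul,
      integral_const_mul, hmk, hmk]
    simp
    ring
  simp only [sq (∑ k ∈ Finset.range v, _), Finset.sum_mul_sum]
  rw [integral_finsetSum _ fun a _ => integrable_finsetSum _ fun b _ => (hprod a b).1]
  refine Finset.sum_congr rfl fun a _ => ?_
  rw [integral_finsetSum _ fun b _ => (hprod a b).1]
  exact Finset.sum_congr rfl fun b _ => (hprod a b).2

/-- The deviation of the averages of the squares, by replacing `x²` with
`(2 / c²) (1 - cos (c x))`. -/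
lemma sqDeviation_le (hT : MeasurePreserving T μ μ) {R : Ω → ℝ} (h4 : MemLp R 4 μ) {B : ℝ}
    (hB : ∫ ω, R ω ^ 4 ∂μ ≤ B) (σ2 : ℝ) {c θ : ℝ} (hc : 0 < c) (hθ : 0 < θ) {v : ℕ} (hv : v ≠ 0) :
    sqDeviation μ T R σ2 v / v ≤ 6 * c ^ 2 * B +
      2 / c ^ 2 * (θ / 2 + 1 / (2 * θ) * ((∑ a ∈ Finset.range v, ∑ b ∈ Finset.range v,
        (∫ ω, Real.cos (c * R (T^[a] ω)) * Real.cos (c * R (T^[b] ω)) ∂μ -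
          (∫ ω, Real.cos (c * R ω) ∂μ) ^ 2)) / v ^ 2)) +
      |2 / c ^ 2 * (1 - ∫ ω, Real.cos (c * R ω) ∂μ) - σ2| := by
  have hv' : (0 : ℝ) < v := by positivity
  set m := ∫ ω, Real.cos (c * R ω) ∂μ with hm
  rw [← integral_sq_sum_cos_eq hT h4.1 c v, ← hm]
  set D : Ω → ℝ := fun ω => ∑ k ∈ Finset.range v, (Real.cos (c * R (T^[k] ω)) - m) with hD
  have hRk : ∀ k, MemLp (fun ω => R (T^[k] ω)) 4 μ := fun k =>
    h4.comp_measurePreserving (hT.iterate k)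
  have hi : ∀ k, Integrable (fun ω => Real.cos (c * R (T^[k] ω)) - m) μ := fun k =>
    (integrable_cos (hRk k).1 c).sub (integrable_const _)
  have hDi : Integrable D μ := integrable_finsetSum _ fun k _ => hi k
  have hDb : ∀ ω, |D ω| ≤ v * (1 + |m|) := fun ω => by
    refine (Finset.abs_sum_le_sum_abs _ _).trans ?_
    refine (Finset.sum_le_card_nsmul _ _ (1 + |m|) fun k _ => ?_).trans
      (le_of_eq (by simp; ring))
    exact (abs_sub _ _).trans (add_le_add (Real.abs_cos_le_one _) le_rfl)
  have hD2 : Integrable (fun ω => D ω ^ 2) μ := by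
    have : MemLp D 2 μ := MemLp.of_bound hDi.1 _ (Eventually.of_forall hDb)
    exact this.integrable_sq
  have hR4 : ∀ k, Integrable (fun ω => R (T^[k] ω) ^ 4) μ := fun k => integrable_pow_four (hRk k)
  have hR4s : Integrable (fun ω => ∑ k ∈ Finset.range v, R (T^[k] ω) ^ 4) μ :=
    integrable_finsetSum _ fun k _ => hR4 k
  set b : ℝ := |2 / c ^ 2 * (1 - m) - σ2| with hb
  have hpt : ∀ ω, |birkhoffSum T (fun ω => R ω ^ 2) v ω - v * σ2| ≤
      6 * c ^ 2 * ∑ k ∈ Finset.range v, R (T^[k] ω) ^ 4 +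
        2 / c ^ 2 * (v * θ / 2 + 1 / (2 * θ * v) * D ω ^ 2) + v * b := by
    intro ω
    -- Three sources of error: the Taylor error of the cosine, at most `6 c² R⁴` per term, the
    -- fluctuation `D` of the cosines, and the bias of their mean.
    have e : birkhoffSum T (fun ω => R ω ^ 2) v ω - v * σ2 =
        ∑ k ∈ Finset.range v, (2 / c ^ 2 * (Real.cos (c * R (T^[k] ω)) -
          (1 - (c * R (T^[k] ω)) ^ 2 / 2))) - 2 / c ^ 2 * D ω + v * (2 / c ^ 2 * (1 - m) - σ2) := by
      simp only [birkhoffSum, hD, Finset.mul_sum]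
      rw [← Finset.sum_sub_distrib]
      have : (v : ℝ) * (2 / c ^ 2 * (1 - m) - σ2) =
          ∑ k ∈ Finset.range v, (2 / c ^ 2 * (1 - m) - σ2) := by simp; ring
      have h' : (v : ℝ) * σ2 = ∑ k ∈ Finset.range v, σ2 := by simp
      rw [this, h', ← Finset.sum_sub_distrib, ← Finset.sum_add_distrib]
      refine Finset.sum_congr rfl fun k _ => ?_
      field_simp
      ring
    rw [e]
    refine (abs_add_le _ _).trans (add_le_add ((abs_sub _ _).trans (add_le_add ?_ ?_)) ?_)
    · rw [Finset.mul_sum]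
      refine (Finset.abs_sum_le_sum_abs _ _).trans (Finset.sum_le_sum fun k _ => ?_)
      rw [abs_mul, abs_of_pos (by positivity : 0 < 2 / c ^ 2)]
      refine (mul_le_mul_of_nonneg_left (abs_cos_sub_le _) (by positivity)).trans (le_of_eq ?_)
      field_simp
      ring
    · rw [abs_mul, abs_of_pos (by positivity : 0 < 2 / c ^ 2)]
      gcongr
      -- Young's inequality with parameter `θ` trades `|D|` for `D²`, whose integral is a sum of
      -- covariances.
      have h1 : 0 ≤ 1 / (2 * θ * v) * (|D ω| - v * θ) ^ 2 := by positivity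
      have h2 : 1 / (2 * θ * v) * (|D ω| - v * θ) ^ 2 =
          1 / (2 * θ * v) * D ω ^ 2 + v * θ / 2 - |D ω| := by
        rw [sub_sq, sq_abs]; field_simp; ring
      linarith
    · rw [abs_mul, abs_of_pos hv']
  have hsum4 : ∫ ω, ∑ k ∈ Finset.range v, R (T^[k] ω) ^ 4 ∂μ ≤ v * B := by
    rw [integral_finsetSum _ fun k _ => hR4 k]
    refine (Finset.sum_le_card_nsmul _ _ B fun k _ => ?_).trans (le_of_eq (by simp))
    rwa [integral_comp_iterate hT (h := fun ω => R ω ^ 4) (integrable_pow_four h4).1]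
  have j1 : Integrable (fun ω => 6 * c ^ 2 * ∑ k ∈ Finset.range v, R (T^[k] ω) ^ 4) μ :=
    hR4s.const_mul _
  have j2 : Integrable (fun ω => 1 / (2 * θ * v) * D ω ^ 2) μ := hD2.const_mul _
  have j3 : Integrable (fun ω => v * θ / 2 + 1 / (2 * θ * v) * D ω ^ 2) μ :=
    (integrable_const _).add j2
  have j4 : Integrable (fun ω => 2 / c ^ 2 * (v * θ / 2 + 1 / (2 * θ * v) * D ω ^ 2)) μ :=
    j3.const_mul _
  have j5 : Integrable (fun ω => 6 * c ^ 2 * ∑ k ∈ Finset.range v, R (T^[k] ω) ^ 4 +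
        2 / c ^ 2 * (v * θ / 2 + 1 / (2 * θ * v) * D ω ^ 2)) μ := j1.add j4
  have hmain : sqDeviation μ T R σ2 v ≤ 6 * c ^ 2 * (v * B) +
      2 / c ^ 2 * (v * θ / 2 + 1 / (2 * θ * v) * ∫ ω, D ω ^ 2 ∂μ) + v * b := by
    refine (integral_mono_of_nonneg (Eventually.of_forall fun ω => abs_nonneg _)
      (j5.add (integrable_const (v * b))) (Eventually.of_forall hpt)).trans ?_
    simp only [Pi.add_apply]
    rw [integral_add j5 (integrable_const _), integral_add j1 j4, integral_const_mul,
      integral_const_mul, integral_add (integrable_const _) j2, integral_const_mul]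
    simp only [integral_const, probReal_univ, one_smul]
    gcongr
  rw [div_le_iff₀ hv']
  refine hmain.trans (le_of_eq ?_)
  change _ = (6 * c ^ 2 * B + 2 / c ^ 2 * (θ / 2 + 1 / (2 * θ) * ((∫ ω, D ω ^ 2 ∂μ) / v ^ 2)) + b) * v
  generalize ∫ ω, D ω ^ 2 ∂μ = I
  field_simp

/-- The squares of a family of stationary sequences with asymptotically uncorrelated cosines
satisfy a law of large numbers on long blocks. -/
lemma exists_sqDeviation_le {κ : Type*} {F : Filter κ} (hT : MeasurePreserving T μ μ)
    {R : κ → Ω → ℝ} (h4 : ∀ n, MemLp (R n) 4 μ) {B : ℝ} (hB : ∀ n, ∫ ω, R n ω ^ 4 ∂μ ≤ B)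
    {σ2 : ℝ} (hσ : 0 ≤ σ2)
    (hone : ∀ c : ℝ, Tendsto (fun n => ∫ ω, Real.cos (c * R n ω) ∂μ) F
      (𝓝 (Real.exp (-(c ^ 2 * σ2 / 2)))))
    (htwo : ∀ c : ℝ, ∀ a b : ℕ, a ≠ b → Tendsto (fun n =>
      ∫ ω, Real.cos (c * R n (T^[a] ω)) * Real.cos (c * R n (T^[b] ω)) ∂μ) F
      (𝓝 (Real.exp (-(c ^ 2 * σ2 / 2)) ^ 2))) {ε : ℝ} (hε : 0 < ε) :
    ∃ v : ℕ, v ≠ 0 ∧ ∀ᶠ n in F, sqDeviation μ T (R n) σ2 v / v ≤ ε := by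
  rcases F.eq_or_neBot with rfl | hF
  · exact ⟨1, one_ne_zero, by simp⟩
  obtain ⟨n₀⟩ : Nonempty κ := nonempty_of_neBot F
  have hB0 : 0 ≤ B := le_trans (integral_nonneg fun ω => by positivity) (hB n₀)
  -- The error is split into four quarters of `ε`. A small `c` absorbs the fourth moment and the
  -- bias of `(2/c²)(1 - exp (-c² σ2 / 2))`; then `θ` depends on `c`; then `v` is large enough for
  -- the covariances; the last quarter is the convergence of the mean cosine.
  set K : ℝ := 6 * B + σ2 ^ 2 / 4 + 1 with hK
  have hK0 : 0 < K := by positivity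
  set c : ℝ := √(ε / (4 * K)) with hc
  have hc0 : 0 < c := Real.sqrt_pos.2 (by positivity)
  have hc2 : c ^ 2 * K = ε / 4 := by
    rw [hc, Real.sq_sqrt (by positivity)]; field_simp
  set θ : ℝ := c ^ 2 * ε / 4 with hθ
  have hθ0 : 0 < θ := by positivity
  obtain ⟨v, hv⟩ := exists_nat_gt (8 / (c ^ 2 * θ * ε))
  have hv0 : (0 : ℝ) < v := lt_trans (by positivity) hv
  have hvne : v ≠ 0 := by rintro rfl; simp at hv0
  refine ⟨v, hvne, ?_⟩
  have hcov : ∀ a b, a ≠ b → ∀ᶠ n in F,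
      ∫ ω, Real.cos (c * R n (T^[a] ω)) * Real.cos (c * R n (T^[b] ω)) ∂μ -
        (∫ ω, Real.cos (c * R n ω) ∂μ) ^ 2 ≤ 1 / v := fun a b hab => by
    have h1 := (htwo c a b hab).sub ((hone c).pow 2)
    rw [sub_self] at h1
    filter_upwards [h1.eventually (gt_mem_nhds (by positivity : (0 : ℝ) < 1 / v))] with n hn
    exact hn.le
  have hcov' : ∀ᶠ n in F, ∀ a ∈ Finset.range v, ∀ b ∈ Finset.range v, a ≠ b →
      ∫ ω, Real.cos (c * R n (T^[a] ω)) * Real.cos (c * R n (T^[b] ω)) ∂μ -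
        (∫ ω, Real.cos (c * R n ω) ∂μ) ^ 2 ≤ 1 / v := by
    rw [Filter.eventually_all_finset]
    intro a _
    rw [Filter.eventually_all_finset]
    intro b _
    by_cases hab : a = b
    · exact Eventually.of_forall fun n h => absurd hab h
    · filter_upwards [hcov a b hab] with n hn _ using hn
  have hmean : ∀ᶠ n in F, |2 / c ^ 2 * (1 - ∫ ω, Real.cos (c * R n ω) ∂μ) - σ2| ≤
      c ^ 2 * σ2 ^ 2 / 4 + ε / 4 := by
    have h1 := ((((hone c).const_sub 1).const_mul (2 / c ^ 2)).sub_const σ2).abs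
    have h2 : |2 / c ^ 2 * (1 - Real.exp (-(c ^ 2 * σ2 / 2))) - σ2| ≤ c ^ 2 * σ2 ^ 2 / 4 := by
      have h3 := abs_exp_neg_sub_le (s := c ^ 2 * σ2 / 2) (by positivity)
      have e : 2 / c ^ 2 * (1 - Real.exp (-(c ^ 2 * σ2 / 2))) - σ2 =
          -(2 / c ^ 2) * (Real.exp (-(c ^ 2 * σ2 / 2)) - (1 - c ^ 2 * σ2 / 2)) := by
        field_simp; ring
      rw [e, abs_mul, abs_neg, abs_of_pos (by positivity : 0 < 2 / c ^ 2)]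
      refine (mul_le_mul_of_nonneg_left h3 (by positivity)).trans (le_of_eq ?_)
      field_simp
      norm_num
      ring
    filter_upwards [h1.eventually (gt_mem_nhds (show _ < c ^ 2 * σ2 ^ 2 / 4 + ε / 4 by linarith))]
      with n hn
    exact hn.le
  filter_upwards [hcov', hmean] with n e1 e2
  refine (sqDeviation_le hT (h4 n) (hB n) σ2 hc0 hθ0 hvne).trans ?_
  have hdiag : ∀ a, ∫ ω, Real.cos (c * R n (T^[a] ω)) * Real.cos (c * R n (T^[a] ω)) ∂μ -
      (∫ ω, Real.cos (c * R n ω) ∂μ) ^ 2 ≤ 1 := fun a => by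
    have h1 : ∫ ω, Real.cos (c * R n (T^[a] ω)) * Real.cos (c * R n (T^[a] ω)) ∂μ ≤
        ∫ _, (1 : ℝ) ∂μ := by
      refine integral_mono_of_nonneg (Eventually.of_forall fun ω => mul_self_nonneg _)
        (integrable_const _) (Eventually.of_forall fun ω => ?_)
      have := Real.abs_cos_le_one (c * R n (T^[a] ω))
      simp only
      rw [← sq, ← sq_abs]
      nlinarith [abs_nonneg (Real.cos (c * R n (T^[a] ω)))]
    have h2 : ∫ _, (1 : ℝ) ∂μ = 1 := by simp
    have h3 := sq_nonneg (∫ ω, Real.cos (c * R n ω) ∂μ)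
    linarith
  -- In each row the diagonal term is at most `1` and the others at most `1 / v`, so each row
  -- contributes at most `2`.
  have hsum : (∑ a ∈ Finset.range v, ∑ b ∈ Finset.range v,
      (∫ ω, Real.cos (c * R n (T^[a] ω)) * Real.cos (c * R n (T^[b] ω)) ∂μ -
        (∫ ω, Real.cos (c * R n ω) ∂μ) ^ 2)) / v ^ 2 ≤ 2 / v := by
    have h1 : ∀ a ∈ Finset.range v, ∑ b ∈ Finset.range v,
        (∫ ω, Real.cos (c * R n (T^[a] ω)) * Real.cos (c * R n (T^[b] ω)) ∂μ -
        (∫ ω, Real.cos (c * R n ω) ∂μ) ^ 2) ≤ 2 := by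
      intro a ha
      calc _ ≤ ∑ b ∈ Finset.range v, ((if a = b then (1 : ℝ) else 0) + 1 / v) := by
            refine Finset.sum_le_sum fun b hb => ?_
            by_cases hab : a = b
            · subst hab
              rw [if_pos rfl]
              have : (0 : ℝ) ≤ 1 / v := by positivity
              linarith [hdiag a]
            · rw [if_neg hab, zero_add]
              exact e1 a ha b hb hab
        _ = 2 := by
            rw [Finset.sum_add_distrib, Finset.sum_ite_eq, if_pos ha]
            simp [hvne]
            norm_num
    have h2 := Finset.sum_le_card_nsmul _ _ _ h1
    simp only [Finset.card_range, nsmul_eq_mul] at h2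
    rw [div_le_div_iff₀ (by positivity) hv0]
    nlinarith
  have f1 : 2 / c ^ 2 * (θ / 2) = ε / 4 := by rw [hθ]; field_simp
  have f2 : 2 / c ^ 2 * (1 / (2 * θ) * (2 / v)) ≤ ε / 4 := by
    rw [div_lt_iff₀ (by positivity)] at hv
    have e : 2 / c ^ 2 * (1 / (2 * θ) * (2 / v)) = 2 / (c ^ 2 * θ * v) := by field_simp
    rw [e, div_le_iff₀ (by positivity)]
    nlinarith
  have f3 : 2 / c ^ 2 * (1 / (2 * θ) * ((∑ a ∈ Finset.range v, ∑ b ∈ Finset.range v,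
      (∫ ω, Real.cos (c * R n (T^[a] ω)) * Real.cos (c * R n (T^[b] ω)) ∂μ -
        (∫ ω, Real.cos (c * R n ω) ∂μ) ^ 2)) / v ^ 2)) ≤ ε / 4 := by
    refine le_trans ?_ f2
    gcongr
  have f4 : 6 * c ^ 2 * B + c ^ 2 * σ2 ^ 2 / 4 ≤ ε / 4 := by
    rw [← hc2, hK]; nlinarith [sq_nonneg c]
  rw [mul_add]
  linarith

end Deviation

/-! ### Induction on the number of directions. -/

section OrthomartingaleCLT

lemma IsMartDiff.integral_mul_iterate {Ω : Type*} {N mΩ : MeasurableSpace Ω} {μ : Measure Ω}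
    [IsProbabilityMeasure μ] {T : Ω → Ω}
     (hT : MeasurePreserving T μ μ) (hN : N ≤ mΩ) (hmono : N ≤ N.comap T) {h : Ω → ℝ}
    (hh : IsMartDiff μ T N h) (h2 : MemLp h 2 μ) {a b : ℕ} (hab : a < b) :
    ∫ ω, h (T^[b] ω) * h (T^[a] ω) ∂μ = 0 := by
  have h1 := hh.aesm.comp_comap_iterate hT a
  rw [MeasurableSpace.comap_comp, ← Function.iterate_succ' T a] at h1
  exact hh.integral_smul_eq_zero hT hN (h2.integrable (by norm_num)) (k := b)
    (Φ := fun ω => h (T^[a] ω)) (h1.mono (comap_iterate_mono hmono hab))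
    ((h2.comp_measurePreserving (hT.iterate b)).integrable_mul
      (h2.comp_measurePreserving (hT.iterate a)))


variable {ι Ω : Type*} {mΩ : MeasurableSpace Ω} {μ : Measure Ω} [IsProbabilityMeasure μ]
  {T : ι → Ω → Ω} {N : ι → MeasurableSpace Ω}

lemma tendsto_coord_atTop (i : ι) : Tendsto (fun n : ι → ℕ => n i) atTop atTop :=
  tendsto_atTop_atTop.2 fun b => ⟨fun _ => b, fun _ hn => hn i⟩

/-- The central limit theorem for orthomartingale differences with finite fourth moments: the
first transformation to be summed over is ergodic. -/
theorem IsShiftSystem.tendsto_charFun (hS : IsShiftSystem μ T N) {i₀ : ι}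
    (herg : Ergodic (T i₀) μ) {l : List ι} (hl : (l ++ [i₀]).Nodup) {h : Ω → ℝ}
    (h4 : MemLp h 4 μ) (hh : ∀ i ∈ l ++ [i₀], IsMartDiff μ (T i) (N i) h) (t : ℝ) :
    Tendsto (fun n : ι → ℕ => ∫ ω, Complex.exp ((t / √(boxSize (l ++ [i₀]) n) *
      boxBirkhoffSum T (l ++ [i₀]) n h ω : ℝ) * Complex.I) ∂μ) atTop
      (𝓝 (Real.exp (-(t ^ 2 * (∫ ω, h ω ^ 2 ∂μ) / 2)) : ℝ)) := by
  induction l generalizing h t with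
  | nil =>
    -- Only here is ergodicity used: the squares obey the mean ergodic theorem, which the fourth
    -- moment of `h` makes available in `L²`.
    have h2 : MemLp (fun ω => h ω ^ 2) 2 μ := by
      have hi : Integrable (fun ω => (h ω ^ 2) ^ 2) μ :=
        (integrable_pow_four h4).congr (Eventually.of_forall fun ω => by ring)
      exact (memLp_two_iff_integrable_sq (h4.1.pow 2)).2 hi
    have h1 := tendsto_charFun_of_sqDeviation (F := atTop) (hS.measurePreserving i₀) (hS.le i₀)
      (hS.mono i₀) (R := fun _ : ι → ℕ => h) (fun _ => hh i₀ (by simp)) (fun _ => h4)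
      (fun _ => le_rfl) (σ2 := ∫ ω, h ω ^ 2 ∂μ) (integral_nonneg fun ω => by positivity)
      (tendsto_coord_atTop i₀) (fun ε hε => ?_) t
    · simpa [boxSize, boxBirkhoffSum] using h1
    · obtain ⟨v, hv, hv'⟩ := ((tendsto_integral_abs_birkhoff herg h2).eventually
        (gt_mem_nhds hε)).and (eventually_ne_atTop 0) |>.exists
      exact ⟨v, hv', Eventually.of_forall fun _ => hv.le⟩
  | cons j l ih =>
    rw [List.cons_append] at hl hh ⊢
    obtain ⟨hj, hl⟩ := List.nodup_cons.1 hl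
    set l' := l ++ [i₀] with hl'
    have hTj := hS.measurePreserving j
    have hmj : IsMartDiff μ (T j) (N j) h := hh j List.mem_cons_self
    have hml : ∀ i ∈ l', IsMartDiff μ (T i) (N i) h := fun i hi =>
      hh i (List.mem_cons_of_mem _ hi)
    have hne : ∀ i ∈ l', i ≠ j := fun i hi hij => hj (hij ▸ hi)
    have h1 : Integrable h μ := h4.integrable (by norm_num)
    have h2 : MemLp h 2 μ := memLp_two_of_four h4
    set σ2 := ∫ ω, h ω ^ 2 ∂μ with hσ2
    -- The normalised sums over the remaining directions. Along `T j` they form, for each `n`, a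
    -- stationary sequence of martingale differences.
    set R : (ι → ℕ) → Ω → ℝ := fun n ω => 1 / √(boxSize l' n) * boxBirkhoffSum T l' n h ω with hR
    have hR4 : ∀ n, MemLp (R n) 4 μ := fun n => (hS.memLp_boxBirkhoffSum h4 l' n).const_mul _
    have hRm : ∀ n, IsMartDiff μ (T j) (N j) (R n) := fun n =>
      (hS.isMartDiff_boxBirkhoffSum hj h1 hmj n).const_mul _
    have hRB : ∀ n, ∫ ω, R n ω ^ 4 ∂μ ≤ 16 ^ l'.length * ∫ ω, h ω ^ 4 ∂μ := by
      intro n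
      have e : ∀ ω, R n ω ^ 4 = (1 / √(boxSize l' n)) ^ 4 * boxBirkhoffSum T l' n h ω ^ 4 :=
        fun ω => mul_pow _ _ _
      simp only [e]
      rw [integral_const_mul]
      have h0 : 0 ≤ ∫ ω, h ω ^ 4 ∂μ := integral_nonneg fun ω => by positivity
      refine (mul_le_mul_of_nonneg_left (hS.integral_pow_four_boxBirkhoffSum_le hl h4 hml n)
        (by positivity)).trans ?_
      have hs : (1 / √(boxSize l' n)) ^ 4 * boxSize l' n ^ 2 ≤ 1 := by
        have e4 : √(boxSize l' n) ^ 4 = boxSize l' n ^ 2 := by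
          rw [show 4 = 2 * 2 from rfl, pow_mul, Real.sq_sqrt (boxSize_nonneg l' n)]
        rw [div_pow, one_pow, e4, one_div]
        exact inv_mul_le_one
      have := mul_le_mul_of_nonneg_right hs (by positivity : 0 ≤ 16 ^ l'.length * ∫ ω, h ω ^ 4 ∂μ)
      linarith
    -- linear combinations of two translates
    have hcomp4 : ∀ k, MemLp (h ∘ (T j)^[k]) 4 μ := fun k =>
      h4.comp_measurePreserving (hTj.iterate k)
    have hcompm : ∀ k, ∀ i ∈ l', IsMartDiff μ (T i) (N i) (h ∘ (T j)^[k]) := fun k i hi =>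
      hS.isMartDiff_comp_iterate (hne i hi) h1 (hml i hi) k
    have hcomp1 : ∀ k, Integrable (h ∘ (T j)^[k]) μ := fun k => (hcomp4 k).integrable (by norm_num)
    have hsq : ∀ k, ∫ ω, h ((T j)^[k] ω) ^ 2 ∂μ = σ2 := fun k =>
      integral_comp_iterate hTj (h := fun ω => h ω ^ 2) h2.integrable_sq.1 k
    have hisq : ∀ k, Integrable (fun ω => h ((T j)^[k] ω) ^ 2) μ := fun k =>
      (memLp_two_of_four (hcomp4 k)).integrable_sq
    have hmul : ∀ a b, Integrable (fun ω => h ((T j)^[a] ω) * h ((T j)^[b] ω)) μ := fun a b =>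
      (memLp_two_of_four (hcomp4 a)).integrable_mul (memLp_two_of_four (hcomp4 b))
    have hcross : ∀ a b, a ≠ b → ∫ ω, h ((T j)^[a] ω) * h ((T j)^[b] ω) ∂μ = 0 := by
      intro a b hab
      rcases lt_or_gt_of_ne hab with hlt | hgt
      · rw [← hmj.integral_mul_iterate hTj (hS.le j) (hS.mono j) h2 hlt]
        simp only [mul_comm]
      · exact hmj.integral_mul_iterate hTj (hS.le j) (hS.mono j) h2 hgt
    have hplus : ∀ a b, a ≠ b → ∫ ω, (h ∘ (T j)^[a] + h ∘ (T j)^[b]) ω ^ 2 ∂μ = 2 * σ2 := by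
      intro a b hab
      have e : ∀ ω, (h ∘ (T j)^[a] + h ∘ (T j)^[b]) ω ^ 2 = h ((T j)^[a] ω) ^ 2 +
          (h ((T j)^[b] ω) ^ 2 + 2 * (h ((T j)^[a] ω) * h ((T j)^[b] ω))) := fun ω => by
        simp only [Pi.add_apply, Function.comp_apply]; ring
      have j1 : Integrable (fun ω => h ((T j)^[b] ω) ^ 2 +
          2 * (h ((T j)^[a] ω) * h ((T j)^[b] ω))) μ := (hisq b).add ((hmul a b).const_mul 2)
      simp only [e]
      rw [integral_add (hisq a) j1, integral_add (hisq b) ((hmul a b).const_mul 2),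
        integral_const_mul, hcross a b hab, hsq, hsq]
      ring
    have hminus : ∀ a b, a ≠ b → ∫ ω, (h ∘ (T j)^[a] - h ∘ (T j)^[b]) ω ^ 2 ∂μ = 2 * σ2 := by
      intro a b hab
      have e : ∀ ω, (h ∘ (T j)^[a] - h ∘ (T j)^[b]) ω ^ 2 = h ((T j)^[a] ω) ^ 2 +
          (h ((T j)^[b] ω) ^ 2 - 2 * (h ((T j)^[a] ω) * h ((T j)^[b] ω))) := fun ω => by
        simp only [Pi.sub_apply, Function.comp_apply]; ring
      have j1 : Integrable (fun ω => h ((T j)^[b] ω) ^ 2 -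
          2 * (h ((T j)^[a] ω) * h ((T j)^[b] ω))) μ := (hisq b).sub ((hmul a b).const_mul 2)
      simp only [e]
      rw [integral_add (hisq a) j1, integral_sub (hisq b) ((hmul a b).const_mul 2),
        integral_const_mul, hcross a b hab, hsq, hsq]
      ring
    have hone : ∀ c : ℝ, Tendsto (fun n => ∫ ω, Real.cos (c * R n ω) ∂μ) atTop
        (𝓝 (Real.exp (-(c ^ 2 * σ2 / 2)))) := fun c => by
      refine tendsto_integral_cos (fun n => (hR4 n).1) ?_
      refine (ih hl h4 hml c).congr fun n => ?_
      refine integral_congr_ae (Eventually.of_forall fun ω => ?_)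
      simp only [hR]
      congr 3
      ring
    -- The sum and the difference of two translates of `h` are martingale differences in the
    -- remaining directions, with second moment `2 σ2` by orthogonality in direction `j`. The
    -- induction hypothesis applies to both, and `cos x cos y = (cos (x + y) + cos (x - y)) / 2`
    -- makes the limit factorise.
    have htwo : ∀ c : ℝ, ∀ a b : ℕ, a ≠ b → Tendsto (fun n =>
        ∫ ω, Real.cos (c * R n ((T j)^[a] ω)) * Real.cos (c * R n ((T j)^[b] ω)) ∂μ) atTop
        (𝓝 (Real.exp (-(c ^ 2 * σ2 / 2)) ^ 2)) := by
      intro c a b hab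
      have hRk : ∀ n k, AEStronglyMeasurable (fun ω => R n ((T j)^[k] ω)) μ := fun n k =>
        (hR4 n).1.comp_measurePreserving (hTj.iterate k)
      have p1 := ih hl ((hcomp4 a).add (hcomp4 b)) (fun i hi =>
        (hcompm a i hi).add (hcompm b i hi) (hcomp1 a) (hcomp1 b)) c
      have p2 := ih hl ((hcomp4 a).sub (hcomp4 b)) (fun i hi =>
        (hcompm a i hi).sub (hcompm b i hi) (hcomp1 a) (hcomp1 b)) c
      rw [hplus a b hab] at p1
      rw [hminus a b hab] at p2
      have q1 : Tendsto (fun n => ∫ ω, Real.cos (c * (R n ((T j)^[a] ω) + R n ((T j)^[b] ω))) ∂μ)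
          atTop (𝓝 (Real.exp (-(c ^ 2 * (2 * σ2) / 2)))) := by
        refine tendsto_integral_cos (fun n => (hRk n a).add (hRk n b)) (p1.congr fun n => ?_)
        refine integral_congr_ae (Eventually.of_forall fun ω => ?_)
        simp only [hR, boxBirkhoffSum_add, hS.boxBirkhoffSum_comp, Pi.add_apply,
          Function.comp_apply]
        congr 3
        ring
      have q2 : Tendsto (fun n => ∫ ω, Real.cos (c * (R n ((T j)^[a] ω) - R n ((T j)^[b] ω))) ∂μ)
          atTop (𝓝 (Real.exp (-(c ^ 2 * (2 * σ2) / 2)))) := by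
        refine tendsto_integral_cos (fun n => (hRk n a).sub (hRk n b)) (p2.congr fun n => ?_)
        refine integral_congr_ae (Eventually.of_forall fun ω => ?_)
        simp only [hR, boxBirkhoffSum_sub, hS.boxBirkhoffSum_comp, Pi.sub_apply,
          Function.comp_apply]
        congr 3
        ring
      have elim : Real.exp (-(c ^ 2 * σ2 / 2)) ^ 2 =
          1 / 2 * (Real.exp (-(c ^ 2 * (2 * σ2) / 2)) + Real.exp (-(c ^ 2 * (2 * σ2) / 2))) := by
        rw [← Real.exp_nat_mul]
        ring_nf
      rw [elim]
      refine ((q1.add q2).const_mul (1 / 2)).congr fun n => ?_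
      have k1 : Integrable (fun ω => Real.cos (c * (R n ((T j)^[a] ω) + R n ((T j)^[b] ω)))) μ :=
        integrable_cos ((hRk n a).add (hRk n b)) c
      have k2 : Integrable (fun ω => Real.cos (c * (R n ((T j)^[a] ω) - R n ((T j)^[b] ω)))) μ :=
        integrable_cos ((hRk n a).sub (hRk n b)) c
      rw [← integral_add k1 k2, ← integral_const_mul]
      refine integral_congr_ae (Eventually.of_forall fun ω => ?_)
      simp only
      rw [mul_add c, mul_sub c, Real.cos_add, Real.cos_sub]
      ring
    have hfin := tendsto_charFun_of_sqDeviation (F := atTop) hTj (hS.le j) (hS.mono j) hRm hR4 hRB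
      (σ2 := σ2) (integral_nonneg fun ω => by positivity) (tendsto_coord_atTop j)
      (fun ε hε => exists_sqDeviation_le hTj hR4 hRB (integral_nonneg fun ω => by positivity)
        hone htwo hε) t
    refine hfin.congr fun n => ?_
    refine integral_congr_ae (Eventually.of_forall fun ω => ?_)
    simp only [hR, birkhoffSum_const_mul, boxBirkhoffSum, boxSize_cons]
    rw [Real.sqrt_mul (by positivity)]
    congr 3
    ring

end OrthomartingaleCLT

/-! ### Composition and conditional expectation as operators on `L²`. -/

section Operators

variable {Ω : Type*} {N mΩ : MeasurableSpace Ω} {μ : Measure Ω} {T : Ω → Ω}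

/-- The isometry `u ↦ u ∘ T` of `L²`. -/
noncomputable def koopman (hT : MeasurePreserving T μ μ) : Lp ℝ 2 μ →L[ℝ] Lp ℝ 2 μ :=
  (Lp.compMeasurePreservingₗᵢ ℝ T hT).toContinuousLinearMap

lemma coeFn_koopman (hT : MeasurePreserving T μ μ) (u : Lp ℝ 2 μ) :
    koopman hT u =ᵐ[μ] u ∘ T :=
  Lp.coeFn_compMeasurePreserving u hT

/-- The conditional expectation given `N` as an operator on `L²`. -/
noncomputable def condProj (μ : Measure Ω) (hN : N ≤ mΩ) : Lp ℝ 2 μ →L[ℝ] Lp ℝ 2 μ :=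
  (lpMeas ℝ ℝ N 2 μ).subtypeL ∘L condExpL2 ℝ ℝ hN

variable [IsProbabilityMeasure μ]

lemma coeFn_condProj (hN : N ≤ mΩ) (u : Lp ℝ 2 μ) : condProj μ hN u =ᵐ[μ] μ[u | N] := by
  have h1 := (Lp.memLp u).condExpL2_ae_eq_condExp (𝕜 := ℝ) hN
  rwa [Lp.toLp_coeFn] at h1

lemma integrable_coeFn (u : Lp ℝ 2 μ) : Integrable u μ := (Lp.memLp u).integrable (by norm_num)

lemma condProj_mul_condProj {N' : MeasurableSpace Ω} (h : N ≤ N') (hN' : N' ≤ mΩ) :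
    condProj μ (h.trans hN') * condProj μ hN' = condProj μ (h.trans hN') := by
  ext1 u
  apply Lp.ext
  rw [mul_apply_eq_comp]
  exact (coeFn_condProj _ _).trans ((condExp_congr_ae (coeFn_condProj _ _)).trans
    ((condExp_condExp_of_le h hN').trans (coeFn_condProj _ _).symm))

omit [IsProbabilityMeasure μ] in
lemma inner_condProj (hN : N ≤ mΩ) (u v : Lp ℝ 2 μ) :
    inner ℝ (condProj μ hN u) v = inner ℝ u (condProj μ hN v) :=
  inner_condExpL2_left_eq_right hN

/-- Used twice: with `N' = N` it is commutation with the other shifts, and with `N' = N.comap T`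
above `N` it gives `P U P = P U`. -/
lemma condProj_mul_koopman (hT : MeasurePreserving T μ μ) (hN : N ≤ mΩ) {N' : MeasurableSpace Ω}
    (hN' : N' ≤ mΩ) (h : N.comap T = N') :
    condProj μ hN' * koopman hT = koopman hT * condProj μ hN := by
  subst h
  ext1 u
  apply Lp.ext
  rw [mul_apply_eq_comp, mul_apply_eq_comp]
  refine (coeFn_condProj _ _).trans ((condExp_congr_ae (coeFn_koopman hT u)).trans ?_)
  refine (condExp_comp_measurePreserving hT hN (integrable_coeFn u)).trans ?_
  exact (hT.quasiMeasurePreserving.ae_eq_comp (coeFn_condProj hN u).symm).trans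
    (coeFn_koopman hT _).symm

lemma isShiftProj_koopman (hT : MeasurePreserving T μ μ) (hN : N ≤ mΩ) (hmono : N ≤ N.comap T) :
    IsShiftProj (koopman hT) (condProj μ hN) where
  norm_shift := (Lp.compMeasurePreservingₗᵢ ℝ T hT).norm_map
  proj_idem := condProj_mul_condProj le_rfl hN
  proj_symm := inner_condProj hN
  proj_shift_proj := by
    have hN' : N.comap T ≤ mΩ := (MeasurableSpace.comap_mono hN).trans hT.measurable.comap_le
    rw [mul_assoc, ← condProj_mul_koopman hT hN hN' rfl, ← mul_assoc, condProj_mul_condProj hmono hN']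

omit [IsProbabilityMeasure μ] in
lemma coeFn_koopman_pow (hT : MeasurePreserving T μ μ) (u : Lp ℝ 2 μ) (k : ℕ) :
    (koopman hT ^ k) u =ᵐ[μ] u ∘ T^[k] := by
  induction k with
  | zero => simp
  | succ k ih =>
    rw [pow_succ', mul_apply_eq_comp, Function.iterate_succ, ← Function.comp_assoc]
    exact (coeFn_koopman hT _).trans (hT.quasiMeasurePreserving.ae_eq_comp ih)

omit [IsProbabilityMeasure μ] in
lemma coeFn_powSum_koopman (hT : MeasurePreserving T μ μ) (u : Lp ℝ 2 μ) (n : ℕ) :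
    powSum (koopman hT) n u =ᵐ[μ] birkhoffSum T u n := by
  induction n with
  | zero =>
    rw [powSum_zero, birkhoffSum_zero', zero_apply]
    exact Lp.coeFn_zero _ _ _
  | succ n ih =>
    rw [powSum_succ, add_apply]
    filter_upwards [Lp.coeFn_add (powSum (koopman hT) n u) ((koopman hT ^ n) u), ih,
      coeFn_koopman_pow hT u n] with ω e1 e2 e3
    rw [e1, Pi.add_apply, e2, e3, birkhoffSum_succ]
    rfl

omit [IsProbabilityMeasure μ] in
lemma birkhoffSum_congr_ae (hT : MeasurePreserving T μ μ) {f g : Ω → ℝ} (hfg : f =ᵐ[μ] g) (n : ℕ) :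
    birkhoffSum T f n =ᵐ[μ] birkhoffSum T g n := by
  have h1 : ∀ᵐ ω ∂μ, ∀ k, f (T^[k] ω) = g (T^[k] ω) := ae_all_iff.2 fun k =>
    (hT.iterate k).quasiMeasurePreserving.ae_eq_comp hfg
  filter_upwards [h1] with ω h
  simp [birkhoffSum, h]

end Operators

/-! ### The operators of a shift system and their martingale differences. -/

section System

variable {ι Ω : Type*} {mΩ : MeasurableSpace Ω} {μ : Measure Ω} [IsProbabilityMeasure μ]
  {T : ι → Ω → Ω} {N : ι → MeasurableSpace Ω}

namespace IsShiftSystem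

variable (hS : IsShiftSystem μ T N)
include hS

/-- The isometries of `L²` given by the transformations of a shift system. -/
noncomputable abbrev koopman (i : ι) : Lp ℝ 2 μ →L[ℝ] Lp ℝ 2 μ :=
  RandomField.koopman (hS.measurePreserving i)

/-- The conditional expectations given the σ-fields of a shift system. -/
noncomputable abbrev condProj (i : ι) : Lp ℝ 2 μ →L[ℝ] Lp ℝ 2 μ :=
  RandomField.condProj μ (hS.le i)

lemma isShiftProjSystem (hcomm : ∀ i j, Commute (hS.condProj i) (hS.condProj j)) :
    IsShiftProjSystem hS.koopman hS.condProj where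
  shiftProj i := isShiftProj_koopman (hS.measurePreserving i) (hS.le i) (hS.mono i)
  shift_comm i j := by
    refine ContinuousLinearMap.ext fun u => Lp.ext ?_
    have h1 : ∀ i j, (hS.koopman i * hS.koopman j) u =ᵐ[μ] u ∘ (T j ∘ T i) := fun i j => by
      rw [mul_apply_eq_comp]
      exact (coeFn_koopman _ _).trans ((hS.measurePreserving i).quasiMeasurePreserving.ae_eq_comp
        (coeFn_koopman (hS.measurePreserving j) u))
    refine (h1 i j).trans (EventuallyEq.trans ?_ (h1 j i).symm)
    rw [(hS.comm i j).comp_eq]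
  proj_comm := hcomm
  proj_shift_comm i j hij := by
    exact condProj_mul_koopman (hS.measurePreserving j) (hS.le i) (hS.le i) (hS.comap_eq i j hij)

omit [IsProbabilityMeasure μ] in
lemma boxBirkhoffSum_congr_ae {f g : Ω → ℝ} (hfg : f =ᵐ[μ] g) (l : List ι) (n : ι → ℕ) :
    boxBirkhoffSum T l n f =ᵐ[μ] boxBirkhoffSum T l n g := by
  induction l with
  | nil => exact hfg
  | cons i l ih => exact birkhoffSum_congr_ae (hS.measurePreserving i) ih _

omit [IsProbabilityMeasure μ] in
lemma coeFn_boxSum (u : Lp ℝ 2 μ) (l : List ι) (n : ι → ℕ) :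
    boxSum hS.koopman l n u =ᵐ[μ] boxBirkhoffSum T l n u := by
  induction l with
  | nil => rfl
  | cons i l ih =>
    rw [boxSum_cons, mul_apply_eq_comp]
    exact (coeFn_powSum_koopman _ _ _).trans
      (birkhoffSum_congr_ae (hS.measurePreserving i) ih (n i))

lemma isMartDiff_of_eq {i : ι} {w u : Lp ℝ 2 μ} (hw : hS.condProj i w = w)
    (hu : u = ((1 - hS.condProj i) * hS.koopman i) w) : IsMartDiff μ (T i) (N i) u := by
  have hT := hS.measurePreserving i
  constructor
  · have h1 : AEStronglyMeasurable[N i] w μ := by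
      rw [← hw]
      exact stronglyMeasurable_condExp.aestronglyMeasurable.congr (coeFn_condProj (hS.le i) w).symm
    have h2 : AEStronglyMeasurable[(N i).comap (T i)] (hS.koopman i w) μ := by
      have := h1.comp_comap_iterate hT 1
      rw [Function.iterate_one] at this
      exact this.congr (coeFn_koopman hT w).symm
    have h3 : AEStronglyMeasurable[(N i).comap (T i)] (hS.condProj i (hS.koopman i w)) μ :=
      ((stronglyMeasurable_condExp.aestronglyMeasurable (m := N i)).mono (hS.mono i)).congr
        (coeFn_condProj (hS.le i) _).symm
    have e : u = hS.koopman i w - hS.condProj i (hS.koopman i w) := by rw [hu]; simp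
    rw [e]
    exact (h2.sub h3).congr (Lp.coeFn_sub _ _).symm
  · have h1 : hS.condProj i u = 0 := by
      have h2 := (isShiftProj_koopman hT (hS.le i) (hS.mono i)).proj_proj (hS.koopman i w)
      rw [hu]
      simp only [mul_apply_eq_comp, sub_apply, one_apply_eq_self, map_sub]
      rw [h2, sub_self]
    refine (coeFn_condProj (hS.le i) u).symm.trans ?_
    rw [h1]
    exact Lp.coeFn_zero _ _ _

/-- The operators `(1 - P_i) U_i` produce martingale differences in each direction. -/
lemma isMartDiff_prod (hcomm : ∀ i j, Commute (hS.condProj i) (hS.condProj j)) {l : List ι}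
    (hl : l.Nodup) {g : Lp ℝ 2 μ} (hg : ∀ i ∈ l, hS.condProj i g = g) {i : ι} (hi : i ∈ l) :
    IsMartDiff μ (T i) (N i) ((l.map fun i => (1 - hS.condProj i) * hS.koopman i).prod g) := by
  have h := hS.isShiftProjSystem hcomm
  obtain ⟨l₁, l₂, rfl⟩ := List.append_of_mem hi
  have hi₁ : ∀ j ∈ l₁, i ≠ j := by
    rintro j hj rfl
    exact (List.nodup_append.1 hl).2.2 i hj i List.mem_cons_self rfl
  have hi₂ : ∀ j ∈ l₂, i ≠ j := by
    rintro j hj rfl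
    exact (List.nodup_cons.1 (List.nodup_append.1 hl).2.1).1 hj
  have cP : ∀ j, i ≠ j → Commute (hS.condProj i) ((1 - hS.condProj j) * hS.koopman j) :=
    fun j hj => ((Commute.one_right _).sub_right (h.proj_comm i j)).mul_right
      (h.proj_shift_comm i j hj)
  have cM : ∀ j, i ≠ j → Commute ((1 - hS.condProj i) * hS.koopman i)
      ((1 - hS.condProj j) * hS.koopman j) := fun j hj =>
    (((Commute.one_left _).sub_left (cP j hj))).mul_left
      (((Commute.one_right _).sub_right (h.proj_shift_comm j i hj.symm).symm).mul_right
        (h.shift_comm i j))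
  have c1 := commute_map_prod (l := l₁) fun j hj => cM j (hi₁ j hj)
  have c2 := commute_map_prod (l := l₁) fun j hj => cP j (hi₁ j hj)
  have c3 := commute_map_prod (l := l₂) fun j hj => cP j (hi₂ j hj)
  -- All factors commute, so the factor of index `i` can be brought to the front, and `P_i` still
  -- fixes the rest of the product applied to `g`.
  refine hS.isMartDiff_of_eq (w := (l₁.map fun i => (1 - hS.condProj i) * hS.koopman i).prod
    ((l₂.map fun i => (1 - hS.condProj i) * hS.koopman i).prod g)) ?_ ?_
  · rw [apply_comm c2, apply_comm c3, hg i hi]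
  · rw [apply_comm c1, List.map_append, List.prod_append, List.map_cons, List.prod_cons,
      mul_apply_eq_comp, mul_apply_eq_comp ((1 - hS.condProj i) * hS.koopman i)]

lemma memLp_top_prod {l : List ι} {g : Lp ℝ 2 μ} (hg : MemLp g ⊤ μ) :
    MemLp ((l.map fun i => (1 - hS.condProj i) * hS.koopman i).prod g) ⊤ μ := by
  induction l with
  | nil => exact hg
  | cons i l ih =>
    rw [List.map_cons, List.prod_cons, mul_apply_eq_comp]
    set u := (l.map fun i => (1 - hS.condProj i) * hS.koopman i).prod g
    have h1 : MemLp (hS.koopman i u) ⊤ μ :=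
      (ih.comp_measurePreserving (hS.measurePreserving i)).ae_eq (coeFn_koopman _ _).symm
    have h2 : MemLp (hS.condProj i (hS.koopman i u)) ⊤ μ :=
      (h1.condExp le_top).ae_eq (coeFn_condProj (hS.le i) _).symm
    have e : ((1 - hS.condProj i) * hS.koopman i) u =
      hS.koopman i u - hS.condProj i (hS.koopman i u) := by simp
    rw [e]
    exact (h1.sub h2).ae_eq (Lp.coeFn_sub _ _).symm

/-- A simple function approximates `g`, and the projections are then applied to it. They preserve
boundedness, do not increase the distance to `g`, which they fix, and since they commute no earlier
invariance is lost. Boundedness supplies the fourth moments of the central limit theorem. -/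
lemma exists_bounded_approx (hcomm : ∀ i j, Commute (hS.condProj i) (hS.condProj j)) {l : List ι}
    {g : Lp ℝ 2 μ} (hg : ∀ i ∈ l, hS.condProj i g = g) {ε : ℝ} (hε : 0 < ε) :
    ∃ g' : Lp ℝ 2 μ, (∀ i ∈ l, hS.condProj i g' = g') ∧ MemLp g' ⊤ μ ∧ ‖g - g'‖ ≤ ε := by
  induction l with
  | nil =>
    obtain ⟨s, hs, hs2⟩ := (Lp.memLp g).exists_simpleFunc_eLpNorm_sub_lt (by norm_num)
      (ENNReal.ofReal_pos.2 hε).ne'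
    refine ⟨hs2.toLp s, by simp, (s.memLp_top μ).ae_eq hs2.coeFn_toLp.symm, ?_⟩
    rw [Lp.norm_def]
    refine ENNReal.toReal_le_of_le_ofReal hε.le ((le_of_eq (eLpNorm_congr_ae ?_)).trans hs.le)
    filter_upwards [Lp.coeFn_sub g (hs2.toLp s), hs2.coeFn_toLp] with ω e1 e2
    rw [e1, Pi.sub_apply, Pi.sub_apply, e2]
  | cons i l ih =>
    obtain ⟨g', h1, h2, h3⟩ := ih fun j hj => hg j (List.mem_cons_of_mem _ hj)
    have hP := isShiftProj_koopman (hS.measurePreserving i) (hS.le i) (hS.mono i)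
    refine ⟨hS.condProj i g', fun j hj => ?_, (h2.condExp le_top).ae_eq
      (coeFn_condProj (hS.le i) g').symm, ?_⟩
    · rcases List.mem_cons.1 hj with rfl | hj
      · exact hP.proj_proj g'
      · rw [apply_comm (hcomm j i), h1 j hj]
    · have e : g - hS.condProj i g' = hS.condProj i (g - g') := by
        rw [map_sub, hg i List.mem_cons_self]
      rw [e]
      exact (hP.norm_proj_le _).trans h3

end IsShiftSystem

end System

/-! ### Passing from orthomartingale differences to the summand. -/

section OperatorCLT

variable {ι Ω : Type*} {mΩ : MeasurableSpace Ω} {μ : Measure Ω}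
  {T : ι → Ω → Ω} {N : ι → MeasurableSpace Ω}

lemma norm_sq_eq_integral (u : Lp ℝ 2 μ) : ‖u‖ ^ 2 = ∫ ω, u ω ^ 2 ∂μ := by
  rw [← real_inner_self_eq_norm_sq, L2.inner_def]
  refine integral_congr_ae (Eventually.of_forall fun ω => ?_)
  simp [sq]

lemma eventually_boxSize_pos (l : List ι) : ∀ᶠ n in (atTop : Filter (ι → ℕ)), 0 < boxSize l n := by
  filter_upwards [eventually_ge_atTop (1 : ι → ℕ)] with n hn
  refine List.prod_pos fun x hx => ?_
  obtain ⟨i, -, rfl⟩ := List.mem_map.1 hx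
  exact_mod_cast (hn i : 1 ≤ n i)

variable [IsProbabilityMeasure μ]

namespace IsShiftSystem

variable (hS : IsShiftSystem μ T N)
include hS

/-- The central limit theorem for orthomartingale differences approximating the summand. -/
lemma exists_clt_approx (hcomm : ∀ i j, Commute (hS.condProj i) (hS.condProj j)) {i₀ : ι}
    (herg : Ergodic (T i₀) μ) {l : List ι} (hl : (l ++ [i₀]).Nodup) {f : Lp ℝ 2 μ}
    (hf : ∀ i ∈ l ++ [i₀], hS.condProj i f = f)
    (hfin : nestedSum dyadicWeight (fun i j => hS.condProj i * powSum (hS.koopman i) (2 ^ j))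
      (l ++ [i₀]) f ≠ ⊤) {ε : ℝ} (hε : 0 < ε) :
    ∃ m : Lp ℝ 2 μ, (∀ n, ‖boxSum hS.koopman (l ++ [i₀]) n m‖ = √(boxSize (l ++ [i₀]) n) * ‖m‖) ∧
      (∀ᶠ n in (atTop : Filter (ι → ℕ)),
        ‖boxSum hS.koopman (l ++ [i₀]) n (f - m)‖ ≤ ε * √(boxSize (l ++ [i₀]) n)) ∧
      ∀ t : ℝ, Tendsto (fun n : ι → ℕ => ∫ ω, Complex.exp ((t / √(boxSize (l ++ [i₀]) n) *
        boxSum hS.koopman (l ++ [i₀]) n m ω : ℝ) * Complex.I) ∂μ) atTop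
        (𝓝 (Real.exp (-(t ^ 2 * ‖m‖ ^ 2 / 2)) : ℝ)) := by
  have h := hS.isShiftProjSystem hcomm
  set l' := l ++ [i₀] with hl'
  obtain ⟨g, hg, hgn⟩ := h.exists_martingale_approx hl hf hfin (half_pos hε)
  obtain ⟨g', hg', hb, hgg⟩ := hS.exists_bounded_approx hcomm hg (half_pos hε)
  set M := (l'.map fun i => (1 - hS.condProj i) * hS.koopman i).prod with hM
  have hnorm := fun n => h.norm_boxSum_prod hl hg' n
  have h4 : MemLp (M g') 4 μ := (hS.memLp_top_prod hb).mono_exponent le_top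
  refine ⟨M g', hnorm, ?_, fun t => ?_⟩
  · filter_upwards [hgn] with n hn
    have e : f - M g' = (f - M g) + M (g - g') := by rw [map_sub]; abel
    have h1 := h.norm_boxSum_prod hl (g := g - g')
      (fun i hi => by rw [map_sub, hg i hi, hg' i hi]) n
    have h2 : ‖M (g - g')‖ ≤ ε / 2 :=
      (norm_map_prod_le (fun i _ x => (h.shiftProj i).norm_shift_sub_proj_le x) _).trans hgg
    rw [e, map_add]
    refine (norm_add_le _ _).trans ?_
    rw [h1]
    have h3 := mul_le_mul_of_nonneg_left h2 (Real.sqrt_nonneg (boxSize l' n))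
    linarith
  · have h1 := hS.tendsto_charFun herg hl h4 (fun i hi => hS.isMartDiff_prod hcomm hl hg' hi) t
    rw [← norm_sq_eq_integral] at h1
    refine h1.congr fun n => integral_congr_ae ?_
    filter_upwards [hS.coeFn_boxSum (M g') l' n] with ω e
    rw [e]

/-- The central limit theorem under the projective summability condition. -/
theorem exists_clt (hcomm : ∀ i j, Commute (hS.condProj i) (hS.condProj j)) {i₀ : ι}
    (herg : Ergodic (T i₀) μ) {l : List ι} (hl : (l ++ [i₀]).Nodup) {f : Lp ℝ 2 μ}
    (hf : ∀ i ∈ l ++ [i₀], hS.condProj i f = f)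
    (hfin : nestedSum dyadicWeight (fun i j => hS.condProj i * powSum (hS.koopman i) (2 ^ j))
      (l ++ [i₀]) f ≠ ⊤) :
    ∃ c : ℝ, Tendsto (fun n : ι → ℕ => ‖boxSum hS.koopman (l ++ [i₀]) n f‖ /
        √(boxSize (l ++ [i₀]) n)) atTop (𝓝 c) ∧
      ∀ t : ℝ, Tendsto (fun n : ι → ℕ => ∫ ω, Complex.exp ((t / √(boxSize (l ++ [i₀]) n) *
        boxSum hS.koopman (l ++ [i₀]) n f ω : ℝ) * Complex.I) ∂μ) atTop
        (𝓝 (Real.exp (-(t ^ 2 * c ^ 2 / 2)) : ℝ)) := by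
  have happrox := fun ε (hε : 0 < ε) => hS.exists_clt_approx hcomm herg hl hf hfin hε
  set l' := l ++ [i₀] with hl'
  have hclose : ∀ m : Lp ℝ 2 μ, ∀ ε : ℝ,
      (∀ n, ‖boxSum hS.koopman l' n m‖ = √(boxSize l' n) * ‖m‖) →
      (∀ᶠ n in (atTop : Filter (ι → ℕ)),
        ‖boxSum hS.koopman l' n (f - m)‖ ≤ ε * √(boxSize l' n)) →
      ∀ᶠ n in (atTop : Filter (ι → ℕ)),
        |‖boxSum hS.koopman l' n f‖ / √(boxSize l' n) - ‖m‖| ≤ ε := by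
    intro m ε h1 h2
    filter_upwards [h2, eventually_boxSize_pos l'] with n hn hpos
    have hpos' := Real.sqrt_pos.2 hpos
    have e : ‖boxSum hS.koopman l' n f‖ / √(boxSize l' n) - ‖m‖ =
        (‖boxSum hS.koopman l' n f‖ - ‖boxSum hS.koopman l' n m‖) / √(boxSize l' n) := by
      rw [h1 n]; field_simp
    rw [e, abs_div, abs_of_pos hpos', div_le_iff₀ hpos']
    refine (abs_norm_sub_norm_le _ _).trans ?_
    rwa [← map_sub]
  -- For every accuracy the normalised norms are eventually that close to a constant `‖m‖`, so they
  -- are Cauchy.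
  obtain ⟨c, hc⟩ : ∃ c : ℝ, Tendsto (fun n : ι → ℕ => ‖boxSum hS.koopman l' n f‖ /
      √(boxSize l' n)) atTop (𝓝 c) := by
    rw [← cauchy_map_iff_exists_tendsto, Metric.cauchy_iff]
    refine ⟨inferInstance, fun ε hε => ?_⟩
    obtain ⟨m, h1, h2, -⟩ := happrox (ε / 3) (by positivity)
    refine ⟨{x | |x - ‖m‖| ≤ ε / 3}, hclose m _ h1 h2, fun x hx y hy => ?_⟩
    have h3 := abs_sub_le x ‖m‖ y
    rw [abs_sub_comm ‖m‖ y] at h3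
    rw [Real.dist_eq]
    simp only [Set.mem_ofPred_eq] at hx hy
    linarith
  refine ⟨c, hc, fun t => ?_⟩
  rw [Metric.tendsto_nhds]
  intro η hη
  have hcont : Continuous fun r : ℝ => Real.exp (-(t ^ 2 * r ^ 2 / 2)) := by fun_prop
  obtain ⟨δ, hδ, hδ'⟩ := Metric.continuousAt_iff.1 (hcont.continuousAt (x := c)) (η / 3)
    (by positivity)
  -- The first bound keeps `‖m‖` within `δ` of `c`, so that the two Gaussian limits differ by less
  -- than `η / 3`; the second makes replacing `f` by `m` cost at most `η / 3` in the characteristic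
  -- function.
  obtain ⟨m, h1, h2, h3⟩ := happrox (min (δ / 2) (η / (3 * (|t| + 1)))) (by positivity)
  have hmc : |‖m‖ - c| ≤ δ / 2 := by
    have h4 := (hc.sub_const ‖m‖).abs
    have h5 := le_of_tendsto h4 (hclose m _ h1 h2)
    rw [abs_sub_comm]
    exact h5.trans (min_le_left _ _)
  have h6 := hδ' (x := ‖m‖) (by rw [Real.dist_eq]; linarith)
  filter_upwards [h2, eventually_boxSize_pos l', (Metric.tendsto_nhds.1 (h3 t)) (η / 3)
    (by positivity)] with n hn hpos hm
  have hpos' := Real.sqrt_pos.2 hpos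
  have h7 := norm_integral_exp_I_sub_le (integrable_coeFn (boxSum hS.koopman l' n f))
    (integrable_coeFn (boxSum hS.koopman l' n m)) (t / √(boxSize l' n))
  have h8 : ∫ ω, |boxSum hS.koopman l' n f ω - boxSum hS.koopman l' n m ω| ∂μ ≤
      ‖boxSum hS.koopman l' n (f - m)‖ := by
    rw [map_sub]
    refine (le_of_eq (integral_congr_ae ?_)).trans (integral_abs_le_norm _)
    filter_upwards [Lp.coeFn_sub (boxSum hS.koopman l' n f) (boxSum hS.koopman l' n m)] with ω e
    rw [e, Pi.sub_apply]
  have h9 : |t / √(boxSize l' n)| *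
      ∫ ω, |boxSum hS.koopman l' n f ω - boxSum hS.koopman l' n m ω| ∂μ < η / 3 := by
    refine (mul_le_mul_of_nonneg_left (h8.trans hn) (abs_nonneg _)).trans_lt ?_
    rw [abs_div, abs_of_pos hpos']
    have e : |t| / √(boxSize l' n) * (min (δ / 2) (η / (3 * (|t| + 1))) * √(boxSize l' n)) =
        |t| * min (δ / 2) (η / (3 * (|t| + 1))) := by field_simp
    rw [e]
    refine (mul_le_mul_of_nonneg_left (min_le_right _ _) (abs_nonneg t)).trans_lt ?_
    rw [← mul_div_assoc, div_lt_iff₀ (by positivity)]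
    nlinarith [abs_nonneg t]
  rw [Real.dist_eq] at h6
  rw [dist_eq_norm] at hm ⊢
  have h10 : ‖((Real.exp (-(t ^ 2 * ‖m‖ ^ 2 / 2)) : ℝ) : ℂ) -
      ((Real.exp (-(t ^ 2 * c ^ 2 / 2)) : ℝ) : ℂ)‖ < η / 3 := by
    rw [← Complex.ofReal_sub, Complex.norm_real]
    exact h6
  refine (norm_sub_le_norm_sub_add_norm_sub _ _ _).trans_lt
    ((add_lt_add_of_le_of_lt (h7.trans h9.le)
    ((norm_sub_le_norm_sub_add_norm_sub _ _ _).trans_lt (add_lt_add hm h10))).trans_le ?_)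
  linarith

end IsShiftSystem

end OperatorCLT

/-! ### The canonical space: shifts, half-spaces and orthants. -/

section Configurations

variable {d : ℕ} {E : Type*} [MeasurableSpace E]

/-- The σ-field generated by the coordinates in `s`. -/
abbrev coordField (E : Type*) [MeasurableSpace E] (s : Set (Fin d → ℤ)) :
    MeasurableSpace ((Fin d → ℤ) → E) :=
  ⨆ u ∈ s, MeasurableSpace.comap (fun x => x u) inferInstance

lemma coordField_le (s : Set (Fin d → ℤ)) : coordField E s ≤ MeasurableSpace.pi :=
  iSup₂_le fun u _ => (measurable_pi_apply u).comap_le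

lemma coordField_mono {s t : Set (Fin d → ℤ)} (h : s ⊆ t) : coordField E s ≤ coordField E t :=
  biSup_mono h

lemma coordField_iUnion {κ : Type*} (s : κ → Set (Fin d → ℤ)) :
    coordField E (⋃ k, s k) = ⨆ k, coordField E (s k) :=
  iSup_iUnion _ _

lemma measurable_apply_coordField {s : Set (Fin d → ℤ)} {u : Fin d → ℤ} (hu : u ∈ s) :
    Measurable[coordField E s] fun x : (Fin d → ℤ) → E => x u :=
  Measurable.of_comap_le (le_biSup (fun u => MeasurableSpace.comap
    (fun x : (Fin d → ℤ) → E => x u) inferInstance) hu)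

lemma comap_shift_coordField (i : Fin d) (s : Set (Fin d → ℤ)) :
    (coordField E s).comap (shift i) = coordField E ((· + Pi.single i 1) '' s) := by
  simp only [coordField, MeasurableSpace.comap_iSup, MeasurableSpace.comap_comp, iSup_image]
  rfl

lemma comap_path_coordField {Ω : Type*} (ξ : (Fin d → ℤ) → Ω → E) (k : Fin d → ℤ) :
    (coordField E (Set.Iic 0)).comap (path fun j => ξ (j + k)) = sigmaField ξ k := by
  simp only [coordField, MeasurableSpace.comap_iSup, MeasurableSpace.comap_comp]
  refine Eq.trans (iSup_congr fun u => ?_) ((Equiv.addRight k).iSup_comp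
    (g := fun u => ⨆ _ : u ∈ Set.Iic k, MeasurableSpace.comap (ξ u) inferInstance))
  have e : u ∈ Set.Iic 0 ↔ Equiv.addRight k u ∈ Set.Iic k := by simp
  exact iSup_congr_Prop e fun _ => rfl

lemma measurable_shift (i : Fin d) : Measurable (shift i : ((Fin d → ℤ) → E) → _) :=
  measurable_pi_lambda _ fun _ => measurable_pi_apply _

omit [MeasurableSpace E] in
lemma commute_shift (i j : Fin d) :
    Function.Commute (shift i : ((Fin d → ℤ) → E) → _) (shift j) := fun x => by
  ext k
  simp only [shift]
  congr 1
  abel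

omit [MeasurableSpace E] in
lemma shift_iterate (i : Fin d) (n : ℕ) (x : (Fin d → ℤ) → E) :
    (shift i)^[n] x = fun j => x (j + Pi.single i (n : ℤ)) := by
  induction n generalizing x with
  | zero => simp
  | succ n ih =>
    rw [Function.iterate_succ_apply, ih]
    ext j
    simp only [shift]
    congr 1
    rw [add_assoc, ← Pi.single_add]
    push_cast
    rfl

/-- The set of the indices whose coordinates in `l` are not positive. -/
def lowerSet (l : List (Fin d)) : Set (Fin d → ℤ) := {u | ∀ i ∈ l, u i ≤ 0}

lemma image_shift_lowerSet {i j : Fin d} (hij : i ≠ j) :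
    (· + Pi.single j (1 : ℤ)) '' lowerSet [i] = lowerSet [i] := by
  ext u
  simp only [lowerSet, List.mem_singleton, forall_eq, Set.mem_image, Set.mem_ofPred_eq]
  constructor
  · rintro ⟨v, hv, rfl⟩
    simpa [hij] using hv
  · intro hu
    exact ⟨u - Pi.single j 1, by simpa [hij] using hu, by simp⟩

lemma subset_image_shift (i : Fin d) :
    lowerSet [i] ⊆ (· + Pi.single i (1 : ℤ)) '' lowerSet [i] := by
  intro u hu
  simp only [lowerSet, List.mem_singleton, forall_eq, Set.mem_image, Set.mem_ofPred_eq] at hu ⊢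
  exact ⟨u - Pi.single i 1, by simp; omega, by simp⟩

variable {ν : Measure ((Fin d → ℤ) → E)}

lemma isShiftSystem_shift (hν : ∀ i, ν.map (shift i) = ν) :
    IsShiftSystem ν (fun i => shift i) fun i => coordField E (lowerSet [i]) where
  measurePreserving i := ⟨measurable_shift i, hν i⟩
  comm := commute_shift
  le i := coordField_le _
  mono i := by
    rw [comap_shift_coordField]
    exact coordField_mono (subset_image_shift i)
  comap_eq i j hij := by rw [comap_shift_coordField, image_shift_lowerSet hij]

/-- A corner of the box approximating `lowerSet l`. -/
def corner (l : List (Fin d)) (M : ℕ) (i : Fin d) : ℤ := if i ∈ l then 0 else M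

lemma corner_inf (i : Fin d) (l : List (Fin d)) (M : ℕ) :
    corner l M ⊓ corner [i] M = corner (i :: l) M := by
  ext j
  simp only [corner, Pi.inf_apply, List.mem_cons]
  by_cases h1 : j = i
  · subst h1
    by_cases h2 : j ∈ l <;> simp [h2]
  · by_cases h2 : j ∈ l <;> simp [h1, h2]

lemma iUnion_Iic_corner (l : List (Fin d)) : ⋃ M, Set.Iic (corner l M) = lowerSet l := by
  ext u
  simp only [Set.mem_iUnion, Set.mem_Iic, lowerSet, Set.mem_ofPred_eq]
  constructor
  · rintro ⟨M, hM⟩ i hi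
    simpa [corner, hi] using hM i
  · intro hu
    refine ⟨∑ i, (u i).natAbs, fun i => ?_⟩
    by_cases hi : i ∈ l
    · simpa [corner, hi] using hu i hi
    · simp only [corner, hi, if_false]
      have := Finset.single_le_sum (f := fun i => (u i).natAbs) (fun _ _ => Nat.zero_le _)
        (Finset.mem_univ i)
      omega

lemma corner_mono (l : List (Fin d)) : Monotone (corner l) := fun M M' h i => by
  simp only [corner]
  split_ifs
  · exact le_rfl
  · exact_mod_cast h

variable [IsProbabilityMeasure ν]

/-- Lévy's upward theorem, as the orthants below the corners increase to `lowerSet l`. -/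
lemma tendsto_eLpNorm_condExp_corner (l : List (Fin d)) (g : ((Fin d → ℤ) → E) → ℝ) :
    Tendsto (fun M => eLpNorm (ν[g | coordField E (Set.Iic (corner l M))] -
      ν[g | coordField E (lowerSet l)]) 1 ν) atTop (𝓝 0) := by
  have h := tendsto_eLpNorm_condExp (μ := ν) (ℱ := ⟨fun M => coordField E (Set.Iic (corner l M)),
    fun _ _ h => coordField_mono (Set.Iic_subset_Iic.2 (corner_mono l h)),
    fun _ => coordField_le _⟩) g
  have e : ⨆ M, coordField E (Set.Iic (corner l M)) = coordField E (lowerSet l) := by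
    rw [← coordField_iUnion, iUnion_Iic_corner]
  rw [← e]
  exact h

/-- The conditional expectations given the σ-fields of orthants commute in the last `d - 1`
coordinates. -/
def IsOrthantCommuting [NeZero d] (ν : Measure ((Fin d → ℤ) → E)) : Prop :=
  ∀ Y : ((Fin d → ℤ) → E) → ℝ, Integrable Y ν → ∀ k l : Fin d → ℤ, l 0 ≤ k 0 →
    ν[ν[Y | coordField E (Set.Iic k)] | coordField E (Set.Iic l)] =ᵐ[ν]
      ν[Y | coordField E (Set.Iic (k ⊓ l))]

/-- The commuting hypothesis holds at the corners of `l` and `[i]`, whose minimum is the corner of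
`i :: l`; then `M → ∞`, conditional expectation being an `L¹` contraction. The alternative `hil`
ensures the required order of the first coordinates of the corners. -/
lemma IsOrthantCommuting.condExp_lowerSet [NeZero d] (h : IsOrthantCommuting ν) {i : Fin d}
    {l : List (Fin d)} (hil : i = 0 ∨ 0 ∉ l) {g : ((Fin d → ℤ) → E) → ℝ} (hg : Integrable g ν) :
    ν[ν[g | coordField E (lowerSet l)] | coordField E (lowerSet [i])] =ᵐ[ν]
      ν[g | coordField E (lowerSet (i :: l))] := by
  set A := ν[g | coordField E (lowerSet l)] with hA
  set a := fun M => eLpNorm (ν[g | coordField E (Set.Iic (corner l M))] - A) 1 ν with ha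
  set b := fun M => eLpNorm (ν[A | coordField E (Set.Iic (corner [i] M))] -
    ν[A | coordField E (lowerSet [i])]) 1 ν with hb
  set c := fun M => eLpNorm (ν[g | coordField E (Set.Iic (corner (i :: l) M))] -
    ν[g | coordField E (lowerSet (i :: l))]) 1 ν with hc
  have habc : Tendsto (fun M => a M + b M + c M) atTop (𝓝 0) := by
    have := ((tendsto_eLpNorm_condExp_corner (ν := ν) l g).add (tendsto_eLpNorm_condExp_corner (ν := ν) [i] A)).add
      (tendsto_eLpNorm_condExp_corner (ν := ν) (i :: l) g)
    simpa using this
  have hle : ∀ M, eLpNorm (ν[A | coordField E (lowerSet [i])] -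
      ν[g | coordField E (lowerSet (i :: l))]) 1 ν ≤ a M + b M + c M := by
    intro M
    set X := ν[g | coordField E (Set.Iic (corner l M))] with hX
    set Y := ν[g | coordField E (Set.Iic (corner (i :: l) M))] with hY
    have hcomm : ν[X | coordField E (Set.Iic (corner [i] M))] =ᵐ[ν] Y := by
      have := h g hg (corner l M) (corner [i] M) ?_
      · rwa [corner_inf] at this
      · rcases hil with rfl | h0
        · simp only [corner, List.mem_singleton, if_true]
          split_ifs <;> positivity
        · simp only [corner, List.mem_singleton, h0, if_false]
          split_ifs <;> simp
    have h1 : eLpNorm (ν[A | coordField E (Set.Iic (corner [i] M))] - Y) 1 ν ≤ a M := by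
      have e : ν[X - A | coordField E (Set.Iic (corner [i] M))] =ᵐ[ν]
          -(ν[A | coordField E (Set.Iic (corner [i] M))] - Y) := by
        filter_upwards [condExp_sub (μ := ν) (integrable_condExp (f := g)) (integrable_condExp
          (f := g)) (coordField E (Set.Iic (corner [i] M))), hcomm] with ω e1 e2
        rw [e1, Pi.sub_apply, e2]; simp [hA]
      have h2 := eLpNorm_condExp_le_eLpNorm (μ := ν) (m := coordField E (Set.Iic (corner [i] M)))
        (X - A) (p := 1) le_rfl
      rwa [eLpNorm_congr_ae e, eLpNorm_neg] at h2
    have e : ν[A | coordField E (lowerSet [i])] - ν[g | coordField E (lowerSet (i :: l))] =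
        (ν[A | coordField E (Set.Iic (corner [i] M))] - Y) -
          (ν[A | coordField E (Set.Iic (corner [i] M))] - ν[A | coordField E (lowerSet [i])]) +
          (Y - ν[g | coordField E (lowerSet (i :: l))]) := by abel
    have i1 : ∀ m, AEStronglyMeasurable (ν[A | m]) ν := fun m => integrable_condExp.1
    have i2 : ∀ m, AEStronglyMeasurable (ν[g | m]) ν := fun m => integrable_condExp.1
    rw [e]
    refine (eLpNorm_add_le (((i1 _).sub (i2 _)).sub ((i1 _).sub (i1 _))) ((i2 _).sub (i2 _))
      le_rfl).trans (add_le_add ((eLpNorm_sub_le ((i1 _).sub (i2 _)) ((i1 _).sub (i1 _))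
        le_rfl).trans (add_le_add h1 le_rfl)) le_rfl)
  have h0 := le_antisymm (ge_of_tendsto' habc hle) zero_le
  rw [eLpNorm_eq_zero_iff ((integrable_condExp (μ := ν)).1.sub integrable_condExp.1)
    one_ne_zero] at h0
  filter_upwards [h0] with ω e
  exact sub_eq_zero.1 e

end Configurations

/-! ### Half-space projections commute and multiply to the orthant projection. -/

section Orthants

variable {d : ℕ} {E : Type*} [MeasurableSpace E] {ν : Measure ((Fin d → ℤ) → E)}

/-- Taking adjoints of `A B = C` with all three symmetric gives `B A = C`. -/
lemma commute_of_mul_eq {H : Type*} [NormedAddCommGroup H] [InnerProductSpace ℝ H]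
    {A B C : H →L[ℝ] H} (hA : ∀ x y, inner ℝ (A x) y = inner ℝ x (A y))
    (hB : ∀ x y, inner ℝ (B x) y = inner ℝ x (B y)) (hC : ∀ x y, inner ℝ (C x) y = inner ℝ x (C y))
    (h : A * B = C) : Commute A B := by
  have h1 : B * A = C := by
    refine ContinuousLinearMap.ext fun x => ext_inner_right ℝ fun y => ?_
    rw [hC, ← h, mul_apply_eq_comp, mul_apply_eq_comp, hB, hA]
  exact h.trans h1.symm

variable [IsProbabilityMeasure ν] [NeZero d]

namespace IsOrthantCommuting

variable (h : IsOrthantCommuting ν)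
include h

lemma condProj_mul {i : Fin d} {l : List (Fin d)} (hil : i = 0 ∨ 0 ∉ l) :
    condProj ν (coordField_le (lowerSet [i])) * condProj ν (coordField_le (lowerSet l)) =
      condProj ν (coordField_le (E := E) (lowerSet (i :: l))) := by
  refine ContinuousLinearMap.ext fun u => Lp.ext ?_
  rw [mul_apply_eq_comp]
  exact (coeFn_condProj _ _).trans ((condExp_congr_ae (coeFn_condProj _ _)).trans
    ((h.condExp_lowerSet hil (integrable_coeFn u)).trans (coeFn_condProj _ _).symm))

/-- The hypothesis is one-sided in the first coordinate, but one of the two orders of `i` and `j` is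
always admissible, and symmetry yields the other. -/
lemma commute_condProj (i j : Fin d) : Commute (condProj ν (coordField_le (E := E) (lowerSet [i])))
    (condProj ν (coordField_le (lowerSet [j]))) := by
  by_cases hij : i = 0 ∨ 0 ∉ [j]
  · exact commute_of_mul_eq (inner_condProj _) (inner_condProj _) (inner_condProj _)
      (h.condProj_mul hij)
  · refine (commute_of_mul_eq (inner_condProj _) (inner_condProj _) (inner_condProj _)
      (h.condProj_mul (i := j) (l := [i]) (Or.inl ?_))).symm
    simp only [List.mem_singleton, not_or, not_not] at hij
    exact hij.2.symm

lemma prod_condProj_mul {l : List (Fin d)} (hl : 0 ∉ l) :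
    (l.map fun i => condProj ν (coordField_le (E := E) (lowerSet [i]))).prod *
      condProj ν (coordField_le (lowerSet [0])) = condProj ν (coordField_le (lowerSet (0 :: l))) := by
  induction l with
  | nil => simp
  | cons i l ih =>
    have hl' : 0 ∉ l := fun h0 => hl (List.mem_cons_of_mem _ h0)
    -- `condProj_mul` cannot add `i ≠ 0` to a list containing `0`. The projection of index `0` is
    -- therefore split off and moved to the left, `i` is merged with `l`, and index `0` is merged
    -- last.
    rw [List.map_cons, List.prod_cons, mul_assoc, ih hl', ← h.condProj_mul (Or.inl rfl),
      ← mul_assoc, (h.commute_condProj i 0).eq, mul_assoc, h.condProj_mul (Or.inr hl'),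
      h.condProj_mul (Or.inl rfl)]

end IsOrthantCommuting

/-- All coordinates, the first one last. -/
def coordList (d : ℕ) [NeZero d] : List (Fin d) := (List.finRange d).erase 0 ++ [0]

lemma coordList_nodup : (coordList d).Nodup := by
  rw [coordList, List.nodup_append]
  refine ⟨(List.nodup_finRange d).erase 0, by simp, fun a ha b hb => ?_⟩
  rw [List.mem_singleton.1 hb]
  exact ((List.Nodup.mem_erase_iff (List.nodup_finRange d)).1 ha).1

lemma mem_coordList (i : Fin d) : i ∈ coordList d := by
  by_cases hi : i = 0
  · simp [coordList, hi]
  · simp [coordList, hi, (List.nodup_finRange d).mem_erase_iff]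

lemma prod_map_coordList {M : Type*} [CommMonoid M] (F : Fin d → M) :
    ((coordList d).map F).prod = ∏ i, F i := by
  rw [← List.prod_toFinset _ coordList_nodup]
  exact Finset.prod_congr (Finset.ext fun i => by simp [mem_coordList]) fun _ _ => rfl

lemma lowerSet_eq_Iic : lowerSet (0 :: (List.finRange d).erase 0) = Set.Iic (0 : Fin d → ℤ) := by
  ext u
  simp only [lowerSet, Set.mem_ofPred_eq, Set.mem_Iic, Pi.le_def, Pi.zero_apply]
  refine ⟨fun hu i => hu i ?_, fun hu i _ => hu i⟩
  have := mem_coordList i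
  simp only [coordList, List.mem_append, List.mem_singleton] at this
  exact List.mem_cons.2 this.symm

lemma IsOrthantCommuting.prod_coordList (h : IsOrthantCommuting ν) :
    ((coordList d).map fun i => condProj ν (coordField_le (E := E) (lowerSet [i]))).prod =
      condProj ν (coordField_le (Set.Iic 0)) := by
  rw [coordList, List.map_append, List.prod_append, List.map_singleton, List.prod_singleton,
    h.prod_condProj_mul (by simp [(List.nodup_finRange d).mem_erase_iff])]
  have e : ∀ s t : Set (Fin d → ℤ), s = t → condProj ν (coordField_le (E := E) s) =
      condProj ν (coordField_le t) := by rintro s _ rfl; rfl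
  exact e _ _ lowerSet_eq_Iic

/-- Collects the projections on the left: the terms of the nested sum become projected sums over
boxes, as in the summability hypothesis. -/
lemma IsShiftProjSystem.prod_map_mul {ι H : Type*} [NormedAddCommGroup H] [InnerProductSpace ℝ H]
    {U P : ι → H →L[ℝ] H} (h : IsShiftProjSystem U P) {l : List ι} (hl : l.Nodup) (n : ι → ℕ) :
    (l.map fun i => P i * powSum (U i) (n i)).prod = (l.map P).prod * boxSum U l n := by
  induction l with
  | nil => simp
  | cons i l ih =>
    obtain ⟨hi, hl⟩ := List.nodup_cons.1 hl
    have c : Commute (powSum (U i) (n i)) (l.map P).prod := commute_map_prod fun j hj =>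
      (commute_powSum (h.proj_shift_comm j i fun hji => hi (hji ▸ hj)) _).symm
    rw [List.map_cons, List.prod_cons, ih hl, boxSum_cons, List.map_cons, List.prod_cons,
      mul_assoc (P i), mul_assoc (P i), ← mul_assoc (powSum (U i) (n i)), c.eq, mul_assoc]

end Orthants

/-! ### Iterated shift sums as sums over boxes of indices. -/

section BoxSums

variable {d : ℕ} {E : Type*}

lemma sum_piFinset_cons {i : Fin d} {l : List (Fin d)} (hi : i ∉ l) (n : Fin d → ℕ)
    (G : (Fin d → ℤ) → ℝ) :
    ∑ k ∈ Fintype.piFinset fun j => if j ∈ i :: l then Finset.Ico 0 (n j : ℤ) else {0}, G k =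
      ∑ m ∈ Finset.range (n i), ∑ k ∈ Fintype.piFinset fun j =>
        if j ∈ l then Finset.Ico 0 (n j : ℤ) else {0}, G (k + Pi.single i (m : ℤ)) := by
  rw [← Finset.sum_product']
  refine Finset.sum_bij' (fun k _ => ((k i).toNat, Function.update k i 0))
    (fun p _ => p.2 + Pi.single i (p.1 : ℤ)) ?_ ?_ ?_ ?_ ?_
  · intro k hk
    rw [Fintype.mem_piFinset] at hk
    have h1 := hk i
    simp only [List.mem_cons, true_or, if_true, Finset.mem_Ico] at h1
    rw [Finset.mem_product, Finset.mem_range, Fintype.mem_piFinset]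
    refine ⟨by simp only; omega, fun j => ?_⟩
    by_cases hj : j = i
    · subst hj; simp [hi]
    · simpa [hj] using hk j
  · rintro ⟨m, k⟩ hp
    simp only [Finset.mem_product, Finset.mem_range, Fintype.mem_piFinset] at hp
    rw [Fintype.mem_piFinset]
    intro j
    have h1 := hp.2 j
    by_cases hj : j = i
    · subst hj
      simp only [hi, if_false, Finset.mem_singleton] at h1
      simp [h1, hp.1]
    · simpa [hj] using h1
  · intro k hk
    rw [Fintype.mem_piFinset] at hk
    have h1 := hk i
    simp only [List.mem_cons, true_or, if_true, Finset.mem_Ico] at h1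
    ext j
    by_cases hj : j = i
    · subst hj; simp [h1.1]
    · simp [hj]
  · rintro ⟨m, k⟩ hp
    simp only [Finset.mem_product, Finset.mem_range, Fintype.mem_piFinset] at hp
    have h1 := hp.2 i
    simp only [hi, if_false, Finset.mem_singleton] at h1
    refine Prod.ext (by simp [h1]) (funext fun j => ?_)
    by_cases hj : j = i
    · subst hj; simp [h1]
    · simp [hj]
  · intro k hk
    rw [Fintype.mem_piFinset] at hk
    have h1 := hk i
    simp only [List.mem_cons, true_or, if_true, Finset.mem_Ico] at h1
    congr 1
    ext j
    by_cases hj : j = i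
    · subst hj; simp [h1.1]
    · simp [hj]

lemma boxBirkhoffSum_shift {l : List (Fin d)} (hl : l.Nodup) (n : Fin d → ℕ)
    (F : ((Fin d → ℤ) → E) → ℝ) (x : (Fin d → ℤ) → E) :
    boxBirkhoffSum (fun i => shift i) l n F x =
      ∑ k ∈ Fintype.piFinset fun j => if j ∈ l then Finset.Ico 0 (n j : ℤ) else {0},
        F fun j => x (j + k) := by
  induction l generalizing x with
  | nil =>
    simp [boxBirkhoffSum]
    exact congrArg F (funext fun j => congrArg x (by ext; simp))
  | cons i l ih =>
    obtain ⟨hi, hl⟩ := List.nodup_cons.1 hl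
    rw [sum_piFinset_cons hi]
    simp only [boxBirkhoffSum, birkhoffSum]
    refine Finset.sum_congr rfl fun m _ => ?_
    rw [ih hl, shift_iterate]
    simp only [add_assoc]

/-- Iterates of shifts count from `0` whereas the box starts at `1`; the difference is absorbed by
translating the path by `1`. -/
lemma partialSum_field_eq [NeZero d] {Ω : Type*} (f : (Set.Iic (0 : Fin d → ℤ) → E) → ℝ)
    (ξ : (Fin d → ℤ) → Ω → E) (n : Fin d → ℤ) (ω : Ω) :
    partialSum (field f ξ) n ω = boxBirkhoffSum (fun i => shift i) (coordList d)
      (fun i => (n i).toNat) (fun x => f fun j => x j) (path (fun j => ξ (j + 1)) ω) := by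
  rw [boxBirkhoffSum_shift coordList_nodup, partialSum]
  refine Finset.sum_bij' (fun k _ => k - 1) (fun k _ => k + 1) ?_ ?_ ?_ ?_ ?_
  · intro k hk
    simp only [Finset.mem_Icc, Pi.le_def] at hk
    simp only [Fintype.mem_piFinset, mem_coordList, if_true, Finset.mem_Ico]
    intro i
    have h1 := hk.1 i
    have h2 := hk.2 i
    simp only [Pi.one_apply, Pi.sub_apply] at h1 ⊢
    omega
  · intro k hk
    simp only [Fintype.mem_piFinset, mem_coordList, if_true, Finset.mem_Ico] at hk
    simp only [Finset.mem_Icc, Pi.le_def]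
    refine ⟨fun i => ?_, fun i => ?_⟩ <;>
    · have h1 := hk i
      simp only [Pi.one_apply, Pi.add_apply]
      omega
  · intro k _; simp
  · intro k _; simp
  · intro k _
    simp only [field, path]
    congr 1
    ext j
    rw [show k + (j : Fin d → ℤ) = j + (k - 1) + 1 by abel]

end BoxSums

/-! ### Transfer between the probability space and the law of the field. -/

section Transfer

lemma integral_comp_measurePreserving {α β G : Type*} {mα : MeasurableSpace α}
    {mβ : MeasurableSpace β} {μ : Measure α} {ν : Measure β} [NormedAddCommGroup G]
    [NormedSpace ℝ G] {φ : α → β} (hφ : MeasurePreserving φ μ ν) {v : β → ℝ}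
    (hv : AEStronglyMeasurable v ν) {s : α → ℝ} (hs : s =ᵐ[μ] v ∘ φ) {ψ : ℝ → G}
    (hψ : Continuous ψ) : ∫ ω, ψ (s ω) ∂μ = ∫ x, ψ (v x) ∂ν := by
  have h1 : ∫ ω, ψ (s ω) ∂μ = ∫ ω, ψ (v (φ ω)) ∂μ := integral_congr_ae (by
    filter_upwards [hs] with ω e
    rw [e, Function.comp_apply])
  rw [h1, ← hφ.map_eq, integral_map hφ.aemeasurable]
  rw [hφ.map_eq]
  exact hψ.comp_aestronglyMeasurable hv

/-- Lévy's continuity theorem for random variables indexed by a countably generated filter. -/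
lemma tendstoInDistribution_gaussianReal {κ Ω : Type*} {mΩ : MeasurableSpace Ω} {μ : Measure Ω}
    [IsProbabilityMeasure μ] {l : Filter κ} [l.IsCountablyGenerated] {Z : κ → Ω → ℝ}
    (hZ : ∀ n, AEMeasurable (Z n) μ) {c : ℝ}
    (h : ∀ t : ℝ, Tendsto (fun n => ∫ ω, Complex.exp ((t * Z n ω : ℝ) * Complex.I) ∂μ) l
      (𝓝 (Real.exp (-(t ^ 2 * c ^ 2 / 2)) : ℝ))) :
    TendstoInDistribution Z l (id : ℝ → ℝ) (fun _ => μ) (gaussianReal 0 (c ^ 2).toNNReal) := by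
  -- A countably generated filter is tested along sequences, to which the continuity theorem
  -- applies.
  refine ⟨hZ, aemeasurable_id, tendsto_of_seq_tendsto fun x hx => ?_⟩
  refine ProbabilityMeasure.tendsto_iff_tendsto_charFun.2 fun t => ?_
  change Tendsto (fun n => charFun (μ.map (Z (x n))) t) atTop
    (𝓝 (charFun ((gaussianReal 0 (c ^ 2).toNNReal).map id) t))
  rw [Measure.map_id, charFun_gaussianReal]
  have e : Complex.exp (t * (0 : ℝ) * Complex.I - ((c ^ 2).toNNReal : ℝ) * t ^ 2 / 2) =
      ((Real.exp (-(t ^ 2 * c ^ 2 / 2)) : ℝ) : ℂ) := by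
    rw [Real.coe_toNNReal _ (sq_nonneg c), Complex.ofReal_exp]
    congr 1
    push_cast
    ring
  refine (((h t).comp hx).congr fun n => ?_).trans_eq (congrArg 𝓝 e.symm)
  rw [charFun_apply_real, integral_map (hZ _) (by fun_prop)]
  simp

variable {d : ℕ} {Ω E : Type*} [MeasurableSpace Ω] [MeasurableSpace E] {μ : Measure Ω}
  {ξ : (Fin d → ℤ) → Ω → E}

lemma measurable_path (hξ : ∀ j, Measurable (ξ j)) : Measurable (path ξ) :=
  measurable_pi_lambda _ hξ

lemma measurePreserving_path (hξ : ∀ j, Measurable (ξ j)) (hstat : IsStationary μ ξ)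
    (k : Fin d → ℤ) : MeasurePreserving (path fun j => ξ (j + k)) μ (μ.map (path ξ)) :=
  ⟨measurable_path fun j => hξ (j + k), hstat k⟩

lemma map_shift_eq (hξ : ∀ j, Measurable (ξ j)) (hstat : IsStationary μ ξ) (i : Fin d) :
    (μ.map (path ξ)).map (shift i) = μ.map (path ξ) := by
  rw [Measure.map_map (measurable_shift i) (measurable_path hξ)]
  exact hstat (Pi.single i 1)

omit [MeasurableSpace Ω] in
lemma comap_path_Iic (ξ : (Fin d → ℤ) → Ω → E) (k : Fin d → ℤ) :
    (coordField E (Set.Iic k)).comap (path ξ) = sigmaField ξ k := by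
  simp only [coordField, MeasurableSpace.comap_iSup, MeasurableSpace.comap_comp]
  rfl

variable [IsProbabilityMeasure μ] [NeZero d]

lemma IsCommuting.isOrthantCommuting (hξ : ∀ j, Measurable (ξ j)) (h : IsCommuting μ ξ) :
    IsOrthantCommuting (μ.map (path ξ)) := by
  intro Y hY k l hkl
  have hφ : MeasurePreserving (path ξ) μ (μ.map (path ξ)) :=
    ⟨measurable_path hξ, rfl⟩
  have : IsProbabilityMeasure (μ.map (path ξ)) := Measure.isProbabilityMeasure_map hφ.aemeasurable
  have hc : ∀ (Z : ((Fin d → ℤ) → E) → ℝ), Integrable Z (μ.map (path ξ)) → ∀ k,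
      μ[Z ∘ path ξ | sigmaField ξ k] =ᵐ[μ]
        (μ.map (path ξ))[Z | coordField E (Set.Iic k)] ∘ path ξ := fun Z hZ k => by
    rw [← comap_path_Iic]
    exact condExp_comp_measurePreserving hφ (coordField_le _) hZ
  have h1 := h (Y ∘ path ξ) (hφ.integrable_comp_of_integrable hY) k l hkl
  have h2 := (condExp_congr_ae (hc Y hY k)).symm.trans h1
  have h3 := ((hc _ integrable_condExp l).symm.trans h2).trans (hc Y hY (k ⊓ l))
  have hm : ∀ (Z : ((Fin d → ℤ) → E) → ℝ) (k : Fin d → ℤ),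
      Measurable ((μ.map (path ξ))[Z | coordField E (Set.Iic k)]) := fun Z k =>
    (stronglyMeasurable_condExp.mono (coordField_le _)).measurable
  exact (ae_map_iff hφ.aemeasurable (measurableSet_eq_fun (hm _ _) (hm _ _))).2 h3

omit [NeZero d] in
lemma measurable_restrict {f : (Set.Iic (0 : Fin d → ℤ) → E) → ℝ} (hf : Measurable f) :
    Measurable[coordField E (Set.Iic 0)] fun x : (Fin d → ℤ) → E => f fun j => x j := by
  refine hf.comp ?_
  refine @measurable_pi_lambda _ _ _ (coordField E (Set.Iic 0)) _ _ fun j => ?_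
  exact measurable_apply_coordField j.2

end Transfer

/-! ### The summability hypothesis in operator form. -/

section Main

variable {d : ℕ} {Ω E : Type*}

lemma field_eq_comp_path (f : (Set.Iic (0 : Fin d → ℤ) → E) → ℝ) (ξ : (Fin d → ℤ) → Ω → E)
    (k : Fin d → ℤ) :
    field f ξ k = (fun x : (Fin d → ℤ) → E => f fun j => x j) ∘ path fun j => ξ (j + k) := by
  ext ω
  simp only [field, Function.comp_apply, path, add_comm k]

lemma partialSum_one (X : (Fin d → ℤ) → Ω → ℝ) : partialSum X 1 = X 1 := by
  ext ω
  simp [partialSum]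

lemma size_eq_boxSize [NeZero d] {n : Fin d → ℤ} (hn : 0 ≤ n) :
    size n = boxSize (coordList d) fun i => (n i).toNat := by
  rw [boxSize, prod_map_coordList, size]
  refine Finset.prod_congr rfl fun i _ => ?_
  have h1 : (((n i).toNat : ℤ) : ℝ) = n i := by rw [Int.toNat_of_nonneg (hn i)]
  exact_mod_cast h1.symm

lemma tendsto_toNat_atTop :
    Tendsto (fun (n : Fin d → ℤ) i => (n i).toNat) atTop (atTop : Filter (Fin d → ℕ)) :=
  tendsto_atTop_atTop.2 fun b => ⟨fun i => b i, fun n hn i => by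
    have := hn i
    simp only at this ⊢
    omega⟩

variable [MeasurableSpace Ω] [MeasurableSpace E] {μ : Measure Ω} {ξ : (Fin d → ℤ) → Ω → E}

/-- Finiteness at the index `1` in the summability condition. -/
lemma memLp_two_of_tsum [IsProbabilityMeasure μ] {ν : Measure ((Fin d → ℤ) → E)} (hξ : ∀ j, Measurable (ξ j))
    (hφ : MeasurePreserving (path fun j => ξ (j + 1)) μ ν)
    {f : (Set.Iic (0 : Fin d → ℤ) → E) → ℝ} (hf : Measurable f)
    (hint : Integrable (fun x : (Fin d → ℤ) → E => f fun j => x j) ν)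
    (hproj : ∑' u : Set.Ici (1 : Fin d → ℤ),
      ENNReal.ofReal (1 / size (u : Fin d → ℤ) ^ (3 / 2 : ℝ)) *
        eLpNorm (μ[partialSum (field f ξ) u | sigmaField ξ 1]) 2 μ ≠ ⊤) :
    MemLp (fun x : (Fin d → ℤ) → E => f fun j => x j) 2 ν := by
  -- At `u = 1` the weight is one and the conditional expectation is `X_1` itself, so a finite sum
  -- forces square integrability.
  have h1 := ENNReal.ne_top_of_tsum_ne_top hproj ⟨1, Set.mem_Ici.2 le_rfl⟩
  have hm := measurable_restrict hf
  have hle : sigmaField ξ 1 ≤ (inferInstance : MeasurableSpace Ω) :=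
    iSup₂_le fun u _ => (hξ u).comap_le
  have h2 : μ[partialSum (field f ξ) 1 | sigmaField ξ 1] = partialSum (field f ξ) 1 := by
    rw [partialSum_one, field_eq_comp_path]
    refine condExp_of_stronglyMeasurable hle ?_ (hφ.integrable_comp_of_integrable hint)
    refine (hm.comp (Measurable.of_comap_le ?_)).stronglyMeasurable
    exact (comap_path_coordField ξ 1).le
  have hs : size (1 : Fin d → ℤ) = 1 := by simp [size]
  simp only [h2, hs] at h1
  rw [partialSum_one, field_eq_comp_path, eLpNorm_comp_measurePreserving hint.1 hφ] at h1
  refine ⟨hint.1, lt_top_iff_ne_top.2 ?_⟩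
  simpa using h1

variable [NeZero d] {ν : Measure ((Fin d → ℤ) → E)}

lemma partialSum_ae_eq (hS : IsShiftSystem ν (fun i => shift i) fun i => coordField E (lowerSet [i]))
    (hφ : MeasurePreserving (path fun j => ξ (j + 1)) μ ν)
    {f : (Set.Iic (0 : Fin d → ℤ) → E) → ℝ}
    (hF : MemLp (fun x : (Fin d → ℤ) → E => f fun j => x j) 2 ν) (n : Fin d → ℤ) :
    partialSum (field f ξ) n =ᵐ[μ] boxSum hS.koopman (coordList d) (fun i => (n i).toNat)
      (hF.toLp _) ∘ path fun j => ξ (j + 1) := by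
  have h1 := (hS.coeFn_boxSum (hF.toLp _) (coordList d) fun i => (n i).toNat).trans
    (hS.boxBirkhoffSum_congr_ae hF.coeFn_toLp _ _)
  refine EventuallyEq.trans (Eventually.of_forall fun ω => ?_)
    (hφ.quasiMeasurePreserving.ae_eq_comp h1).symm
  exact partialSum_field_eq f ξ n ω

variable [IsProbabilityMeasure μ] [IsProbabilityMeasure ν]

/-- The projection on `ℱ_1`, seen from index `1`, is the product of the half-space projections by
`prod_coordList`, and these distribute over the one-directional sums. -/
lemma eLpNorm_condExp_partialSum (hO : IsOrthantCommuting ν)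
    (hS : IsShiftSystem ν (fun i => shift i) fun i => coordField E (lowerSet [i]))
    (hφ : MeasurePreserving (path fun j => ξ (j + 1)) μ ν)
    {f : (Set.Iic (0 : Fin d → ℤ) → E) → ℝ}
    (hF : MemLp (fun x : (Fin d → ℤ) → E => f fun j => x j) 2 ν) (n : Fin d → ℤ) :
    eLpNorm (μ[partialSum (field f ξ) n | sigmaField ξ 1]) 2 μ =
      ‖((coordList d).map fun i => hS.condProj i * powSum (hS.koopman i) (n i).toNat).prod
        (hF.toLp _)‖ₑ := by
  have h := hS.isShiftProjSystem hO.commute_condProj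
  rw [h.prod_map_mul coordList_nodup fun i => (n i).toNat, hO.prod_coordList, mul_apply_eq_comp,
    Lp.enorm_def]
  set u := boxSum hS.koopman (coordList d) (fun i => (n i).toNat) (hF.toLp _) with hu
  have h1 : μ[partialSum (field f ξ) n | sigmaField ξ 1] =ᵐ[μ]
      ν[u | coordField E (Set.Iic 0)] ∘ path fun j => ξ (j + 1) := by
    refine (condExp_congr_ae (partialSum_ae_eq hS hφ hF n)).trans ?_
    rw [← comap_path_coordField]
    exact condExp_comp_measurePreserving hφ (coordField_le _) (integrable_coeFn u)
  rw [eLpNorm_congr_ae h1, eLpNorm_comp_measurePreserving integrable_condExp.1 hφ]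
  exact eLpNorm_congr_ae (coeFn_condProj _ u).symm

lemma nestedSum_ne_top (hO : IsOrthantCommuting ν)
    (hS : IsShiftSystem ν (fun i => shift i) fun i => coordField E (lowerSet [i]))
    (hφ : MeasurePreserving (path fun j => ξ (j + 1)) μ ν)
    {f : (Set.Iic (0 : Fin d → ℤ) → E) → ℝ}
    (hF : MemLp (fun x : (Fin d → ℤ) → E => f fun j => x j) 2 ν)
    (hproj : ∑' u : Set.Ici (1 : Fin d → ℤ),
      ENNReal.ofReal (1 / size (u : Fin d → ℤ) ^ (3 / 2 : ℝ)) *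
        eLpNorm (μ[partialSum (field f ξ) u | sigmaField ξ 1]) 2 μ ≠ ⊤) :
    nestedSum dyadicWeight (fun i j => hS.condProj i * powSum (hS.koopman i) (2 ^ j))
      (coordList d) (hF.toLp _) ≠ ⊤ := by
  have h := hS.isShiftProjSystem hO.commute_condProj
  refine ne_top_of_le_ne_top (ENNReal.mul_ne_top (by finiteness) (ne_top_of_le_ne_top hproj ?_))
    (h.nestedSum_dyadic_le (coordList d) (hF.toLp _))
  rw [nestedSum_eq_tsum coordList_nodup (fun i j _ m n => h.commute_proj_powSum i j _ _) _ 0]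
  -- The index `u = v + 1` matches the weights `(n + 1)^(-3/2)`; injectivity suffices for the
  -- comparison.
  set e : (Fin d → ℕ) → Set.Ici (1 : Fin d → ℤ) := fun v => ⟨fun i => v i + 1, fun i => by simp⟩
    with he
  have hinj : Function.Injective e := fun v w hvw => by
    ext i
    have := congrFun (congrArg Subtype.val hvw) i
    simpa [he] using this
  refine le_trans (ENNReal.tsum_le_tsum fun v => ?_) (ENNReal.tsum_comp_le_tsum_of_injective hinj _)
  rw [if_pos fun j hj => absurd (mem_coordList j) hj, eLpNorm_condExp_partialSum hO hS hφ hF,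
    prod_map_coordList]
  have e1 : ∏ i, projWeight (v i) = ENNReal.ofReal (1 / size (e v : Fin d → ℤ) ^ (3 / 2 : ℝ)) := by
    simp only [projWeight, size, he]
    rw [← ENNReal.ofReal_prod_of_nonneg fun i _ => by positivity,
      ← Real.finsetProd_rpow _ _ fun i _ => by positivity]
    simp
  have e2 : ∀ i, ((e v : Fin d → ℤ) i).toNat = v i + 1 := fun i => by
    simp only [he]; omega
  rw [e1]
  simp only [e2]
  exact le_rfl

end Main

end RandomField

theorem mainTheorem2 {d : ℕ} [NeZero d] {Ω E : Type*} [MeasurableSpace Ω] [MeasurableSpace E]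
    (μ : Measure Ω) [IsProbabilityMeasure μ]
    (ξ : (Fin d → ℤ) → Ω → E) (hξ : ∀ j, Measurable (ξ j))
    (hstat : RandomField.IsStationary μ ξ)
    (hcomm : RandomField.IsCommuting μ ξ)
    (herg : Ergodic (RandomField.shift (0 : Fin d)) (μ.map (RandomField.path ξ)))
    (f : (Set.Iic (0 : Fin d → ℤ) → E) → ℝ) (hf : Measurable f)
    (X : (Fin d → ℤ) → Ω → ℝ) (hX : X = RandomField.field f ξ) (hint : Integrable (X 0) μ)
    (S : (Fin d → ℤ) → Ω → ℝ) (hS : S = RandomField.partialSum X)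
    (hproj : ∑' u : Set.Ici (1 : Fin d → ℤ),
      ENNReal.ofReal (1 / RandomField.size (u : Fin d → ℤ) ^ (3 / 2 : ℝ)) *
        eLpNorm (μ[S u | RandomField.sigmaField ξ 1]) 2 μ < ⊤) :
    ∃ c : ℝ,
      (∀ n, MemLp (S n) 2 μ) ∧
      Tendsto (fun n : Fin d → ℤ => (1 / RandomField.size n) * ∫ ω, S n ω ^ 2 ∂μ)
        atTop (𝓝 (c ^ 2)) ∧
      TendstoInDistribution (fun (n : Fin d → ℤ) ω => (1 / √(RandomField.size n)) * S n ω)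
        atTop (id : ℝ → ℝ) (fun _ => μ) (gaussianReal 0 (c ^ 2).toNNReal) := by
  subst hX hS
  -- The translate by `1` carries the partial sums, the one by `0` the integrability of `X 0`; by
  -- stationarity both have the same law.
  have hφ := RandomField.measurePreserving_path hξ hstat 1
  have hφ0 := RandomField.measurePreserving_path hξ hstat 0
  have hprob := Measure.isProbabilityMeasure_map (μ := μ)
    (RandomField.measurable_path hξ).aemeasurable
  have hO := hcomm.isOrthantCommuting hξ
  have hsys := RandomField.isShiftSystem_shift (RandomField.map_shift_eq hξ hstat)
  have hm := RandomField.measurable_restrict hf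
  have hFi : Integrable (fun x : (Fin d → ℤ) → E => f fun j => x j)
      (μ.map (RandomField.path ξ)) := by
    rw [RandomField.field_eq_comp_path] at hint
    exact (hφ0.integrable_comp
      (hm.mono (RandomField.coordField_le _) le_rfl).aestronglyMeasurable).1 hint
  have hF := RandomField.memLp_two_of_tsum hξ hφ hf hFi hproj.ne
  have hfin := RandomField.nestedSum_ne_top hO hsys hφ hF hproj.ne
  have hPF : ∀ i ∈ RandomField.coordList d, hsys.condProj i (hF.toLp _) = hF.toLp _ := by
    intro i _
    refine Lp.ext ((RandomField.coeFn_condProj _ _).trans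
      ((condExp_congr_ae hF.coeFn_toLp).trans (EventuallyEq.trans ?_ hF.coeFn_toLp.symm)))
    rw [condExp_of_stronglyMeasurable (RandomField.coordField_le _) _ hFi]
    refine (hm.mono (RandomField.coordField_mono
      (t := RandomField.lowerSet [i]) fun u hu j _ => hu j) le_rfl).stronglyMeasurable
  obtain ⟨c, hc, hchar⟩ := hsys.exists_clt hO.commute_condProj herg
    RandomField.coordList_nodup hPF hfin
  have hae := RandomField.partialSum_ae_eq hsys hφ hF
  have hmem : ∀ n, MemLp (RandomField.partialSum (RandomField.field f ξ) n) 2 μ := fun n =>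
    ((Lp.memLp _).comp_measurePreserving hφ).ae_eq (hae n).symm
  refine ⟨c, hmem, ?_, RandomField.tendstoInDistribution_gaussianReal
    (fun n => (hmem n).1.aemeasurable.const_mul _) fun t => ?_⟩
  · refine ((hc.comp RandomField.tendsto_toNat_atTop).pow 2).congr' ?_
    -- For `n ≥ 0` the passage to natural numbers by `toNat` loses nothing.
    filter_upwards [eventually_ge_atTop 0] with n hn
    rw [RandomField.integral_comp_measurePreserving hφ (Lp.aestronglyMeasurable _) (hae n)
      (ψ := fun x => x ^ 2) (by fun_prop), ← RandomField.norm_sq_eq_integral,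
      RandomField.size_eq_boxSize hn, Function.comp_apply, div_pow,
      Real.sq_sqrt (RandomField.boxSize_nonneg _ _), one_div, div_eq_inv_mul]
    rfl
  · refine ((hchar t).comp RandomField.tendsto_toNat_atTop).congr' ?_
    filter_upwards [eventually_ge_atTop 0] with n hn
    rw [RandomField.integral_comp_measurePreserving hφ (Lp.aestronglyMeasurable _) (hae n)
      (ψ := fun x => Complex.exp ((t * (1 / √(RandomField.size n) * x) : ℝ) * Complex.I))
      (by fun_prop), RandomField.size_eq_boxSize hn]
    simp only [Function.comp_apply, ← mul_assoc, mul_one_div]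
    rfl
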